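/- Let $1\le n\le d$ be integers and let $\mu$ be a Radon measure on $\mathbb R^d$ with $\mu(B(x,r))\le C_0 r^n$ for all $x\in\mathbb R^d$, $r>0$, where $C_0$ is a constant. Functions are real-valued. A cube is a closed cube with sides parallel to the axes, of side length $l(Q)>0$, centred at a point of $\operatorname{supp}\mu$; if $\mu(\mathbb R^d)<\infty$, also $\mathbb R^d$ itself counts as a cube (with $tQ=Q$ for $Q=\mathbb R^d$). For cubes $Q\subset R$ put $$K_{Q,R}=1+\sum_{k=1}^{N_{Q,R}}\frac{\mu(2^kQ)}{l(2^kQ)^n},$$ where $N_{Q,R}$ is the first integer $k\ge 0$ with $l(2^kQ)\ge l(R)$, $N_{Q,R}=\infty$ if $R=\mathbb R^d\ne Q$, and $K_{Q,R}=1$ if $Q=R=\mathbb R^d$. Fix $\beta>2^d$; a cube $Q$ is doubling if $\mu(2Q)\le\beta\mu(Q)$, and $\widetilde Q=2^NQ$ with $N\ge0$ the least integer such that $2^NQ$ is doubling. Write $m_Qf$ for the $\mu$-mean of $f$ over $Q$. $\mathrm{RBMO}(\mu)$ is the space, modulo constants, of all $f\in L^1_{loc}(\mu)$ for which there is $C\ge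 0$ with $$\int_Q|f-m_{\widetilde Q}f|\,d\mu\le C\,\mu(2Q)\ \text{ for all cubes }Q,\qquad |m_Qf-m_Rf|\le C\,K_{Q,R}\ \text{ for all doubling cubes }Q\subset R,$$ normed by the least such $C$. An atomic block is a function $b\in L^1(\mu)$, vanishing $\mu$-a.e. outside a cube $R$, with $\int b\,d\mu=0$, which can be written $b=\sum_{j\ge1}\lambda_ja_j$ $\mu$-a.e., where $\lambda_j\in\mathbb R$, $\sum_j|\lambda_j|<\infty$, and each $a_j$ is a measurable function vanishing $\mu$-a.e. outside a cube $Q_j\subset R$ with $\|a_j\|_{L^\infty(\mu)}\le(\mu(2Q_j)K_{Q_j,R})^{-1}$; put $|b|=\sum_j|\lambda_j|$ (this depends on the decomposition). $H^{1,\infty}_{atb}(\mu)$ is the space of all $f=\sum_i b_i$ ($\mu$-a.e.) with atomic blocks $b_i$ such that $\sum_i|b_i|<\infty$, normed by $\inf\sum_i|b_i|$ over all such decompositions. **Theorem.** Let $T$ be a linear operator that is bounded from $H^{1,\infty}_{atb}(\mu)$ into $L^1(\mu)$ and from $L^\infty(\mu)$ into $\mathrm{RBMO}(\mu)$; that is,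 $T$ is given by bounded linear maps $H^{1,\infty}_{atb}(\mu)\to L^1(\mu)$ and $L^\infty(\mu)\to\mathrm{RBMO}(\mu)$ that agree, modulo constants, on $H^{1,\infty}_{atb}(\mu)\cap L^\infty(\mu)$. Then for every $1<p<\infty$, $T$ extends boundedly to $L^p(\mu)$: there is a bounded linear operator $S$ on $L^p(\mu)$ such that $Sf=Tf$ $\mu$-a.e. for all $f\in L^p(\mu)\cap H^{1,\infty}_{atb}(\mu)$, and $Sf=Tf$ modulo constants for all $f\in L^p(\mu)\cap L^\infty(\mu)$. -/

import Mathlib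

open MeasureTheory
open scoped ENNReal

noncomputable section

namespace NonDoubling

/-- Closed cubes of `ℝ^d` with sides parallel to the axes, given by centre and side length,
together with the whole space `ℝ^d` (which counts as a cube for finite measures). -/
inductive Cube (d : ℕ) where
  | box (center : EuclideanSpace ℝ (Fin d)) (side : ℝ) : Cube d
  | whole : Cube d

variable {d : ℕ}

/-- The underlying set of points of a cube. -/
def Cube.toSet : Cube d → Set (EuclideanSpace ℝ (Fin d))
  | .box c l => {x | ∀ i, |x i - c i| ≤ l / 2}
  | .whole => Set.univ

/-- The concentric dilate `t Q`. -/
def Cube.dilate (t : ℝ) : Cube d → Cube d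
  | .box c l => .box c (t * l)
  | .whole => .whole

/-- The cubes that are used: nondegenerate cubes centred at a point of `supp μ`, and the whole
space if `μ` is finite. -/
def Cube.Admissible (μ : Measure (EuclideanSpace ℝ (Fin d))) : Cube d → Prop
  | .box c l => c ∈ μ.support ∧ 0 < l
  | .whole => μ Set.univ < ∞

/-- Growth of degree `n`: `μ (B(x,r)) ≤ C₀ r ^ n` for all `x` and all `r > 0`. -/
def HasGrowth (n : ℕ) (μ : Measure (EuclideanSpace ℝ (Fin d))) : Prop :=
  ∃ C₀ : ℝ, ∀ (x : EuclideanSpace ℝ (Fin d)) (r : ℝ), 0 < r →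
    μ (Metric.ball x r) ≤ ENNReal.ofReal (C₀ * r ^ n)

/-- The coefficient `K_{Q,R} = 1 + ∑_{k=1}^{N} μ(2^k Q) / l(2^k Q)^n` for cubes `Q ⊆ R`, where `N`
is the first integer `k ≥ 0` with `l(2^k Q) ≥ l(R)`, and `N = ∞` if `R = ℝ^d ≠ Q`. -/
def K (n : ℕ) (μ : Measure (EuclideanSpace ℝ (Fin d))) : Cube d → Cube d → ℝ
  | .box c l, .box _ r =>
      1 + ∑ k ∈ Finset.Icc 1 (sInf {k : ℕ | r ≤ 2 ^ k * l}),
        μ.real (Cube.box c (2 ^ k * l)).toSet / (2 ^ k * l) ^ n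
  | .box c l, .whole =>
      1 + ∑' k : ℕ, μ.real (Cube.box c (2 ^ (k + 1) * l)).toSet / (2 ^ (k + 1) * l) ^ n
  | .whole, _ => 1

/-- `Q` is `(2,β)`-doubling: `μ(2Q) ≤ β μ(Q)`. For every `β > 2^d` and every Radon measure, almost
every point is the centre of arbitrarily small `(2,β)`-doubling cubes; Lebesgue measure shows that
no `β < 2^d` has this property. -/
def Cube.Doubling (β : ℝ) (μ : Measure (EuclideanSpace ℝ (Fin d))) (Q : Cube d) : Prop :=
  μ.real (Q.dilate 2).toSet ≤ β * μ.real Q.toSet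

/-- The cube `Q̃ = 2^N Q`, where `N ≥ 0` is the smallest integer such that `2^N Q` is doubling. -/
def Cube.tilde (β : ℝ) (μ : Measure (EuclideanSpace ℝ (Fin d))) (Q : Cube d) : Cube d :=
  Q.dilate (2 ^ sInf {N : ℕ | (Q.dilate (2 ^ N)).Doubling β μ})

/-- The mean `m_Q f`. -/
def mean (μ : Measure (EuclideanSpace ℝ (Fin d))) (Q : Cube d)
    (f : EuclideanSpace ℝ (Fin d) → ℝ) : ℝ :=
  ⨍ x in Q.toSet, f x ∂μ

/-- `C` is an admissible constant in the definition of `RBMO(μ)` for the function `f`. -/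
structure RBMOBound (n : ℕ) (β : ℝ) (μ : Measure (EuclideanSpace ℝ (Fin d)))
    (f : EuclideanSpace ℝ (Fin d) → ℝ) (C : ℝ) : Prop where
  nonneg : 0 ≤ C
  locallyIntegrable : LocallyIntegrable f μ
  /-- The integrability clause only has content for `Q = ℝ^d`, where it says that the integral in
  the second clause is finite. -/
  oscillation : ∀ Q : Cube d, Q.Admissible μ → IntegrableOn f Q.toSet μ ∧
    ∫ x in Q.toSet, |f x - mean μ (Q.tilde β μ) f| ∂μ ≤ C * μ.real (Q.dilate 2).toSet
  regularity : ∀ Q R : Cube d, Q.Admissible μ → R.Admissible μ → Q.Doubling β μ →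
    R.Doubling β μ → Q.toSet ⊆ R.toSet → |mean μ Q f - mean μ R f| ≤ C * K n μ Q R

/-- `f` belongs to `RBMO(μ)`. -/
def MemRBMO (n : ℕ) (β : ℝ) (μ : Measure (EuclideanSpace ℝ (Fin d)))
    (f : EuclideanSpace ℝ (Fin d) → ℝ) : Prop :=
  ∃ C : ℝ, RBMOBound n β μ f C

/-- The norm `‖f‖_*` of `RBMO(μ)`: the minimal admissible constant. -/
def rbmoNorm (n : ℕ) (β : ℝ) (μ : Measure (EuclideanSpace ℝ (Fin d)))
    (f : EuclideanSpace ℝ (Fin d) → ℝ) : ℝ :=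
  sInf {C : ℝ | RBMOBound n β μ f C}

/-- The constant functions (as classes of functions modulo `μ`-null sets). -/
def constants (μ : Measure (EuclideanSpace ℝ (Fin d))) :
    Submodule ℝ (EuclideanSpace ℝ (Fin d) →ₘ[μ] ℝ) :=
  Submodule.span ℝ {AEEqFun.const (EuclideanSpace ℝ (Fin d)) (1 : ℝ)}

/-- `b` is an atomic block, with a decomposition `b = ∑ λ_j a_j` for which `∑ |λ_j| = c`. -/
def IsAtomicBlock (n : ℕ) (μ : Measure (EuclideanSpace ℝ (Fin d)))
    (b : EuclideanSpace ℝ (Fin d) → ℝ) (c : ℝ) : Prop :=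
  ∃ R : Cube d, R.Admissible μ ∧ (∀ᵐ x ∂μ, x ∉ R.toSet → b x = 0) ∧
    Integrable b μ ∧ ∫ x, b x ∂μ = 0 ∧
    ∃ (coef : ℕ → ℝ) (Q : ℕ → Cube d) (a : ℕ → EuclideanSpace ℝ (Fin d) → ℝ),
      (∀ j, (Q j).Admissible μ ∧ (Q j).toSet ⊆ R.toSet ∧ AEStronglyMeasurable (a j) μ ∧
        (∀ᵐ x ∂μ, x ∉ (Q j).toSet → a j x = 0) ∧
        (∀ᵐ x ∂μ, |a j x| ≤ (μ.real ((Q j).dilate 2).toSet * K n μ (Q j) R)⁻¹)) ∧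
      HasSum (fun j => |coef j|) c ∧
      ∀ᵐ x ∂μ, HasSum (fun j => coef j * a j x) (b x)

/-- `f` is a sum of atomic blocks `b_i` with `∑ |b_i| = s`. -/
def HasAtomicBlockSum (n : ℕ) (μ : Measure (EuclideanSpace ℝ (Fin d)))
    (f : EuclideanSpace ℝ (Fin d) → ℝ) (s : ℝ) : Prop :=
  ∃ (b : ℕ → EuclideanSpace ℝ (Fin d) → ℝ) (c : ℕ → ℝ),
    (∀ i, IsAtomicBlock n μ (b i) (c i)) ∧ HasSum c s ∧
      ∀ᵐ x ∂μ, HasSum (fun i => b i x) (f x)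

/-- The `H^{1,∞}_{atb}(μ)` norm. -/
def atbNorm (n : ℕ) (μ : Measure (EuclideanSpace ℝ (Fin d)))
    (f : EuclideanSpace ℝ (Fin d) → ℝ) : ℝ :=
  sInf {s : ℝ | HasAtomicBlockSum n μ f s}

theorem exists_admissible (μ : Measure (EuclideanSpace ℝ (Fin d))) :
    ∃ Q : Cube d, Q.Admissible μ := by
  by_cases h : μ Set.univ < ∞
  · exact ⟨.whole, h⟩
  · have h0 : μ ≠ 0 := by
      rintro rfl
      simp at h
    obtain ⟨x, hx⟩ := μ.nonempty_support h0
    exact ⟨.box x 1, hx, one_pos⟩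

theorem isAtomicBlock_zero (n : ℕ) (μ : Measure (EuclideanSpace ℝ (Fin d))) :
    IsAtomicBlock n μ (fun _ => 0) 0 := by
  obtain ⟨Q, hQ⟩ := exists_admissible μ
  have hK : 0 ≤ K n μ Q Q := by
    cases Q with
    | whole => exact zero_le_one
    | box c l =>
      have hl : 0 ≤ l := hQ.2.le
      unfold K
      positivity
  refine ⟨Q, hQ, by simp, integrable_zero _ _ _, by simp, fun _ => 0, fun _ => Q,
    fun _ _ => 0, fun j => ⟨hQ, subset_rfl, aestronglyMeasurable_const, by simp, ?_⟩, ?_, ?_⟩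
  · refine Filter.Eventually.of_forall fun x => ?_
    rw [abs_zero]
    positivity
  · simp [hasSum_zero]
  · exact Filter.Eventually.of_forall fun x => by simp [hasSum_zero]

theorem IsAtomicBlock.smul {n : ℕ} {μ : Measure (EuclideanSpace ℝ (Fin d))}
    {b : EuclideanSpace ℝ (Fin d) → ℝ} {c : ℝ} (h : IsAtomicBlock n μ b c) (r : ℝ) :
    IsAtomicBlock n μ (fun x => r * b x) (|r| * c) := by
  obtain ⟨R, hR, hb, hi, h0, coef, Q, a, ha, hc, hs⟩ := h
  refine ⟨R, hR, ?_, hi.const_mul r, by rw [integral_const_mul, h0, mul_zero],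
    fun j => r * coef j, Q, a, ha, ?_, ?_⟩
  · filter_upwards [hb] with x hx hxR
    rw [hx hxR, mul_zero]
  · simpa only [abs_mul] using hc.mul_left |r|
  · filter_upwards [hs] with x hx
    simpa only [mul_assoc] using hx.mul_left r

theorem HasAtomicBlockSum.add {n : ℕ} {μ : Measure (EuclideanSpace ℝ (Fin d))}
    {f g : EuclideanSpace ℝ (Fin d) → ℝ} {s t : ℝ} (hf : HasAtomicBlockSum n μ f s)
    (hg : HasAtomicBlockSum n μ g t) :
    HasAtomicBlockSum n μ (fun x => f x + g x) (s + t) := by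
  obtain ⟨b, c, hb, hc, hs⟩ := hf
  obtain ⟨b', c', hb', hc', hs'⟩ := hg
  have key : ∀ (u v : ℕ → ℝ) (p q : ℝ), HasSum u p → HasSum v q →
      HasSum (fun i => Sum.elim u v (Equiv.natSumNatEquivNat.symm i)) (p + q) := by
    intro u v p q hu hv
    have h : HasSum (Sum.elim u v) (p + q) := HasSum.sum (by simpa using hu) (by simpa using hv)
    exact (Equiv.natSumNatEquivNat.symm.hasSum_iff).2 h
  refine ⟨fun i x => Sum.elim (fun j => b j x) (fun j => b' j x) (Equiv.natSumNatEquivNat.symm i),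
    fun i => Sum.elim c c' (Equiv.natSumNatEquivNat.symm i), ?_, key _ _ _ _ hc hc', ?_⟩
  · have h : ∀ z : ℕ ⊕ ℕ, IsAtomicBlock n μ
        (fun x => Sum.elim (fun j => b j x) (fun j => b' j x) z) (Sum.elim c c' z) := by
      rintro (j | j)
      · exact hb j
      · exact hb' j
    exact fun i => h _
  · filter_upwards [hs, hs'] with x hx hx'
    exact key _ _ _ _ hx hx'

/-- The atomic block space `H^{1,∞}_{atb}(μ)`, as a space of classes of functions modulo
`μ`-null sets. -/
def H1atb (n : ℕ) (μ : Measure (EuclideanSpace ℝ (Fin d))) :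
    Submodule ℝ (EuclideanSpace ℝ (Fin d) →ₘ[μ] ℝ) where
  carrier := {f | ∃ s : ℝ, HasAtomicBlockSum n μ f s}
  zero_mem' := by
    refine ⟨0, fun _ _ => 0, fun _ => 0, fun _ => isAtomicBlock_zero n μ, hasSum_zero, ?_⟩
    filter_upwards [AEEqFun.coeFn_zero (μ := μ) (β := ℝ)] with x hx
    rw [hx]
    exact hasSum_zero
  add_mem' := by
    rintro f g ⟨s, hf⟩ ⟨t, hg⟩
    obtain ⟨b, c, hb, hc, hs⟩ := hf.add hg
    refine ⟨s + t, b, c, hb, hc, ?_⟩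
    filter_upwards [hs, AEEqFun.coeFn_add f g] with x hx hx'
    rw [hx']
    exact hx
  smul_mem' := by
    rintro r f ⟨s, b, c, hb, hc, hs⟩
    refine ⟨|r| * s, fun i x => r * b i x, fun i => |r| * c i, fun i => (hb i).smul r,
      hc.mul_left _, ?_⟩
    filter_upwards [hs, AEEqFun.coeFn_smul r f] with x hx hx'
    rw [hx']
    exact hx.mul_left r

end NonDoubling

end

open NonDoubling

/-!
The two endpoint bounds are interpolated by hand, without a sharp maximal function: a bounded
function `f` of the atomic block space is cut into pieces `b j` at the levels `Λ / 2 ^ j`, each of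
which is controlled in `L^∞` and in `H^{1,∞}_{atb}` at the same time, and the endpoint bounds are
applied to each piece.

*Cubes.* Only cubes of side length `2 ^ k` centred in the support are used, and among these the
strongly doubling ones, with `μ (2 ^ i Q) ≤ β ^ i μ(Q)` for all `i ≥ 0`. Since `μ` has growth of
degree `n` and `β > 2 ^ n`, the quantity `β ^ (-k) μ (dyad x k)` tends to zero as `k → ∞`, and a
scale at which it is maximal among the larger ones is strongly doubling
(`GrowthData.exists_isPeak`). The masses between the given scale and the peak grow at least like
powers of `β`, so that the coefficient `K_{Q,R}` is bounded (`IsPeak.K_le`). As `β > 2 ^ d`, almost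
every point is the centre of arbitrarily small strongly doubling cubes
(`GrowthData.ae_exists_stronglyDoubling`).

*John–Nirenberg.* If `h` has norm at most `A` in `L¹` and at most `σ` in `RBMO`, then
`∫ |h| ^ r ≤ C σ ^ (r - 1) A` for every `r ≥ 1` (`GrowthData.exists_lintegral_rpow_le`). This is a
good-`λ` argument over strongly doubling cubes: raising the level by a multiple of `σ` halves the
measure of the level set (`L1RBMO.measure_levelSet_add_le`).

*Decomposition.* The Calderón–Zygmund decomposition at a level `τ` writes a bounded function as a
sum of atomic blocks plus a function bounded by a multiple of `τ`
(`GrowthData.exists_calderonZygmund`); the compensating functions are spread over large parts of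
strongly doubling cubes by means of a Carleson packing condition (`exists_subset_tsum_le`). Iterated
over the levels `Λ / 2 ^ j` it gives the pieces `b j`, which are bounded by a multiple of
`Λ / 2 ^ j` and whose costs are at most multiples of `∫_{|f| > Λ / 2 ^ (j + 1)} |f|`
(`GrowthData.exists_isDecomposition`).

*The a priori estimate.* The endpoint bounds and the John–Nirenberg inequality give
`∫ |T b_j| ^ r ≤ C (Λ / 2 ^ j) ^ (r - 1) s_j` for all `r`, where `s_j` is the cost of `b j`. Using this
for one exponent below and one above `p`, the pointwise inequality `exists_rpow_sum_le` sums the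
pieces, and `∑ (Λ / 2 ^ j) ^ (p - 1) s_j` is at most a multiple of `∫ |f| ^ p`. Hence
`‖T f‖_p ≤ C ‖f‖_p` (`EndpointBounds.exists_lintegral_rpow_le_integral`).

*Extension.* Functions in `L^p` are bounded up to sums of atomic blocks that are small in cost and
in `L^p` (`GrowthData.exists_bounded_add_small`), and bounded functions in `L^p`, of mean zero if `μ`
is finite, are limits both uniformly and in `L^p` of bounded sums of atomic blocks
(`GrowthData.exists_approximation`). By density the operator extends to `L^p`; for finite `μ`, where
atomic blocks only reach the functions of mean zero, the value at the constant function `1` is taken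
from the operator on `L^∞` (`EndpointBounds.exists_extension`). The extension agrees with the
operator on `H^{1,∞}_{atb}` because the approximation converges in both spaces
(`EndpointBounds.extension_eq`). On `L^∞` and for finite `μ` it agrees by subtraction of the mean.
For infinite `μ` the images of the approximating functions converge in `L^p`, and their differences
from the image under the operator on `L^∞` tend to zero in `RBMO`, so that the limit differs from
that image by a constant (`exists_ae_eq_const`).
-/

open MeasureTheory Filter Topology
open scoped ENNReal

noncomputable section

namespace NonDoubling

variable {d n : ℕ} {μ : Measure (EuclideanSpace ℝ (Fin d))} {β G : ℝ}

/-! ### Dyadic-scale cubes -/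

/-- The cube with centre `x` and side length `2 ^ k`, `k ∈ ℤ`. -/
def dyad (x : EuclideanSpace ℝ (Fin d)) (k : ℤ) : Cube d := .box x (2 ^ k)

/-- The set of points of `dyad x k`. -/
def dset (x : EuclideanSpace ℝ (Fin d)) (k : ℤ) : Set (EuclideanSpace ℝ (Fin d)) :=
  (dyad x k).toSet

/-- The distance of `x` and `y` in the supremum norm, whose closed balls are the cubes. -/
def supDist (x y : EuclideanSpace ℝ (Fin d)) : ℝ := dist (WithLp.ofLp x) (WithLp.ofLp y)

theorem supDist_self (x : EuclideanSpace ℝ (Fin d)) : supDist x x = 0 := dist_self _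

theorem supDist_comm (x y : EuclideanSpace ℝ (Fin d)) : supDist x y = supDist y x :=
  dist_comm _ _

theorem supDist_nonneg (x y : EuclideanSpace ℝ (Fin d)) : 0 ≤ supDist x y := dist_nonneg

theorem supDist_triangle (x y z : EuclideanSpace ℝ (Fin d)) :
    supDist x z ≤ supDist x y + supDist y z := dist_triangle _ _ _

theorem mem_dset {x y : EuclideanSpace ℝ (Fin d)} {k : ℤ} :
    y ∈ dset x k ↔ supDist x y ≤ 2 ^ k / 2 := by
  have h : (0 : ℝ) ≤ 2 ^ k / 2 := by positivity
  rw [supDist, dist_comm, dist_pi_le_iff h]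
  rfl

theorem dset_eq_preimage (x : EuclideanSpace ℝ (Fin d)) (k : ℤ) :
    dset x k = WithLp.ofLp ⁻¹' Metric.closedBall (WithLp.ofLp x) (2 ^ k / 2) := by
  ext y
  rw [mem_dset, Set.mem_preimage, Metric.mem_closedBall, dist_comm]
  rfl

theorem continuous_ofLp' : Continuous (WithLp.ofLp : EuclideanSpace ℝ (Fin d) → Fin d → ℝ) :=
  PiLp.continuous_ofLp 2 _

theorem isClosed_dset (x : EuclideanSpace ℝ (Fin d)) (k : ℤ) : IsClosed (dset x k) := by
  rw [dset_eq_preimage]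
  exact Metric.isClosed_closedBall.preimage continuous_ofLp'

theorem measurableSet_dset (x : EuclideanSpace ℝ (Fin d)) (k : ℤ) : MeasurableSet (dset x k) :=
  (isClosed_dset x k).measurableSet

theorem isCompact_dset (x : EuclideanSpace ℝ (Fin d)) (k : ℤ) : IsCompact (dset x k) := by
  have h := (isCompact_closedBall (WithLp.ofLp x) ((2 : ℝ) ^ k / 2)).image
    (PiLp.continuous_toLp 2 (fun _ : Fin d => ℝ))
  convert h using 1
  ext y
  rw [dset_eq_preimage]
  constructor
  · exact fun hy => ⟨WithLp.ofLp y, hy, rfl⟩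
  · rintro ⟨z, hz, rfl⟩
    exact hz

theorem measure_dset_lt_top [IsLocallyFiniteMeasure μ] (x : EuclideanSpace ℝ (Fin d)) (k : ℤ) :
    μ (dset x k) < ∞ := (isCompact_dset x k).measure_lt_top

theorem measure_dset_ne_top [IsLocallyFiniteMeasure μ] (x : EuclideanSpace ℝ (Fin d)) (k : ℤ) :
    μ (dset x k) ≠ ∞ := (measure_dset_lt_top x k).ne

theorem mem_dset_self (x : EuclideanSpace ℝ (Fin d)) (k : ℤ) : x ∈ dset x k := by
  rw [mem_dset, supDist_self]
  positivity

theorem dset_subset {x y : EuclideanSpace ℝ (Fin d)} {j k : ℤ}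
    (h : supDist x y + 2 ^ j / 2 ≤ 2 ^ k / 2) : dset y j ⊆ dset x k := by
  intro z hz
  rw [mem_dset] at hz ⊢
  linarith [supDist_triangle x y z]

theorem two_zpow_le {j k : ℤ} (h : j ≤ k) : (2 : ℝ) ^ j ≤ 2 ^ k :=
  zpow_le_zpow_right₀ one_le_two h

theorem two_zpow_add_one (k : ℤ) : (2 : ℝ) ^ (k + 1) = 2 * 2 ^ k := by
  rw [zpow_add_one₀ two_ne_zero, mul_comm]

theorem two_zpow_add_two (k : ℤ) : (2 : ℝ) ^ (k + 2) = 4 * 2 ^ k := by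
  rw [zpow_add₀ two_ne_zero, mul_comm]; norm_num

theorem two_zpow_add_three (k : ℤ) : (2 : ℝ) ^ (k + 3) = 8 * 2 ^ k := by
  rw [zpow_add₀ two_ne_zero, mul_comm]; norm_num

theorem two_zpow_add_four (k : ℤ) : (2 : ℝ) ^ (k + 4) = 16 * 2 ^ k := by
  rw [zpow_add₀ two_ne_zero, mul_comm]; norm_num

theorem two_zpow_pos (k : ℤ) : (0 : ℝ) < 2 ^ k := by positivity

theorem dset_mono {x : EuclideanSpace ℝ (Fin d)} {j k : ℤ} (h : j ≤ k) :
    dset x j ⊆ dset x k :=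
  dset_subset (by rw [supDist_self]; linarith [two_zpow_le h])

theorem ball_subset_interior_dset (x : EuclideanSpace ℝ (Fin d)) (k : ℤ) :
    x ∈ interior (dset x k) := by
  refine mem_interior.2 ⟨WithLp.ofLp ⁻¹' Metric.ball (WithLp.ofLp x) (2 ^ k / 2), ?_,
    Metric.isOpen_ball.preimage continuous_ofLp', ?_⟩
  · rw [dset_eq_preimage]
    exact Set.preimage_mono Metric.ball_subset_closedBall
  · exact Metric.mem_ball_self (by positivity)

theorem dset_mem_nhds (x : EuclideanSpace ℝ (Fin d)) (k : ℤ) : dset x k ∈ 𝓝 x :=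
  mem_interior_iff_mem_nhds.1 (ball_subset_interior_dset x k)

theorem exists_mem_dset (x y : EuclideanSpace ℝ (Fin d)) : ∃ N : ℕ, y ∈ dset x (N : ℤ) := by
  obtain ⟨N, hN⟩ := pow_unbounded_of_one_lt (2 * supDist x y) (one_lt_two (α := ℝ))
  refine ⟨N, ?_⟩
  rw [mem_dset, zpow_natCast]
  linarith

theorem iUnion_dset (x : EuclideanSpace ℝ (Fin d)) : ⋃ N : ℕ, dset x (N : ℤ) = Set.univ :=
  Set.eq_univ_of_forall fun y => Set.mem_iUnion.2 (exists_mem_dset x y)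

theorem monotone_dset (x : EuclideanSpace ℝ (Fin d)) : Monotone fun N : ℕ => dset x (N : ℤ) :=
  fun _ _ h => dset_mono (by exact_mod_cast h)

theorem exists_lt_measure_dset (x : EuclideanSpace ℝ (Fin d)) {c : ℝ≥0∞} (hc : c < μ Set.univ) :
    ∃ N : ℕ, c < μ (dset x (N : ℤ)) := by
  have h := tendsto_measure_iUnion_atTop (μ := μ) (monotone_dset x)
  rw [iUnion_dset] at h
  exact ((tendsto_order.1 h).1 c hc).exists

/-- The mass of the cube with centre `x` and side length `2 ^ k`. -/
def mass (μ : Measure (EuclideanSpace ℝ (Fin d))) (x : EuclideanSpace ℝ (Fin d)) (k : ℤ) : ℝ :=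
  μ.real (dset x k)

theorem mass_nonneg (x : EuclideanSpace ℝ (Fin d)) (k : ℤ) : 0 ≤ mass μ x k := measureReal_nonneg

theorem ofReal_mass [IsLocallyFiniteMeasure μ] (x : EuclideanSpace ℝ (Fin d)) (k : ℤ) :
    ENNReal.ofReal (mass μ x k) = μ (dset x k) :=
  ENNReal.ofReal_toReal (measure_dset_ne_top x k)

theorem mass_pos [IsLocallyFiniteMeasure μ] {x : EuclideanSpace ℝ (Fin d)} (hx : x ∈ μ.support)
    (k : ℤ) : 0 < mass μ x k :=
  ENNReal.toReal_pos ((Measure.mem_support_iff_forall x).1 hx _ (dset_mem_nhds x k)).ne'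
    (measure_dset_ne_top x k)

theorem mass_le_of_subset [IsLocallyFiniteMeasure μ] {x y : EuclideanSpace ℝ (Fin d)} {j k : ℤ}
    (h : dset y j ⊆ dset x k) : mass μ y j ≤ mass μ x k :=
  measureReal_mono h (measure_dset_ne_top x k)

theorem mass_mono [IsLocallyFiniteMeasure μ] {x : EuclideanSpace ℝ (Fin d)} {j k : ℤ}
    (h : j ≤ k) : mass μ x j ≤ mass μ x k := mass_le_of_subset (dset_mono h)

theorem admissible_dyad {x : EuclideanSpace ℝ (Fin d)} (hx : x ∈ μ.support) (k : ℤ) :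
    (dyad x k).Admissible μ := ⟨hx, two_zpow_pos k⟩

theorem dilate_pow_dyad (x : EuclideanSpace ℝ (Fin d)) (k : ℤ) (N : ℕ) :
    (dyad x k).dilate (2 ^ N) = dyad x (k + N) := by
  simp only [dyad, Cube.dilate]
  rw [zpow_add₀ two_ne_zero, zpow_natCast, mul_comm]

theorem dilate_two_dyad (x : EuclideanSpace ℝ (Fin d)) (k : ℤ) :
    (dyad x k).dilate 2 = dyad x (k + 1) := by
  simpa using dilate_pow_dyad x k 1

theorem doubling_dyad_iff {x : EuclideanSpace ℝ (Fin d)} {k : ℤ} :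
    (dyad x k).Doubling β μ ↔ mass μ x (k + 1) ≤ β * mass μ x k := by
  rw [Cube.Doubling, dilate_two_dyad]
  rfl

/-! ### Growth and strongly doubling cubes -/

/-- The standing assumptions: `μ` has growth of degree `n` on the cubes, with constant `G`, and the
doubling constant satisfies `β > 2 ^ d`. -/
structure GrowthData (n : ℕ) (μ : Measure (EuclideanSpace ℝ (Fin d))) (β G : ℝ) : Prop where
  le_dim : n ≤ d
  two_pow_lt : 2 ^ d < β
  pos : 0 < G
  mass_le : ∀ x k, mass μ x k ≤ G * (2 ^ k) ^ n

theorem HasGrowth.exists_growthData (hμ : HasGrowth n μ) (hn : 1 ≤ n) (hnd : n ≤ d)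
    (hβ : 2 ^ d < β) : ∃ G, GrowthData n μ β G := by
  obtain ⟨C, hC⟩ := hμ
  have hd : 0 < d := by omega
  have hd' : (0 : ℝ) < d := by exact_mod_cast hd
  refine ⟨(|C| + 1) * d ^ n, hnd, hβ, by positivity, fun x k => ?_⟩
  have hsub : dset x k ⊆ Metric.ball x (d * 2 ^ k) := by
    intro y hy
    rw [Metric.mem_ball, EuclideanSpace.dist_eq]
    have h1 : ∀ i, dist (y i) (x i) ^ 2 ≤ (2 ^ k / 2 : ℝ) ^ 2 := fun i =>
      pow_le_pow_left₀ dist_nonneg (by rw [Real.dist_eq]; exact hy i) 2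
    have h2 : ∑ i, dist (y i) (x i) ^ 2 ≤ d * (2 ^ k / 2 : ℝ) ^ 2 := by
      refine (Finset.sum_le_sum fun i _ => h1 i).trans ?_
      simp
    rw [Real.sqrt_lt' (by positivity)]
    have h3 : (1 : ℝ) ≤ d := by exact_mod_cast hd
    have h4 : (0 : ℝ) < 2 ^ k := two_zpow_pos k
    nlinarith [mul_pos h4 h4, mul_nonneg (mul_pos h4 h4).le (sub_nonneg.2 h3)]
  have h0 : (0 : ℝ) < d * 2 ^ k := by positivity
  refine (ENNReal.toReal_mono (ENNReal.ofReal_ne_top)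
    ((measure_mono hsub).trans (hC x _ h0))).trans ?_
  rw [ENNReal.toReal_ofReal', mul_pow, ← mul_assoc]
  refine max_le ?_ (by positivity)
  gcongr
  linarith [le_abs_self C]

theorem GrowthData.one_lt (D : GrowthData n μ β G) : 1 < β :=
  (one_le_pow₀ one_le_two).trans_lt D.two_pow_lt

theorem GrowthData.β_pos (D : GrowthData n μ β G) : 0 < β := zero_lt_one.trans D.one_lt

theorem GrowthData.two_pow_n_lt (D : GrowthData n μ β G) : 2 ^ n < β :=
  (pow_le_pow_right₀ one_le_two D.le_dim).trans_lt D.two_pow_lt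

/-- `dyad x k` is strongly doubling: `μ (2 ^ i Q) ≤ β ^ i μ(Q)` for all `i ≥ 0`. Unlike plain
doubling, this controls all dilates of the cube at once. -/
def StronglyDoubling (β : ℝ) (μ : Measure (EuclideanSpace ℝ (Fin d)))
    (x : EuclideanSpace ℝ (Fin d)) (k : ℤ) : Prop :=
  ∀ i, k ≤ i → mass μ x i ≤ β ^ (i - k) * mass μ x k

/-- `k` maximizes `β ^ (-i) μ (dyad x i)` among all `i ≥ j`. -/
def IsPeak (β : ℝ) (μ : Measure (EuclideanSpace ℝ (Fin d)))
    (x : EuclideanSpace ℝ (Fin d)) (j k : ℤ) : Prop :=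
  j ≤ k ∧ ∀ i, j ≤ i → mass μ x i ≤ β ^ (i - k) * mass μ x k

theorem IsPeak.stronglyDoubling {x : EuclideanSpace ℝ (Fin d)} {j k : ℤ}
    (h : IsPeak β μ x j k) : StronglyDoubling β μ x k := fun i hi => h.2 i (h.1.trans hi)

theorem StronglyDoubling.mass_add_le {x : EuclideanSpace ℝ (Fin d)} {k : ℤ}
    (h : StronglyDoubling β μ x k) (i : ℕ) : mass μ x (k + i) ≤ β ^ i * mass μ x k := by
  simpa using h (k + i) (by omega)

theorem StronglyDoubling.doubling {x : EuclideanSpace ℝ (Fin d)} {k : ℤ}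
    (h : StronglyDoubling β μ x k) : (dyad x k).Doubling β μ := by
  rw [doubling_dyad_iff]
  simpa using h.mass_add_le 1

theorem GrowthData.tendsto_zpow_mul_mass (D : GrowthData n μ β G)
    (x : EuclideanSpace ℝ (Fin d)) (j : ℤ) :
    Tendsto (fun i : ℕ => (β ^ (j + i))⁻¹ * mass μ x (j + i)) atTop (𝓝 0) := by
  have hβ := D.β_pos
  have h1 : Tendsto (fun i : ℕ => (β ^ j)⁻¹ * (G * (2 ^ j) ^ n) * (2 ^ n / β) ^ i) atTop
      (𝓝 ((β ^ j)⁻¹ * (G * (2 ^ j) ^ n) * 0)) :=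
    (tendsto_pow_atTop_nhds_zero_of_lt_one (by positivity)
      ((div_lt_one hβ).2 D.two_pow_n_lt)).const_mul _
  rw [mul_zero] at h1
  refine squeeze_zero (fun i => mul_nonneg (by positivity) (mass_nonneg _ _)) (fun i => ?_) h1
  refine (mul_le_mul_of_nonneg_left (D.mass_le x (j + i)) (by positivity)).trans (le_of_eq ?_)
  rw [zpow_add₀ hβ.ne', zpow_add₀ two_ne_zero, zpow_natCast, zpow_natCast]
  rw [div_pow, mul_inv, mul_pow, ← pow_mul, ← pow_mul, mul_comm n i]
  ring

theorem GrowthData.exists_isPeak [IsLocallyFiniteMeasure μ] (D : GrowthData n μ β G)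
    {x : EuclideanSpace ℝ (Fin d)} (hx : x ∈ μ.support) (j : ℤ) : ∃ k, IsPeak β μ x j k := by
  have hβ := D.β_pos
  set F : ℕ → ℝ := fun i => (β ^ (j + i))⁻¹ * mass μ x (j + i) with hF
  have hF0 : 0 < F 0 := mul_pos (by positivity) (mass_pos hx _)
  obtain ⟨N, hN⟩ := ((tendsto_order.1 (D.tendsto_zpow_mul_mass x j)).2 _ hF0).exists_forall_of_atTop
  obtain ⟨m, hm, hmax⟩ := Finset.exists_max_image (Finset.range (N + 1)) F ⟨0, by simp⟩
  have hall : ∀ i, F i ≤ F m := fun i => by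
    rcases lt_or_ge i (N + 1) with h | h
    · exact hmax i (Finset.mem_range.2 h)
    · exact (hN i (by omega)).le.trans (hmax 0 (by simp))
  refine ⟨j + m, by omega, fun i hi => ?_⟩
  obtain ⟨p, rfl⟩ := Int.le.dest hi
  have h := hall p
  rw [hF] at h
  have h2 : mass μ x (j + p) ≤ β ^ (j + p : ℤ) * ((β ^ (j + m : ℤ))⁻¹ * mass μ x (j + m)) := by
    rw [← inv_mul_le_iff₀ (by positivity)]
    exact h
  refine h2.trans (le_of_eq ?_)
  rw [zpow_sub₀ hβ.ne']
  field_simp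

/-! ### The coefficients `K_{Q,R}` -/

theorem K_dyad_eq (x y : EuclideanSpace ℝ (Fin d)) (j : ℤ) (N : ℕ) :
    K n μ (dyad y j) (dyad x (j + N)) =
      1 + ∑ i ∈ Finset.Icc 1 N, mass μ y (j + i) / (2 ^ (j + i)) ^ n := by
  have hs : sInf {k : ℕ | (2 : ℝ) ^ (j + N) ≤ 2 ^ k * 2 ^ j} = N := by
    have : {k : ℕ | (2 : ℝ) ^ (j + N) ≤ 2 ^ k * 2 ^ j} = Set.Ici N := by
      ext k
      rw [Set.mem_ofPred_eq, Set.mem_Ici, ← zpow_natCast, ← zpow_add₀ two_ne_zero,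
        zpow_le_zpow_iff_right₀ one_lt_two]
      omega
    rw [this, csInf_Ici]
  simp only [dyad, K]
  rw [hs]
  congr 1
  refine Finset.sum_congr rfl fun i _ => ?_
  rw [← zpow_natCast, ← zpow_add₀ two_ne_zero, add_comm (i : ℤ) j]
  rfl

theorem K_dyad_self (x y : EuclideanSpace ℝ (Fin d)) (j : ℤ) :
    K n μ (dyad y j) (dyad x j) = 1 := by
  simpa using K_dyad_eq (n := n) (μ := μ) x y j 0

theorem one_le_K_dyad {x y : EuclideanSpace ℝ (Fin d)} {j k : ℤ} (h : j ≤ k) :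
    1 ≤ K n μ (dyad y j) (dyad x k) := by
  obtain ⟨N, rfl⟩ := Int.le.dest h
  rw [K_dyad_eq]
  have : 0 ≤ ∑ i ∈ Finset.Icc 1 N, mass μ y (j + i) / ((2 : ℝ) ^ (j + i)) ^ n :=
    Finset.sum_nonneg fun i _ => div_nonneg (mass_nonneg _ _) (by positivity)
  linarith

/-- A bound for the coefficients `K_{Q,R}` of the pairs of cubes that occur below. -/
def KBound (n : ℕ) (β G : ℝ) : ℝ :=
  1 + G * 8 ^ n * (2 ^ n / β)⁻¹ ^ 3 * (1 - 2 ^ n / β)⁻¹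

theorem GrowthData.one_le_KBound (D : GrowthData n μ β G) : 1 ≤ KBound n β G := by
  have hβ := D.β_pos
  have h1 : 0 < 1 - 2 ^ n / β := sub_pos.2 ((div_lt_one hβ).2 D.two_pow_n_lt)
  have hG := D.pos
  rw [KBound, le_add_iff_nonneg_right]
  positivity

/-- The terms of the sum defining `K_{Q,R}` are dominated by a geometric series if the masses of
the cubes around the centre of `R` grow at least as fast as the powers of `β > 2 ^ n`. -/
theorem GrowthData.K_le [IsLocallyFiniteMeasure μ] (D : GrowthData n μ β G)
    {x y : EuclideanSpace ℝ (Fin d)} {j k : ℤ} (hjk : j ≤ k) (hxy : supDist x y ≤ 2 ^ (j + 2))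
    (h : ∀ i, j + 4 ≤ i → i ≤ k → mass μ x i ≤ β ^ (i - k) * mass μ x k) :
    K n μ (dyad y j) (dyad x k) ≤ KBound n β G := by
  have hβ := D.β_pos
  have hG := D.pos
  set ρ : ℝ := 2 ^ n / β with hρ
  have hρ0 : 0 < ρ := by positivity
  have hρ1 : ρ < 1 := (div_lt_one hβ).2 D.two_pow_n_lt
  obtain ⟨N, rfl⟩ := Int.le.dest hjk
  rw [K_dyad_eq, KBound]
  gcongr
  have hterm : ∀ i ∈ Finset.Icc 1 N, mass μ y (j + i) / ((2 : ℝ) ^ (j + i)) ^ n ≤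
      G * 8 ^ n * ρ⁻¹ ^ 3 * ρ ^ (N - i) := by
    intro i hi
    rw [Finset.mem_Icc] at hi
    have h2 : (0 : ℝ) < 2 ^ (j + i : ℤ) := by positivity
    rw [div_le_iff₀ (by positivity)]
    rcases le_or_gt (i + 3) N with hN | hN
    · have hsub : dset y (j + i) ⊆ dset x (j + i + 3) := by
        apply dset_subset
        have e1 : (2 : ℝ) ^ (j + 2) ≤ 2 * 2 ^ (j + i : ℤ) := by
          rw [← two_zpow_add_one]
          exact two_zpow_le (by omega)
        rw [two_zpow_add_three]
        linarith
      have h3 := (mass_le_of_subset (μ := μ) hsub).trans (h (j + i + 3) (by omega) (by omega))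
      refine h3.trans ((mul_le_mul_of_nonneg_left (D.mass_le x _) (by positivity)).trans
        (le_of_eq ?_))
      have e2 : (j + i + 3 - (j + N) : ℤ) = -((N - i : ℕ) : ℤ) + 3 := by
        push_cast [hi.2]; ring
      have e3 : ((2 : ℝ) ^ (j + N : ℤ)) = 2 ^ (j + i : ℤ) * 2 ^ (N - i) := by
        rw [← zpow_natCast, ← zpow_add₀ two_ne_zero]
        congr 1
        push_cast [hi.2]; ring
      rw [e2, e3, zpow_add₀ hβ.ne', zpow_neg, zpow_natCast, hρ]
      have e4 : (8 : ℝ) ^ n = (2 ^ n) ^ 3 := by rw [← pow_mul, mul_comm, pow_mul]; norm_num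
      have e5 : ((2 : ℝ) ^ (N - i)) ^ n = (2 ^ n) ^ (N - i) := by
        rw [← pow_mul, ← pow_mul, mul_comm]
      rw [e4, mul_pow, e5, div_pow, inv_pow, div_pow]
      have e6 : β ^ (3 : ℤ) = β ^ 3 := by norm_cast
      rw [e6]
      field_simp
    · have h4 : 1 ≤ 8 ^ n * ρ⁻¹ ^ 3 * ρ ^ (N - i) := by
        have e1 : (1 : ℝ) ≤ 8 ^ n := one_le_pow₀ (by norm_num)
        have e2 : 1 ≤ ρ⁻¹ ^ 3 * ρ ^ (N - i) := by
          rw [inv_pow, inv_mul_eq_div, one_le_div (by positivity)]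
          exact pow_le_pow_of_le_one hρ0.le hρ1.le (by omega)
        rw [mul_assoc]
        nlinarith
      have h5 : 0 ≤ G * (2 ^ (j + i : ℤ)) ^ n := by positivity
      nlinarith [D.mass_le y (j + i)]
  refine (Finset.sum_le_sum hterm).trans ?_
  rw [← Finset.mul_sum]
  gcongr
  have hgeo : ∑ i ∈ Finset.Icc 1 N, ρ ^ (N - i) ≤ ∑ m ∈ Finset.range N, ρ ^ m := by
    refine le_of_eq (Finset.sum_nbij' (fun i => N - i) (fun m => N - m) ?_ ?_ ?_ ?_ ?_)
    all_goals simp only [Finset.mem_Icc, Finset.mem_range]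
    all_goals intros
    all_goals first | omega | rfl | trivial
  refine hgeo.trans ?_
  rw [← tsum_geometric_of_lt_one hρ0.le hρ1]
  exact (summable_geometric_of_lt_one hρ0.le hρ1).sum_le_tsum _ (fun _ _ => by positivity)

theorem IsPeak.K_le [IsLocallyFiniteMeasure μ] (D : GrowthData n μ β G)
    {x y : EuclideanSpace ℝ (Fin d)} {j i k : ℤ} (h : IsPeak β μ x i k) (hji : j ≤ i)
    (hij : i ≤ j + 4) (hxy : supDist x y ≤ 2 ^ (j + 2)) :
    K n μ (dyad y j) (dyad x k) ≤ KBound n β G :=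
  D.K_le (hji.trans h.1) hxy fun _ hm _ => h.2 _ (hij.trans hm)

/-- The doubling cube `Q̃` of a dyadic-scale cube is again of dyadic scale, and the masses of the
cubes in between grow at least as fast as the powers of `β`. -/
theorem GrowthData.exists_tilde_eq [IsLocallyFiniteMeasure μ] (D : GrowthData n μ β G)
    {x : EuclideanSpace ℝ (Fin d)} (hx : x ∈ μ.support) (j : ℤ) :
    ∃ k, j ≤ k ∧ (dyad x j).tilde β μ = dyad x k ∧ (dyad x k).Doubling β μ ∧
      ∀ i, j ≤ i → i ≤ k → mass μ x i ≤ β ^ (i - k) * mass μ x k := by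
  have hβ := D.β_pos
  set s : Set ℕ := {N : ℕ | ((dyad x j).dilate (2 ^ N)).Doubling β μ} with hs
  have hne : s.Nonempty := by
    obtain ⟨k, hk⟩ := D.exists_isPeak hx j
    obtain ⟨N, rfl⟩ := Int.le.dest hk.1
    refine ⟨N, ?_⟩
    rw [hs, Set.mem_ofPred_eq, dilate_pow_dyad]
    exact hk.stronglyDoubling.doubling
  have hmem : sInf s ∈ s := Nat.sInf_mem hne
  refine ⟨j + (sInf s : ℕ), by omega, dilate_pow_dyad x j _, ?_, ?_⟩
  · rw [hs, Set.mem_ofPred_eq, dilate_pow_dyad] at hmem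
    exact hmem
  · have key : ∀ m : ℕ, m ≤ sInf s →
        β ^ m * mass μ x (j + (sInf s : ℕ) - m) ≤ mass μ x (j + (sInf s : ℕ)) := by
      intro m
      induction m with
      | zero => intro _; simp
      | succ m ih =>
        intro hm
        refine le_trans ?_ (ih (by omega))
        have hnot : sInf s - (m + 1) ∉ s := Nat.notMem_of_lt_sInf (by omega)
        rw [hs, Set.mem_ofPred_eq, dilate_pow_dyad, doubling_dyad_iff, not_le, ← hs] at hnot
        have e1 : (j + ((sInf s - (m + 1) : ℕ) : ℤ)) = j + (sInf s : ℕ) - ((m + 1 : ℕ) : ℤ) := by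
          push_cast [hm]; ring
        rw [e1] at hnot
        have e2 : (j + (sInf s : ℕ) - ((m + 1 : ℕ) : ℤ) + 1 : ℤ) = j + (sInf s : ℕ) - m := by
          push_cast; ring
        rw [e2] at hnot
        rw [pow_succ, mul_assoc]
        exact mul_le_mul_of_nonneg_left hnot.le (by positivity)
    intro i hi hik
    obtain ⟨m, hm⟩ := Int.le.dest hik
    have h := key m (by omega)
    have e : (j + (sInf s : ℕ) - m : ℤ) = i := by omega
    rw [e] at h
    have e' : (i - (j + (sInf s : ℕ)) : ℤ) = -(m : ℤ) := by omega
    rw [e', zpow_neg, zpow_natCast, le_inv_mul_iff₀ (by positivity)]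
    exact h

/-! ### Differentiation along small cubes -/

/-- The transport of `μ` to `Fin d → ℝ`, where the closed balls of the supremum norm are the
cubes. -/
def supMeasure (μ : Measure (EuclideanSpace ℝ (Fin d))) : Measure (Fin d → ℝ) :=
  μ.map (EuclideanSpace.equiv (Fin d) ℝ).toHomeomorph

theorem supMeasure_apply {s : Set (Fin d → ℝ)} (hs : MeasurableSet s) :
    supMeasure μ s = μ (WithLp.ofLp ⁻¹' s) :=
  Measure.map_apply (EuclideanSpace.equiv (Fin d) ℝ).toHomeomorph.measurable hs

theorem supMeasure_closedBall (x : EuclideanSpace ℝ (Fin d)) (k : ℤ) :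
    supMeasure μ (Metric.closedBall (WithLp.ofLp x) (2 ^ k / 2)) = μ (dset x k) := by
  rw [supMeasure_apply Metric.isClosed_closedBall.measurableSet, dset_eq_preimage]

instance [IsLocallyFiniteMeasure μ] : IsLocallyFiniteMeasure (supMeasure μ) := by
  refine ⟨fun y => ⟨Metric.closedBall y (2 ^ (0 : ℤ) / 2), Metric.closedBall_mem_nhds _ (by simp),
    ?_⟩⟩
  have h := supMeasure_closedBall (μ := μ) (WithLp.toLp 2 y) 0
  exact h.trans_lt (measure_dset_lt_top _ _)

theorem tendsto_half_zpow :
    Tendsto (fun k : ℕ => (2 : ℝ) ^ (-(k : ℤ)) / 2) atTop (𝓝[>] 0) := by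
  refine tendsto_nhdsWithin_iff.2 ⟨?_, Eventually.of_forall fun k => Set.mem_Ioi.2 (by positivity)⟩
  have h := (tendsto_pow_atTop_nhds_zero_of_lt_one (r := (2 : ℝ)⁻¹) (by norm_num)
    (by norm_num)).div_const 2
  simpa using h

theorem ae_of_supMeasure {p : (Fin d → ℝ) → Prop} (h : ∀ᵐ y ∂supMeasure μ, p y) :
    ∀ᵐ x ∂μ, p (WithLp.ofLp x) :=
  ae_of_ae_map (EuclideanSpace.equiv (Fin d) ℝ).toHomeomorph.measurable.aemeasurable h

/-- Lebesgue differentiation along cubes. -/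
theorem ae_tendsto_average_dset [IsLocallyFiniteMeasure μ] {f : EuclideanSpace ℝ (Fin d) → ℝ}
    (hf : LocallyIntegrable f μ) :
    ∀ᵐ x ∂μ, Tendsto (fun k : ℕ => ⨍ y in dset x (-(k : ℤ)), f y ∂μ) atTop (𝓝 (f x)) := by
  set e := (EuclideanSpace.equiv (Fin d) ℝ).toHomeomorph with he
  have hf' : LocallyIntegrable (f ∘ e.symm) (supMeasure μ) := by
    rw [supMeasure, locallyIntegrable_map_homeomorph]
    exact hf
  have h := (Besicovitch.vitaliFamily (supMeasure μ)).ae_tendsto_average hf'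
  filter_upwards [ae_of_supMeasure h] with x hx
  have h2 := (hx.comp (Besicovitch.tendsto_filterAt _ _)).comp tendsto_half_zpow
  refine h2.congr fun k => ?_
  simp only [Function.comp_apply]
  have h3 := e.toMeasurableEquiv.measurableEmbedding.setIntegral_map (μ := μ) (f ∘ e.symm)
    (Metric.closedBall (WithLp.ofLp x) (2 ^ (-(k : ℤ)) / 2))
  rw [setAverage_eq, setAverage_eq, Measure.real, supMeasure_closedBall, Measure.real]
  congr 1
  rw [dset_eq_preimage]
  exact h3

/-- Almost every point is the centre of arbitrarily small strongly doubling cubes: for almost every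
`x` the masses `μ (dyad x k)` are bounded below by a multiple of `2 ^ (k d)` as `k → -∞`, so that
`β ^ (-k) μ (dyad x k)` is unbounded because of `β > 2 ^ d`. -/
theorem GrowthData.ae_exists_stronglyDoubling [IsLocallyFiniteMeasure μ]
    (D : GrowthData n μ β G) :
    ∀ᵐ x ∂μ, x ∈ μ.support ∧ ∀ k₀ : ℤ, ∃ k < k₀, StronglyDoubling β μ x k := by
  have hβ := D.β_pos
  have h1 := Besicovitch.ae_tendsto_rnDeriv (volume : Measure (Fin d → ℝ)) (supMeasure μ)
  have h2 := (volume : Measure (Fin d → ℝ)).rnDeriv_lt_top (supMeasure μ)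
  filter_upwards [ae_of_supMeasure h1, ae_of_supMeasure h2, Measure.support_mem_ae (μ := μ)]
    with x hx hx2 hsupp
  refine ⟨hsupp, fun k₀ => ?_⟩
  obtain ⟨c, hc⟩ := ENNReal.lt_iff_exists_nnreal_btwn.1 hx2
  have h3 := (hx.comp tendsto_half_zpow).eventually (Iio_mem_nhds hc.1)
  have hlow : ∀ᶠ k : ℕ in atTop, (2 ^ (-(k : ℤ)) : ℝ) ^ d ≤ c * mass μ x (-(k : ℤ)) := by
    filter_upwards [h3] with k hk
    simp only [Function.comp_apply] at hk
    rw [supMeasure_closedBall, Real.volume_pi_closedBall _ (by positivity), Fintype.card_fin,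
      mul_div_cancel₀ _ two_ne_zero, ← ofReal_mass] at hk
    have hm := mass_pos hsupp (-(k : ℤ))
    rw [ENNReal.div_lt_iff (Or.inl (ENNReal.ofReal_pos.2 hm).ne')
      (Or.inl ENNReal.ofReal_ne_top), ← ENNReal.ofReal_coe_nnreal,
      ← ENNReal.ofReal_mul c.coe_nonneg] at hk
    exact (ENNReal.ofReal_lt_ofReal_iff_of_nonneg (by positivity)).1 hk |>.le
  obtain ⟨k₁, hk₁⟩ := D.exists_isPeak hsupp k₀
  set W := (β ^ k₁)⁻¹ * mass μ x k₁ with hW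
  have hbig : Tendsto (fun k : ℕ => (β / 2 ^ d) ^ k) atTop atTop :=
    tendsto_pow_atTop_atTop_of_one_lt ((one_lt_div (by positivity)).2 D.two_pow_lt)
  obtain ⟨m, hm, hm1, hm2⟩ := (hlow.and ((hbig.eventually_gt_atTop (c * W)).and
    (eventually_gt_atTop (-k₀).toNat))).exists
  obtain ⟨k, hk⟩ := D.exists_isPeak hsupp (-(m : ℤ))
  refine ⟨k, ?_, hk.stronglyDoubling⟩
  by_contra hcon
  rw [not_lt] at hcon
  have e1 := hk₁.2 k hcon
  have e2 := hk.2 (-(m : ℤ)) le_rfl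
  have e3 : mass μ x (-(m : ℤ)) ≤ β ^ (-(m : ℤ)) * W := by
    refine e2.trans ((mul_le_mul_of_nonneg_left e1 (by positivity)).trans (le_of_eq ?_))
    rw [hW, zpow_sub₀ hβ.ne', zpow_sub₀ hβ.ne']
    field_simp
  have e4 : (2 ^ (-(m : ℤ)) : ℝ) ^ d ≤ c * W * β ^ (-(m : ℤ)) := by
    refine hm.trans ((mul_le_mul_of_nonneg_left e3 c.coe_nonneg).trans (le_of_eq (by ring)))
  rw [zpow_neg, zpow_neg, zpow_natCast, zpow_natCast, inv_pow, ← div_eq_mul_inv,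
    le_div_iff₀ (by positivity), inv_mul_le_iff₀ (by positivity)] at e4
  rw [div_pow, lt_div_iff₀ (by positivity), ← pow_mul, mul_comm d m, pow_mul] at hm1
  linarith

/-! ### Covering and the weak type inequality -/

/-- A Vitali covering lemma. Since the side lengths are powers of two, the cubes are selected so
that the doubled cubes already cover. The radii are not assumed to be bounded but only to grow
slowly at infinity; Vitali's argument is applied to the radii divided by `‖x‖ + ρ`, which vary
little between intersecting cubes. -/
theorem exists_disjoint_covering (Y : Set (EuclideanSpace ℝ (Fin d)))
    (k : EuclideanSpace ℝ (Fin d) → ℤ) {ρ : ℝ}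
    (hk : ∀ x ∈ Y, 2 ^ k x * 8 ≤ supDist 0 x + ρ) :
    ∃ I ⊆ Y, I.Countable ∧ I.PairwiseDisjoint (fun x => dset x (k x)) ∧
      ∀ y ∈ Y, ∃ x ∈ I, k y ≤ k x ∧ supDist x y ≤ 2 ^ k x := by
  have hpos : ∀ x ∈ Y, 0 < supDist 0 x + ρ := fun x hx =>
    (mul_pos (two_zpow_pos (k x)) (by norm_num)).trans_le (hk x hx)
  obtain ⟨I, hIY, hdisj, hcov⟩ := Vitali.exists_disjoint_subfamily_covering_enlargement
    (fun x => dset x (k x)) Y (fun x => 2 ^ k x / (supDist 0 x + ρ)) (11 / 10) (by norm_num)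
    (fun x hx => div_nonneg (by positivity) (hpos x hx).le) (1 / 8)
    (fun x hx => by
      rw [div_le_iff₀ (hpos x hx)]
      linarith [hk x hx])
    (fun x _ => ⟨x, mem_dset_self x _⟩)
  refine ⟨I, hIY, ?_, hdisj, fun y hy => ?_⟩
  · exact hdisj.countable_of_nonempty_interior fun x _ => ⟨x, ball_subset_interior_dset x _⟩
  · obtain ⟨x, hx, ⟨z, hzy, hzx⟩, hle⟩ := hcov y hy
    rw [mem_dset] at hzy hzx
    have hxy : supDist x y ≤ 2 ^ k x / 2 + 2 ^ k y / 2 := by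
      have := supDist_triangle x z y
      rw [supDist_comm z y] at this
      linarith
    have hle' : k y ≤ k x := by
      by_contra hcon
      have h2 : (2 : ℝ) * 2 ^ k x ≤ 2 ^ k y := by
        rw [← two_zpow_add_one]
        exact two_zpow_le (by omega)
      have hX := hpos x (hIY hx)
      have hY := hpos y hy
      have hkx := hk x (hIY hx)
      have hky := hk y hy
      rw [← mul_div_assoc, div_le_div_iff₀ hY hX] at hle
      have h3 := supDist_triangle 0 x y
      have h4 := two_zpow_pos (k x)
      nlinarith
    refine ⟨x, hx, hle', hxy.trans ?_⟩
    linarith [two_zpow_le hle']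

/-- The weak type `(1,1)` inequality for the maximal operator over strongly doubling cubes. -/
theorem weak_type_of_stronglyDoubling [IsLocallyFiniteMeasure μ] (hβ : 0 ≤ β)
    {Y W : Set (EuclideanSpace ℝ (Fin d))} {F : EuclideanSpace ℝ (Fin d) → ℝ≥0∞} {c : ℝ≥0∞}
    {ρ : ℝ} (h : ∀ y ∈ Y, ∃ k, 2 ^ k * 8 ≤ supDist 0 y + ρ ∧ StronglyDoubling β μ y k ∧
      dset y k ⊆ W ∧ c * μ (dset y k) ≤ ∫⁻ x in dset y k, F x ∂μ) :
    c * μ Y ≤ ENNReal.ofReal β * ∫⁻ x in W, F x ∂μ := by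
  choose! k hk hSD hW hF using h
  obtain ⟨I, hIY, hIc, hdisj, hcov⟩ := exists_disjoint_covering Y k hk
  have hdbl : ∀ x ∈ I, μ (dset x (k x + 1)) ≤ ENNReal.ofReal β * μ (dset x (k x)) := by
    intro x hx
    rw [← ofReal_mass, ← ofReal_mass, ← ENNReal.ofReal_mul hβ]
    exact ENNReal.ofReal_le_ofReal (by simpa using (hSD x (hIY hx)).mass_add_le 1)
  have hsub : Y ⊆ ⋃ x ∈ I, dset x (k x + 1) := by
    intro y hy
    obtain ⟨x, hx, -, hxy⟩ := hcov y hy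
    refine Set.mem_biUnion hx ?_
    rw [mem_dset, two_zpow_add_one]
    linarith
  have : Countable I := hIc.to_subtype
  calc c * μ Y ≤ c * ∑' x : I, μ (dset (x : EuclideanSpace ℝ (Fin d)) (k x + 1)) := by
        gcongr
        exact (measure_mono hsub).trans (measure_biUnion_le μ hIc _)
    _ ≤ c * ∑' x : I, ENNReal.ofReal β * μ (dset (x : EuclideanSpace ℝ (Fin d)) (k x)) := by
        gcongr with x
        exact hdbl x x.2
    _ = ENNReal.ofReal β * ∑' x : I, c * μ (dset (x : EuclideanSpace ℝ (Fin d)) (k x)) := by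
        rw [ENNReal.tsum_mul_left, ENNReal.tsum_mul_left]
        ring
    _ ≤ ENNReal.ofReal β * ∑' x : I, ∫⁻ y in dset (x : EuclideanSpace ℝ (Fin d)) (k x), F y ∂μ := by
        gcongr with x
        exact hF x (hIY x.2)
    _ = ENNReal.ofReal β * ∫⁻ y in ⋃ x ∈ I, dset x (k x), F y ∂μ := by
        rw [lintegral_biUnion hIc (fun x _ => measurableSet_dset x _) hdisj]
    _ ≤ ENNReal.ofReal β * ∫⁻ x in W, F x ∂μ := by
        gcongr
        exact Set.iUnion₂_subset fun x hx => hW x (hIY hx)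

/-! ### A John–Nirenberg inequality -/

/-- Cubes whose mass is at most `c < μ(ℝ^d)` have a side length that grows slowly with the distance
of the centre from the origin. -/
theorem exists_scale_bound [IsLocallyFiniteMeasure μ] {c : ℝ} (hc0 : 0 ≤ c)
    (hc : ENNReal.ofReal c < μ Set.univ) :
    ∃ ρ : ℝ, ∀ x k, mass μ x (k + 4) ≤ c → 2 ^ k * 8 ≤ supDist 0 x + ρ := by
  obtain ⟨M, hM⟩ := exists_lt_measure_dset 0 hc
  refine ⟨2 ^ (M : ℤ) / 2, fun x k h => ?_⟩
  by_contra hcon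
  rw [not_le] at hcon
  have hsub : dset 0 (M : ℤ) ⊆ dset x (k + 4) := by
    apply dset_subset
    rw [two_zpow_add_four, supDist_comm]
    linarith
  rw [← ofReal_mass, ENNReal.ofReal_lt_ofReal_iff_of_nonneg hc0] at hM
  linarith [mass_le_of_subset (μ := μ) hsub]

theorem exists_greatest_scale {P : ℤ → Prop} {B : ℝ} (hP : ∃ k, P k)
    (hB : ∀ k, P k → 2 ^ k * 8 ≤ B) : ∃ k, P k ∧ ∀ i, k < i → ¬P i := by
  obtain ⟨N, hN⟩ := pow_unbounded_of_one_lt B (one_lt_two (α := ℝ))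
  obtain ⟨k, hk, hmax⟩ := Int.exists_greatest_of_bdd (P := P) ⟨N, fun z hz => by
    by_contra hcon
    have h1 : (2 : ℝ) ^ (N : ℤ) ≤ 2 ^ z := two_zpow_le (by omega)
    rw [zpow_natCast] at h1
    linarith [hB z hz, two_zpow_pos z]⟩ hP
  exact ⟨k, hk, fun i hi h => absurd (hmax i h) (not_le.2 hi)⟩

theorem RBMOBound.abs_mean_sub_le [IsLocallyFiniteMeasure μ]
    {h : EuclideanSpace ℝ (Fin d) → ℝ} {σ : ℝ} (hh : RBMOBound n β μ h σ)
    {x y : EuclideanSpace ℝ (Fin d)} {j k : ℤ} (hx : x ∈ μ.support) (hy : y ∈ μ.support)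
    (hQ : (dyad y j).Doubling β μ) (hR : (dyad x k).Doubling β μ) (hsub : dset y j ⊆ dset x k)
    (hK : K n μ (dyad y j) (dyad x k) ≤ KBound n β G) :
    |mean μ (dyad y j) h - mean μ (dyad x k) h| ≤ σ * KBound n β G :=
  (hh.regularity _ _ (admissible_dyad hy j) (admissible_dyad hx k) hQ hR hsub).trans
    (mul_le_mul_of_nonneg_left hK hh.nonneg)

theorem RBMOBound.integrableOn_dset {h : EuclideanSpace ℝ (Fin d) → ℝ} {σ : ℝ}
    (hh : RBMOBound n β μ h σ) (x : EuclideanSpace ℝ (Fin d)) (k : ℤ) :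
    IntegrableOn h (dset x k) μ :=
  hh.locallyIntegrable.integrableOn_isCompact (isCompact_dset x k)

theorem RBMOBound.integrableOn_abs_sub [IsLocallyFiniteMeasure μ]
    {h : EuclideanSpace ℝ (Fin d) → ℝ} {σ : ℝ}
    (hh : RBMOBound n β μ h σ) (x : EuclideanSpace ℝ (Fin d)) (k : ℤ) (c : ℝ) :
    IntegrableOn (fun y => |h y - c|) (dset x k) μ :=
  ((hh.integrableOn_dset x k).sub (integrableOn_const (measure_dset_ne_top x k))).abs

/-- The constant in the oscillation estimate on the dilates of strongly doubling cubes. -/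
def oscConst (n : ℕ) (β G : ℝ) : ℝ := β ^ 3 + β ^ 2 * KBound n β G

theorem GrowthData.one_le_oscConst (D : GrowthData n μ β G) : 1 ≤ oscConst n β G := by
  have h1 := one_le_pow₀ (n := 3) D.one_lt.le
  have h2 := D.one_le_KBound
  have : 0 ≤ β ^ 2 * KBound n β G := by positivity
  rw [oscConst]
  linarith

/-- The oscillation of `h` on four times a strongly doubling cube `Q`, around the mean over `Q`. The
defining condition is applied to `4 Q` and gives the mean over the doubling cube of `4 Q`, which is
compared with the mean over `Q`. -/
theorem RBMOBound.oscillation_le [IsLocallyFiniteMeasure μ] (D : GrowthData n μ β G)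
    {h : EuclideanSpace ℝ (Fin d) → ℝ} {σ : ℝ} (hh : RBMOBound n β μ h σ)
    {x : EuclideanSpace ℝ (Fin d)} (hx : x ∈ μ.support) {k : ℤ}
    (hk : StronglyDoubling β μ x k) :
    ∫ y in dset x (k + 2), |h y - mean μ (dyad x k) h| ∂μ ≤
      σ * oscConst n β G * mass μ x k := by
  have hKB : 0 ≤ KBound n β G := zero_le_one.trans D.one_le_KBound
  obtain ⟨l, hl, htilde, hdbl, hgrow⟩ := D.exists_tilde_eq hx (k + 2)
  have h1 := (hh.oscillation _ (admissible_dyad hx (k + 2))).2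
  rw [htilde, dilate_two_dyad] at h1
  have h2 : |mean μ (dyad x k) h - mean μ (dyad x l) h| ≤ σ * KBound n β G := by
    refine hh.abs_mean_sub_le hx hx hk.doubling hdbl (dset_mono (by omega)) ?_
    exact D.K_le (by omega) (by rw [supDist_self]; positivity)
      fun i hi hil => hgrow i (by omega) hil
  have h3 : ∫ y in dset x (k + 2), |h y - mean μ (dyad x k) h| ∂μ ≤
      ∫ y in dset x (k + 2), (|h y - mean μ (dyad x l) h| + σ * KBound n β G) ∂μ := by
    refine setIntegral_mono (hh.integrableOn_abs_sub _ _ _)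
      ((hh.integrableOn_abs_sub _ _ _).add (integrableOn_const (measure_dset_ne_top _ _)))
      fun y => ?_
    have := abs_sub_le (h y) (mean μ (dyad x l) h) (mean μ (dyad x k) h)
    rw [abs_sub_comm (mean μ (dyad x l) h)] at this
    linarith
  rw [integral_add (hh.integrableOn_abs_sub _ _ _)
    (integrableOn_const (measure_dset_ne_top _ _)), setIntegral_const, smul_eq_mul] at h3
  have h4 := hk.mass_add_le 3
  have h5 := hk.mass_add_le 2
  have h6 : ∫ y in dset x (k + 2), |h y - mean μ (dyad x l) h| ∂μ ≤ σ * mass μ x (k + 3) := by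
    rw [add_assoc] at h1
    exact h1
  have e1 : σ * mass μ x (k + 3) ≤ σ * (β ^ 3 * mass μ x k) :=
    mul_le_mul_of_nonneg_left h4 hh.nonneg
  have e2 : mass μ x (k + 2) * (σ * KBound n β G) ≤
      (β ^ 2 * mass μ x k) * (σ * KBound n β G) :=
    mul_le_mul_of_nonneg_right h5 (mul_nonneg hh.nonneg hKB)
  have e3 : μ.real (dset x (k + 2)) = mass μ x (k + 2) := rfl
  rw [e3] at h3
  rw [oscConst]
  linarith

/-- The points of `supp μ` that are centres of strongly doubling cubes over which the mean of `h`
exceeds `t` in absolute value. -/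
def levelSet (β : ℝ) (μ : Measure (EuclideanSpace ℝ (Fin d)))
    (h : EuclideanSpace ℝ (Fin d) → ℝ) (t : ℝ) : Set (EuclideanSpace ℝ (Fin d)) :=
  {x | x ∈ μ.support ∧ ∃ k, StronglyDoubling β μ x k ∧ t < |mean μ (dyad x k) h|}

theorem levelSet_anti {h : EuclideanSpace ℝ (Fin d) → ℝ} {s t : ℝ} (hst : s ≤ t) :
    levelSet β μ h t ⊆ levelSet β μ h s :=
  fun _ ⟨hx, k, hk, hlt⟩ => ⟨hx, k, hk, hst.trans_lt hlt⟩

theorem mean_dyad (x : EuclideanSpace ℝ (Fin d)) (k : ℤ) (h : EuclideanSpace ℝ (Fin d) → ℝ) :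
    mean μ (dyad x k) h = (mass μ x k)⁻¹ * ∫ y in dset x k, h y ∂μ := by
  rw [mean, setAverage_eq, smul_eq_mul]
  rfl

theorem mul_mass_le_of_le_abs_mean [IsLocallyFiniteMeasure μ] {x : EuclideanSpace ℝ (Fin d)}
    (hx : x ∈ μ.support) {k : ℤ} {h : EuclideanSpace ℝ (Fin d) → ℝ} {c t : ℝ}
    (hi : IntegrableOn h (dset x k) μ) (hm : t ≤ |mean μ (dyad x k) h - c|) :
    t * mass μ x k ≤ ∫ y in dset x k, |h y - c| ∂μ := by
  have hpos := mass_pos hx k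
  have hc : IntegrableOn (fun _ => c) (dset x k) μ :=
    integrableOn_const (measure_dset_ne_top x k)
  have h1 : (mean μ (dyad x k) h - c) * mass μ x k = ∫ y in dset x k, (h y - c) ∂μ := by
    rw [integral_sub hi hc, setIntegral_const, mean_dyad, smul_eq_mul]
    have : μ.real (dset x k) = mass μ x k := rfl
    rw [this]
    field_simp
  calc t * mass μ x k ≤ |mean μ (dyad x k) h - c| * mass μ x k := by gcongr
    _ = |∫ y in dset x k, (h y - c) ∂μ| := by rw [← h1, abs_mul, abs_of_pos hpos]
    _ ≤ ∫ y in dset x k, |h y - c| ∂μ := abs_integral_le_integral_abs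

/-- The level sets control `h` itself, as almost every point is the limit of its strongly doubling
cubes. -/
theorem ae_le_of_notMem_levelSet [IsLocallyFiniteMeasure μ] (D : GrowthData n μ β G)
    {h : EuclideanSpace ℝ (Fin d) → ℝ} (hh : LocallyIntegrable h μ) :
    ∀ᵐ x ∂μ, ∀ t, x ∉ levelSet β μ h t → |h x| ≤ t := by
  filter_upwards [D.ae_exists_stronglyDoubling, ae_tendsto_average_dset hh] with x hx hlim t ht
  by_contra hcon
  rw [not_le] at hcon
  obtain ⟨N, hN⟩ := (hlim.abs.eventually (lt_mem_nhds hcon)).exists_forall_of_atTop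
  obtain ⟨k, hk, hSD⟩ := hx.2 (-(N : ℤ))
  obtain ⟨p, rfl⟩ : ∃ p : ℕ, k = -(p : ℤ) := ⟨(-k).toNat, by omega⟩
  exact ht ⟨hx.1, _, hSD, hN p (by omega)⟩

/-- Data common to the lemmas on functions in `L¹ ∩ RBMO`. The last condition only has content for
finite measures, where it makes the mean of `|h|` over the whole space small. -/
structure L1RBMO (n : ℕ) (β : ℝ) (μ : Measure (EuclideanSpace ℝ (Fin d)))
    (h : EuclideanSpace ℝ (Fin d) → ℝ) (σ A : ℝ) : Prop where
  bound : RBMOBound n β μ h σ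
  pos : 0 < σ
  integrable : Integrable h μ
  integral_le : ∫ x, |h x| ∂μ ≤ A
  le_measure : ENNReal.ofReal A ≤ ENNReal.ofReal σ * μ Set.univ

theorem L1RBMO.nonneg {h : EuclideanSpace ℝ (Fin d) → ℝ} {σ A : ℝ} (H : L1RBMO n β μ h σ A) :
    0 ≤ A := (integral_nonneg fun _ => abs_nonneg _).trans H.integral_le

theorem L1RBMO.mul_mass_le [IsLocallyFiniteMeasure μ] {h : EuclideanSpace ℝ (Fin d) → ℝ}
    {σ A t : ℝ} (H : L1RBMO n β μ h σ A) {x : EuclideanSpace ℝ (Fin d)} (hx : x ∈ μ.support)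
    {k : ℤ} (ht : t ≤ |mean μ (dyad x k) h|) : t * mass μ x k ≤ A := by
  have h1 := mul_mass_le_of_le_abs_mean (c := 0) hx H.integrable.integrableOn (by simpa using ht)
  simp only [sub_zero] at h1
  exact h1.trans ((setIntegral_le_integral H.integrable.abs
    (Eventually.of_forall fun _ => abs_nonneg _)).trans H.integral_le)

/-- The cubes with large mean have slowly growing side lengths, as is required for covering
arguments. The threshold `2 β ^ 4 σ` makes the mass of the dilated cube `16 Q` at most `A / (2 σ)`,
which is less than the total mass. -/
theorem L1RBMO.exists_scale_bound [IsLocallyFiniteMeasure μ] [NeZero μ] (D : GrowthData n μ β G)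
    {h : EuclideanSpace ℝ (Fin d) → ℝ} {σ A : ℝ} (H : L1RBMO n β μ h σ A) :
    ∃ ρ : ℝ, ∀ t, 2 * β ^ 4 * σ ≤ t → ∀ x ∈ μ.support, ∀ k, StronglyDoubling β μ x k →
      t < |mean μ (dyad x k) h| → 2 ^ k * 8 ≤ supDist 0 x + ρ := by
  have hβ := D.β_pos
  have hσ := H.pos
  have hA := H.nonneg
  have hlt : ENNReal.ofReal (A / (2 * σ)) < μ Set.univ := by
    have h1 : ENNReal.ofReal (A / σ) ≤ μ Set.univ := by
      rw [ENNReal.ofReal_div_of_pos hσ]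
      exact ENNReal.div_le_of_le_mul' H.le_measure
    rcases hA.eq_or_lt with h0 | h0
    · rw [← h0, zero_div, ENNReal.ofReal_zero]
      exact (Measure.measure_univ_pos).2 (NeZero.ne μ)
    · refine lt_of_lt_of_le ?_ h1
      rw [ENNReal.ofReal_lt_ofReal_iff (by positivity)]
      exact div_lt_div_of_pos_left h0 hσ (by linarith)
  obtain ⟨ρ, hρ⟩ := NonDoubling.exists_scale_bound (by positivity) hlt
  refine ⟨ρ, fun t ht x hx k hk hm => hρ x k ?_⟩
  have h2 := H.mul_mass_le hx (ht.trans hm.le)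
  have h3 := hk.mass_add_le 4
  rw [le_div_iff₀ (by positivity)]
  have h4 : mass μ x (k + 4) * (2 * σ) ≤ β ^ 4 * mass μ x k * (2 * σ) :=
    mul_le_mul_of_nonneg_right h3 (by positivity)
  linarith

theorem L1RBMO.measure_levelSet_le [IsLocallyFiniteMeasure μ] [NeZero μ] (D : GrowthData n μ β G)
    {h : EuclideanSpace ℝ (Fin d) → ℝ} {σ A t : ℝ} (H : L1RBMO n β μ h σ A)
    (ht : 2 * β ^ 4 * σ ≤ t) :
    ENNReal.ofReal t * μ (levelSet β μ h t) ≤ ENNReal.ofReal (β * A) := by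
  have hβ := D.β_pos
  have hσ := H.pos
  have ht0 : 0 ≤ t := le_trans (by positivity) ht
  obtain ⟨ρ, hρ⟩ := H.exists_scale_bound D
  refine (weak_type_of_stronglyDoubling (W := Set.univ)
    (F := fun x => ENNReal.ofReal |h x|) (ρ := ρ) hβ.le ?_).trans ?_
  · rintro y ⟨hy, k, hk, hm⟩
    refine ⟨k, hρ t ht y hy k hk hm, hk, Set.subset_univ _, ?_⟩
    have h1 := mul_mass_le_of_le_abs_mean (c := 0) (t := t) hy H.integrable.integrableOn
      (by simpa using hm.le)
    simp only [sub_zero] at h1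
    rw [← ofReal_mass, ← ENNReal.ofReal_mul ht0, ← ofReal_integral_eq_lintegral_ofReal
      H.integrable.abs.integrableOn (Eventually.of_forall fun _ => abs_nonneg _)]
    exact ENNReal.ofReal_le_ofReal h1
  · rw [Measure.restrict_univ, ← ofReal_integral_eq_lintegral_ofReal H.integrable.abs
      (Eventually.of_forall fun _ => abs_nonneg _), ← ENNReal.ofReal_mul hβ.le]
    exact ENNReal.ofReal_le_ofReal (mul_le_mul_of_nonneg_left H.integral_le hβ.le)

/-- The good-`λ` step: raising the level by a multiple of the `RBMO` constant halves the measure of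
the level set. Around each point of the lower level set the largest strongly doubling cube `Q` with
a large mean is taken; its mean cannot exceed the level by much. Higher means near `Q` come from
smaller cubes, on which `h - m_Q h` is controlled by the weak type inequality. -/
theorem L1RBMO.measure_levelSet_add_le [IsLocallyFiniteMeasure μ] [NeZero μ]
    (D : GrowthData n μ β G) {h : EuclideanSpace ℝ (Fin d) → ℝ} {σ A t : ℝ}
    (H : L1RBMO n β μ h σ A) (ht : 2 * β ^ 4 * σ ≤ t) :
    2 * μ (levelSet β μ h (t + (σ * KBound n β G + 2 * β * (σ * oscConst n β G)))) ≤
      μ (levelSet β μ h (t - σ * KBound n β G)) := by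
  have hβ := D.β_pos
  have hσ := H.pos
  have hKB : 0 < KBound n β G := zero_lt_one.trans_le D.one_le_KBound
  have hO : 0 < oscConst n β G := zero_lt_one.trans_le D.one_le_oscConst
  set C₂ := σ * KBound n β G with hC₂
  have hC₂0 : 0 < C₂ := by positivity
  set E := σ * oscConst n β G with hE
  have hE0 : 0 < E := by positivity
  set κ := C₂ + 2 * β * E with hκ
  have hκ0 : C₂ < κ := by rw [hκ]; linarith [mul_pos (mul_pos two_pos hβ) hE0]
  obtain ⟨ρ, hρ⟩ := H.exists_scale_bound D
  have hmax : ∀ x ∈ levelSet β μ h t, ∃ k, (StronglyDoubling β μ x k ∧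
      t < |mean μ (dyad x k) h|) ∧ ∀ i, k < i → ¬(StronglyDoubling β μ x i ∧
      t < |mean μ (dyad x i) h|) := fun x hx =>
    exists_greatest_scale hx.2 fun k hk => hρ t ht x hx.1 k hk.1 hk.2
  choose! k hk hkmax using hmax
  have hpeak : ∀ x ∈ levelSet β μ h t, ∀ j, k x < j → ∃ l, IsPeak β μ x j l ∧
      |mean μ (dyad x l) h| ≤ t := by
    intro x hx j hj
    obtain ⟨l, hl⟩ := D.exists_isPeak hx.1 j
    refine ⟨l, hl, not_lt.1 fun hlt => hkmax x hx l (hj.trans_le hl.1) ⟨hl.stronglyDoubling, hlt⟩⟩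
  -- the mean over a maximal cube exceeds `t` by at most `C₂`
  have hmean : ∀ x ∈ levelSet β μ h t, |mean μ (dyad x (k x)) h| ≤ t + C₂ := by
    intro x hx
    obtain ⟨l, hl, hlt⟩ := hpeak x hx (k x + 1) (by omega)
    have h1 := H.bound.abs_mean_sub_le (G := G) hx.1 hx.1 (hk x hx).1.doubling
      hl.stronglyDoubling.doubling (dset_mono (by have := hl.1; omega))
      (hl.K_le D (by omega) (by omega) (by rw [supDist_self]; positivity))
    have h2 := abs_sub_abs_le_abs_sub (mean μ (dyad x (k x)) h) (mean μ (dyad x l) h)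
    linarith
  obtain ⟨I, hIY, hIc, hdisj, hcov⟩ := exists_disjoint_covering (levelSet β μ h t) k
    fun x hx => hρ t ht x hx.1 _ (hk x hx).1 (hk x hx).2
  set U : EuclideanSpace ℝ (Fin d) → Set (EuclideanSpace ℝ (Fin d)) := fun x =>
    {y | y ∈ levelSet β μ h (t + κ) ∧ supDist x y ≤ 2 ^ k x} with hU
  have hsub : levelSet β μ h (t + κ) ⊆ ⋃ x ∈ I, U x := by
    intro y hy
    obtain ⟨x, hx, -, hxy⟩ := hcov y (levelSet_anti (by linarith) hy)
    exact Set.mem_biUnion hx ⟨hy, hxy⟩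
  have hlocal : ∀ x ∈ I, 2 * μ (U x) ≤ μ (dset x (k x)) := by
    intro x hxI
    have hx := hIY hxI
    have hweak := weak_type_of_stronglyDoubling (μ := μ) (Y := U x) (W := dset x (k x + 2))
      (F := fun y => ENNReal.ofReal |h y - mean μ (dyad x (k x)) h|)
      (c := ENNReal.ofReal (2 * β * E)) (ρ := 2 ^ k x * 8) hβ.le ?_
    · rw [← ofReal_integral_eq_lintegral_ofReal (H.bound.integrableOn_abs_sub _ _ _)
        (Eventually.of_forall fun _ => abs_nonneg _)] at hweak
      have h1 := ENNReal.ofReal_le_ofReal (H.bound.oscillation_le D hx.1 (hk x hx).1)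
      have h2 := hweak.trans (mul_le_mul_right h1 _)
      have e1 : ENNReal.ofReal (2 * β * E) = ENNReal.ofReal (β * E) * 2 := by
        rw [mul_assoc, mul_comm, ENNReal.ofReal_mul' two_pos.le, ENNReal.ofReal_ofNat]
      have e2 : ENNReal.ofReal β * ENNReal.ofReal (E * mass μ x (k x)) =
          ENNReal.ofReal (β * E) * μ (dset x (k x)) := by
        rw [ENNReal.ofReal_mul hE0.le, ENNReal.ofReal_mul hβ.le, ofReal_mass, mul_assoc]
      rw [← hE, e1, e2, mul_assoc] at h2
      exact (ENNReal.mul_le_mul_iff_right (ENNReal.ofReal_pos.2 (by positivity)).ne'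
        ENNReal.ofReal_ne_top).1 h2
    · rintro y ⟨⟨hy, j, hj, hm⟩, hxy⟩
      -- If the cube around `y` were not smaller, the peak cube of `x` above its scale would have a mean
      -- of size at most `t`, and the mean over the cube around `y` would be at most `t + C₂ < t + κ`.
      have hjk : j < k x := by
        by_contra hcon
        rw [not_lt] at hcon
        obtain ⟨l, hl, hlt⟩ := hpeak x hx (j + 2) (by omega)
        have h4 := two_zpow_le hcon
        have h1 := H.bound.abs_mean_sub_le (G := G) hx.1 hy hj.doubling
          hl.stronglyDoubling.doubling
          ((dset_subset (k := j + 2) (by rw [two_zpow_add_two]; linarith [two_zpow_pos j])).trans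
            (dset_mono hl.1))
          (hl.K_le D (by omega) (by omega) (by rw [two_zpow_add_two]; linarith [two_zpow_pos j]))
        have h2 := abs_sub_abs_le_abs_sub (mean μ (dyad y j) h) (mean μ (dyad x l) h)
        linarith
      have h4 := two_zpow_le hjk.le
      refine ⟨j, by linarith [supDist_nonneg 0 y], hj,
        dset_subset (by rw [two_zpow_add_two]; linarith [two_zpow_pos (k x)]), ?_⟩
      have h5 : 2 * β * E ≤ |mean μ (dyad y j) h - mean μ (dyad x (k x)) h| := by
        have h2 := abs_sub_abs_le_abs_sub (mean μ (dyad y j) h) (mean μ (dyad x (k x)) h)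
        have h3 := hmean x hx
        linarith
      have h6 := mul_mass_le_of_le_abs_mean hy H.integrable.integrableOn h5
      rw [← ofReal_mass, ← ENNReal.ofReal_mul (by positivity),
        ← ofReal_integral_eq_lintegral_ofReal (H.bound.integrableOn_abs_sub _ _ _)
        (Eventually.of_forall fun _ => abs_nonneg _)]
      exact ENNReal.ofReal_le_ofReal h6
  -- Around each point of a selected cube there is a strongly doubling cube of comparable size or
  -- larger, whose mean differs from that of the selected cube by at most `C₂`.
  have hincl : (⋃ x ∈ I, dset x (k x)) ⊆ levelSet β μ h (t - C₂) ∪ μ.supportᶜ := by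
    refine Set.iUnion₂_subset fun x hxI z hz => ?_
    by_cases hzs : z ∈ μ.support
    · left
      have hx := hIY hxI
      rw [mem_dset] at hz
      obtain ⟨l, hl⟩ := D.exists_isPeak hzs (k x + 1)
      refine ⟨hzs, l, hl.stronglyDoubling, ?_⟩
      have h4 := two_zpow_pos (k x)
      have h1 := H.bound.abs_mean_sub_le (G := G) hzs hx.1 (hk x hx).1.doubling
        hl.stronglyDoubling.doubling
        ((dset_subset (k := k x + 1) (by
          rw [two_zpow_add_one, supDist_comm]; linarith)).trans (dset_mono hl.1))
        (hl.K_le D (by omega) (by omega) (by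
          rw [two_zpow_add_two, supDist_comm]; linarith))
      have h2 := abs_sub_abs_le_abs_sub (mean μ (dyad x (k x)) h) (mean μ (dyad z l) h)
      linarith [(hk x hx).2]
    · exact Or.inr hzs
  have : Countable I := hIc.to_subtype
  calc 2 * μ (levelSet β μ h (t + κ))
      ≤ 2 * ∑' x : I, μ (U x) := by
        gcongr
        exact (measure_mono hsub).trans (measure_biUnion_le μ hIc _)
    _ = ∑' x : I, 2 * μ (U x) := ENNReal.tsum_mul_left.symm
    _ ≤ ∑' x : I, μ (dset (x : EuclideanSpace ℝ (Fin d)) (k x)) :=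
        ENNReal.tsum_le_tsum fun x => hlocal x x.2
    _ = μ (⋃ x ∈ I, dset x (k x)) :=
        (measure_biUnion hIc hdisj fun x _ => measurableSet_dset x _).symm
    _ ≤ μ (levelSet β μ h (t - C₂)) + μ μ.supportᶜ :=
        (measure_mono hincl).trans (measure_union_le _ _)
    _ = μ (levelSet β μ h (t - C₂)) := by rw [Measure.measure_compl_support, add_zero]

theorem summable_add_two_rpow_mul_geometric (r : ℝ) :
    Summable fun m : ℕ => ((m : ℝ) + 2) ^ r * (1 / 2) ^ m := by
  have h1 := (summable_nat_add_iff 2).2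
    (summable_pow_mul_geometric_of_norm_lt_one (R := ℝ) ⌈r⌉₊ (r := 1 / 2) (by norm_num))
  refine (h1.mul_left 4).of_nonneg_of_le (fun m => by positivity) fun m => ?_
  have h2 : ((m : ℝ) + 2) ^ r ≤ ((m : ℝ) + 2) ^ ⌈r⌉₊ := by
    rw [← Real.rpow_natCast]
    exact Real.rpow_le_rpow_of_exponent_le (by linarith [(Nat.cast_nonneg m : (0 : ℝ) ≤ m)])
      (Nat.le_ceil r)
  have h3 : (0 : ℝ) ≤ (1 / 2) ^ m := by positivity
  push_cast
  rw [pow_add]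
  linarith [mul_le_mul_of_nonneg_right h2 h3]

/-- The ratio between the base level and the `RBMO` constant in the John–Nirenberg inequality. -/
def levelConst (n : ℕ) (β G : ℝ) : ℝ := 2 * β ^ 4 + 2 * KBound n β G + 2 * β * oscConst n β G

/-- A form of the John–Nirenberg inequality: a function in `L¹ ∩ RBMO` lies in every `L^r`, and
`‖h‖_r ^ r ≤ C σ ^ (r - 1) ‖h‖₁`. -/
theorem GrowthData.exists_lintegral_rpow_le [IsLocallyFiniteMeasure μ] [NeZero μ]
    (D : GrowthData n μ β G) {r : ℝ} (hr : 1 ≤ r) :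
    ∃ C : ℝ, 0 ≤ C ∧ ∀ (h : EuclideanSpace ℝ (Fin d) → ℝ) (σ A : ℝ), L1RBMO n β μ h σ A →
      ∫⁻ x, ENNReal.ofReal (|h x| ^ r) ∂μ ≤ ENNReal.ofReal (C * (σ ^ (r - 1) * A)) := by
  have hβ := D.β_pos
  have hKB : 0 < KBound n β G := zero_lt_one.trans_le D.one_le_KBound
  have hO : 0 < oscConst n β G := zero_lt_one.trans_le D.one_le_oscConst
  set τ := levelConst n β G with hτ
  have hτ0 : 0 < τ := by rw [hτ, levelConst]; positivity
  set Z := ∑' m : ℕ, ((m : ℝ) + 2) ^ r * (1 / 2) ^ m with hZ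
  have hZ0 : 0 ≤ Z := tsum_nonneg fun m => by positivity
  refine ⟨τ ^ (r - 1) * (1 + β * Z), by positivity, fun h σ A H => ?_⟩
  have hσ := H.pos
  have hA := H.nonneg
  set T := σ * τ with hT
  have hT0 : 0 < T := by positivity
  have hTr : T ^ (r - 1) = σ ^ (r - 1) * τ ^ (r - 1) := Real.mul_rpow hσ.le hτ0.le
  have hT1 : 2 * β ^ 4 * σ ≤ T := by
    have : 0 ≤ σ * (2 * KBound n β G + 2 * β * oscConst n β G) := by positivity
    rw [hT, hτ, levelConst]
    linarith
  have hstep : ∀ t, T ≤ t → 2 * μ (levelSet β μ h (t + T)) ≤ μ (levelSet β μ h t) := by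
    intro t ht
    have h1 := H.measure_levelSet_add_le D (t := t + σ * KBound n β G)
      (by nlinarith [mul_pos hσ hKB])
    rw [add_sub_cancel_right] at h1
    refine le_trans ?_ h1
    gcongr
    refine levelSet_anti ?_
    have : 0 ≤ σ * (2 * β ^ 4) := by positivity
    rw [hT, hτ, levelConst]
    linarith
  have hdecay : ∀ m : ℕ, 2 ^ m * μ (levelSet β μ h ((m + 1) * T)) ≤
      ENNReal.ofReal (β * A / T) := by
    intro m
    induction m with
    | zero =>
      have h1 := H.measure_levelSet_le D hT1
      rw [ENNReal.ofReal_div_of_pos hT0]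
      rw [ENNReal.le_div_iff_mul_le (Or.inl (ENNReal.ofReal_pos.2 hT0).ne')
        (Or.inl ENNReal.ofReal_ne_top), mul_comm]
      simpa using h1
    | succ m ih =>
      refine le_trans ?_ ih
      rw [pow_succ, mul_assoc]
      gcongr
      have h1 := hstep ((m + 1) * T) (by nlinarith [(Nat.cast_nonneg m : (0 : ℝ) ≤ m)])
      have e : (((m + 1 : ℕ) : ℝ) + 1) * T = (m + 1) * T + T := by
        push_cast
        ring
      rw [e]
      exact h1
  set Ω : ℕ → Set (EuclideanSpace ℝ (Fin d)) := fun m =>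
    toMeasurable μ (levelSet β μ h ((m + 1) * T)) with hΩ
  have hpt : ∀ᵐ x ∂μ, ENNReal.ofReal (|h x| ^ r) ≤ ENNReal.ofReal (T ^ (r - 1) * |h x|) +
      ∑' m : ℕ, (Ω m).indicator (fun _ => ENNReal.ofReal ((((m : ℝ) + 2) * T) ^ r)) x := by
    filter_upwards [ae_le_of_notMem_levelSet D H.integrable.locallyIntegrable] with x hx
    -- If `|h x| > T`, then `(m + 1) T < |h x| ≤ (m + 2) T` for some `m`.
    rcases le_or_gt |h x| T with hle | hgt
    · refine le_add_right (ENNReal.ofReal_le_ofReal ?_)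
      rcases (abs_nonneg (h x)).eq_or_lt with h0 | h0
      · rw [← h0, Real.zero_rpow (by linarith), mul_zero]
      · calc |h x| ^ r = |h x| ^ (r - 1) * |h x| := by
              rw [← Real.rpow_add_one h0.ne', sub_add_cancel]
          _ ≤ T ^ (r - 1) * |h x| := by
              gcongr
    · have h1 : 1 < |h x| / T := (one_lt_div hT0).2 hgt
      have h2 : 1 < ⌈|h x| / T⌉₊ := by
        rw [Nat.lt_ceil]
        exact_mod_cast h1
      obtain ⟨m, hm⟩ : ∃ m, ⌈|h x| / T⌉₊ = m + 2 := ⟨⌈|h x| / T⌉₊ - 2, by omega⟩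
      have h3 : |h x| ≤ (m + 2) * T := by
        rw [← div_le_iff₀ hT0]
        exact (Nat.le_ceil _).trans (by rw [hm]; push_cast; exact le_rfl)
      have h4 : ((m : ℝ) + 1) * T < |h x| := by
        rw [← lt_div_iff₀ hT0]
        have : m + 1 < ⌈|h x| / T⌉₊ := by omega
        rw [Nat.lt_ceil] at this
        exact_mod_cast this
      have hmem : x ∈ Ω m := by
        apply subset_toMeasurable
        by_contra hcon
        exact absurd (hx _ hcon) (not_le.2 h4)
      refine le_add_left (le_trans ?_ (ENNReal.le_tsum m))
      rw [Set.indicator_of_mem hmem]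
      exact ENNReal.ofReal_le_ofReal (Real.rpow_le_rpow (abs_nonneg _) h3 (by linarith))
  refine (lintegral_mono_ae hpt).trans ?_
  rw [lintegral_add_left' (H.integrable.abs.const_mul _).aemeasurable.ennreal_ofReal,
    lintegral_tsum fun m => (measurable_const.indicator (measurableSet_toMeasurable _ _)).aemeasurable]
  have hfirst : ∫⁻ x, ENNReal.ofReal (T ^ (r - 1) * |h x|) ∂μ ≤
      ENNReal.ofReal (T ^ (r - 1) * A) := by
    rw [← ofReal_integral_eq_lintegral_ofReal (H.integrable.abs.const_mul _)
      (Eventually.of_forall fun _ => by positivity), integral_const_mul]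
    exact ENNReal.ofReal_le_ofReal (mul_le_mul_of_nonneg_left H.integral_le (by positivity))
  have hsecond : ∑' m : ℕ, ∫⁻ x, (Ω m).indicator
      (fun _ => ENNReal.ofReal ((((m : ℝ) + 2) * T) ^ r)) x ∂μ ≤
      ENNReal.ofReal (Z * (T ^ (r - 1) * (β * A))) := by
    have hterm : ∀ m : ℕ, ∫⁻ x, (Ω m).indicator
        (fun _ => ENNReal.ofReal ((((m : ℝ) + 2) * T) ^ r)) x ∂μ ≤
        ENNReal.ofReal (((m : ℝ) + 2) ^ r * (1 / 2) ^ m * (T ^ (r - 1) * (β * A))) := by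
      intro m
      rw [lintegral_indicator_const (measurableSet_toMeasurable _ _), measure_toMeasurable]
      have h1 : μ (levelSet β μ h ((m + 1) * T)) ≤
          ENNReal.ofReal ((1 / 2) ^ m * (β * A / T)) := by
        rw [ENNReal.ofReal_mul (by positivity), one_div, inv_pow,
          ENNReal.ofReal_inv_of_pos (by positivity), ENNReal.ofReal_pow two_pos.le,
          ENNReal.ofReal_ofNat, ← ENNReal.div_eq_inv_mul,
          ENNReal.le_div_iff_mul_le (Or.inl (by simp)) (Or.inl (by simp)), mul_comm]
        exact hdecay m
      refine (mul_le_mul_right h1 _).trans ?_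
      rw [← ENNReal.ofReal_mul (by positivity)]
      refine ENNReal.ofReal_le_ofReal (le_of_eq ?_)
      rw [Real.mul_rpow (by positivity) hT0.le, Real.rpow_sub_one hT0.ne']
      field_simp
    refine (ENNReal.tsum_le_tsum hterm).trans ?_
    rw [← ENNReal.ofReal_tsum_of_nonneg (fun m => by positivity)
      ((summable_add_two_rpow_mul_geometric r).mul_right _), tsum_mul_right]
  refine (add_le_add hfirst hsecond).trans ?_
  rw [← ENNReal.ofReal_add (by positivity) (by positivity)]
  refine ENNReal.ofReal_le_ofReal (le_of_eq ?_)
  rw [hTr]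
  ring

/-! ### Atomic blocks -/

theorem Cube.measure_toSet_lt_top [IsLocallyFiniteMeasure μ] {Q : Cube d} (hQ : Q.Admissible μ) :
    μ Q.toSet < ∞ := by
  cases Q with
  | whole => exact hQ
  | box c l =>
    obtain ⟨N, hN⟩ := pow_unbounded_of_one_lt l (one_lt_two (α := ℝ))
    refine (measure_mono (t := dset c (N : ℤ)) fun y hy i => (hy i).trans ?_).trans_lt
      (measure_dset_lt_top c _)
    rw [zpow_natCast]
    linarith

theorem Cube.toSet_subset_dilate_two {Q : Cube d} (hQ : Q.Admissible μ) :
    Q.toSet ⊆ (Q.dilate 2).toSet := by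
  cases Q with
  | whole => exact subset_rfl
  | box c l => exact fun y hy i => (hy i).trans (by linarith [hQ.2])

theorem Cube.Admissible.dilate_two {Q : Cube d} (hQ : Q.Admissible μ) :
    (Q.dilate 2).Admissible μ := by
  cases Q with
  | whole => exact hQ
  | box c l => exact ⟨hQ.1, mul_pos two_pos hQ.2⟩

theorem one_le_K {Q : Cube d} (hQ : Q.Admissible μ) (R : Cube d) : 1 ≤ K n μ Q R := by
  cases Q with
  | whole => cases R <;> exact le_rfl
  | box c l =>
    have hl : 0 < l := hQ.2
    cases R with
    | whole =>
      rw [K, le_add_iff_nonneg_right]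
      exact tsum_nonneg fun k => by positivity
    | box c' r =>
      rw [K, le_add_iff_nonneg_right]
      exact Finset.sum_nonneg fun k _ => by positivity

theorem IsAtomicBlock.nonneg {b : EuclideanSpace ℝ (Fin d) → ℝ} {c : ℝ}
    (h : IsAtomicBlock n μ b c) : 0 ≤ c := by
  obtain ⟨-, -, -, -, -, coef, -, -, -, hc, -⟩ := h
  exact hc.nonneg fun j => abs_nonneg _

theorem IsAtomicBlock.integrable {b : EuclideanSpace ℝ (Fin d) → ℝ} {c : ℝ}
    (h : IsAtomicBlock n μ b c) : Integrable b μ := by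
  obtain ⟨-, -, -, hi, -⟩ := h
  exact hi

theorem IsAtomicBlock.integral_eq_zero {b : EuclideanSpace ℝ (Fin d) → ℝ} {c : ℝ}
    (h : IsAtomicBlock n μ b c) : ∫ x, b x ∂μ = 0 := by
  obtain ⟨-, -, -, -, hi, -⟩ := h
  exact hi

theorem lintegral_atom_le_one [IsLocallyFiniteMeasure μ] {Q R : Cube d}
    {a : EuclideanSpace ℝ (Fin d) → ℝ} (hQ : Q.Admissible μ)
    (ha : ∀ᵐ x ∂μ, x ∉ Q.toSet → a x = 0)
    (hbd : ∀ᵐ x ∂μ, |a x| ≤ (μ.real (Q.dilate 2).toSet * K n μ Q R)⁻¹) :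
    ∫⁻ x, ‖a x‖ₑ ∂μ ≤ 1 := by
  set w := μ.real (Q.dilate 2).toSet * K n μ Q R with hw
  have hK := one_le_K (n := n) hQ R
  have hfin := Cube.measure_toSet_lt_top hQ.dilate_two
  have hw0 : 0 ≤ w := mul_nonneg measureReal_nonneg (zero_le_one.trans hK)
  have h1 : ∀ᵐ x ∂μ, ‖a x‖ₑ ≤
      ((Q.dilate 2).toSet).indicator (fun _ => ENNReal.ofReal w⁻¹) x := by
    filter_upwards [ha, hbd] with x hx hxb
    by_cases hxQ : x ∈ (Q.dilate 2).toSet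
    · rw [Set.indicator_of_mem hxQ, Real.enorm_eq_ofReal_abs]
      exact ENNReal.ofReal_le_ofReal hxb
    · rw [Set.indicator_of_notMem hxQ, hx fun h => hxQ (Cube.toSet_subset_dilate_two hQ h),
        enorm_zero]
  refine (lintegral_mono_ae h1).trans ((lintegral_indicator_const_le _ _).trans ?_)
  have h2 : μ (Q.dilate 2).toSet ≤ ENNReal.ofReal w := by
    rw [← ENNReal.ofReal_toReal hfin.ne]
    exact ENNReal.ofReal_le_ofReal (le_mul_of_one_le_right measureReal_nonneg hK)
  refine (mul_le_mul_right h2 _).trans ?_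
  rw [← ENNReal.ofReal_mul (inv_nonneg.2 hw0), ← ENNReal.ofReal_one]
  exact ENNReal.ofReal_le_ofReal (inv_mul_le_one)

theorem IsAtomicBlock.lintegral_enorm_le [IsLocallyFiniteMeasure μ]
    {b : EuclideanSpace ℝ (Fin d) → ℝ} {c : ℝ} (h : IsAtomicBlock n μ b c) :
    ∫⁻ x, ‖b x‖ₑ ∂μ ≤ ENNReal.ofReal c := by
  obtain ⟨R, -, -, -, -, coef, Q, a, ha, hc, hs⟩ := h
  calc ∫⁻ x, ‖b x‖ₑ ∂μ ≤ ∫⁻ x, ∑' j, ‖coef j * a j x‖ₑ ∂μ := by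
        refine lintegral_mono_ae ?_
        filter_upwards [hs] with x hx
        rw [← hx.tsum_eq]
        exact enorm_tsum_le_tsum_enorm
    _ = ∑' j, ∫⁻ x, ‖coef j * a j x‖ₑ ∂μ :=
        lintegral_tsum fun j => ((ha j).2.2.1.const_mul _).enorm
    _ ≤ ∑' j, ‖coef j‖ₑ := by
        refine ENNReal.tsum_le_tsum fun j => ?_
        simp_rw [enorm_mul]
        rw [lintegral_const_mul'' _ (ha j).2.2.1.enorm]
        exact mul_le_of_le_one_right' (lintegral_atom_le_one (ha j).1 (ha j).2.2.2.1 (ha j).2.2.2.2)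
    _ = ENNReal.ofReal c := by
        simp_rw [Real.enorm_eq_ofReal_abs]
        rw [← ENNReal.ofReal_tsum_of_nonneg (fun _ => abs_nonneg _) hc.summable, hc.tsum_eq]

theorem HasAtomicBlockSum.nonneg {f : EuclideanSpace ℝ (Fin d) → ℝ} {s : ℝ}
    (h : HasAtomicBlockSum n μ f s) : 0 ≤ s := by
  obtain ⟨b, c, hb, hc, -⟩ := h
  exact hc.nonneg fun i => (hb i).nonneg

theorem HasAtomicBlockSum.congr {f g : EuclideanSpace ℝ (Fin d) → ℝ} {s : ℝ}
    (h : HasAtomicBlockSum n μ f s) (hfg : f =ᵐ[μ] g) : HasAtomicBlockSum n μ g s := by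
  obtain ⟨b, c, hb, hc, hs⟩ := h
  refine ⟨b, c, hb, hc, ?_⟩
  filter_upwards [hs, hfg] with x hx hxg
  rwa [← hxg]

theorem HasAtomicBlockSum.neg {f : EuclideanSpace ℝ (Fin d) → ℝ} {s : ℝ}
    (h : HasAtomicBlockSum n μ f s) : HasAtomicBlockSum n μ (fun x => -f x) s := by
  obtain ⟨b, c, hb, hc, hs⟩ := h
  refine ⟨fun i x => -1 * b i x, c, fun i => by simpa using (hb i).smul (-1), hc, ?_⟩
  filter_upwards [hs] with x hx
  simpa using hx.neg

theorem HasAtomicBlockSum.sub {f g : EuclideanSpace ℝ (Fin d) → ℝ} {s t : ℝ}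
    (hf : HasAtomicBlockSum n μ f s) (hg : HasAtomicBlockSum n μ g t) :
    HasAtomicBlockSum n μ (fun x => f x - g x) (s + t) := by
  simpa only [sub_eq_add_neg] using hf.add hg.neg

theorem hasAtomicBlockSum_of_countable {ι : Type*} [Countable ι]
    {b : ι → EuclideanSpace ℝ (Fin d) → ℝ} {c : ι → ℝ} {f : EuclideanSpace ℝ (Fin d) → ℝ} {s : ℝ}
    (hb : ∀ i, IsAtomicBlock n μ (b i) (c i)) (hc : HasSum c s)
    (hs : ∀ᵐ x ∂μ, HasSum (fun i => b i x) (f x)) : HasAtomicBlockSum n μ f s := by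
  obtain ⟨e, he⟩ := exists_injective_nat ι
  refine ⟨Function.extend e b fun _ _ => 0, Function.extend e c fun _ => 0, fun j => ?_, ?_, ?_⟩
  · by_cases hj : ∃ i, e i = j
    · obtain ⟨i, rfl⟩ := hj
      rw [he.extend_apply, he.extend_apply]
      exact hb i
    · rw [Function.extend_apply' _ _ _ hj, Function.extend_apply' _ _ _ hj]
      exact isAtomicBlock_zero n μ
  · rw [← he.hasSum_iff]
    · convert hc using 1
      ext i
      exact he.extend_apply _ _ _
    · exact fun j hj => Function.extend_apply' _ _ _ hj
  · filter_upwards [hs] with x hx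
    rw [← he.hasSum_iff]
    · convert hx using 1
      ext i
      simp only [Function.comp_apply, he.extend_apply]
    · intro j hj
      rw [Function.extend_apply' _ _ _ hj]

theorem IsAtomicBlock.hasAtomicBlockSum {b : EuclideanSpace ℝ (Fin d) → ℝ} {c : ℝ}
    (h : IsAtomicBlock n μ b c) : HasAtomicBlockSum n μ b c :=
  hasAtomicBlockSum_of_countable (ι := Unit) (b := fun _ => b) (c := fun _ => c) (fun _ => h)
    (hasSum_unique _) (Eventually.of_forall fun _ => hasSum_unique _)

theorem hasAtomicBlockSum_zero : HasAtomicBlockSum n μ (fun _ => 0) 0 :=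
  (isAtomicBlock_zero n μ).hasAtomicBlockSum

theorem HasAtomicBlockSum.finset_sum {ι : Type*} (t : Finset ι)
    {f : ι → EuclideanSpace ℝ (Fin d) → ℝ} {s : ι → ℝ}
    (h : ∀ i ∈ t, HasAtomicBlockSum n μ (f i) (s i)) :
    HasAtomicBlockSum n μ (fun x => ∑ i ∈ t, f i x) (∑ i ∈ t, s i) := by
  classical
  induction t using Finset.induction_on with
  | empty => simpa using hasAtomicBlockSum_zero
  | insert i t hi ih =>
    simp only [Finset.sum_insert hi]
    exact (h i (Finset.mem_insert_self i t)).add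
      (ih fun j hj => h j (Finset.mem_insert_of_mem hj))

theorem ae_summable_of_tsum_lintegral_ne_top {ι : Type*} [Countable ι]
    {f : ι → EuclideanSpace ℝ (Fin d) → ℝ} (hf : ∀ i, AEStronglyMeasurable (f i) μ)
    (h : ∑' i, ∫⁻ x, ‖f i x‖ₑ ∂μ ≠ ∞) : ∀ᵐ x ∂μ, Summable fun i => f i x := by
  rw [← lintegral_tsum fun i => (hf i).enorm] at h
  filter_upwards [ae_lt_top' (AEMeasurable.tsum fun i => (hf i).enorm) h] with x hx
  have h1 : Summable fun i => ‖f i x‖₊ := ENNReal.tsum_coe_ne_top_iff_summable.1 hx.ne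
  exact Summable.of_nnnorm h1

/-- Functions in the atomic block space are integrable with integral zero. -/
theorem HasAtomicBlockSum.integrable_and [IsLocallyFiniteMeasure μ]
    {f : EuclideanSpace ℝ (Fin d) → ℝ} {s : ℝ} (h : HasAtomicBlockSum n μ f s) :
    Integrable f μ ∧ ∫ x, |f x| ∂μ ≤ s ∧ ∫ x, f x ∂μ = 0 := by
  have hs0 := h.nonneg
  obtain ⟨b, c, hb, hc, hs⟩ := h
  have hmeas : AEStronglyMeasurable f μ := by
    refine aestronglyMeasurable_of_tendsto_ae atTop
      (f := fun (N : ℕ) x => ∑ i ∈ Finset.range N, b i x) (fun N => ?_) ?_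
    · exact Finset.aestronglyMeasurable_fun_sum _ fun i _ => (hb i).integrable.1
    · filter_upwards [hs] with x hx
      exact hx.tendsto_sum_nat
  have hle : ∫⁻ x, ‖f x‖ₑ ∂μ ≤ ENNReal.ofReal s := by
    calc ∫⁻ x, ‖f x‖ₑ ∂μ ≤ ∫⁻ x, ∑' j, ‖b j x‖ₑ ∂μ := by
          refine lintegral_mono_ae ?_
          filter_upwards [hs] with x hx
          rw [← hx.tsum_eq]
          exact enorm_tsum_le_tsum_enorm
      _ = ∑' j, ∫⁻ x, ‖b j x‖ₑ ∂μ := lintegral_tsum fun j => (hb j).integrable.1.enorm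
      _ ≤ ∑' j, ENNReal.ofReal (c j) := ENNReal.tsum_le_tsum fun j => (hb j).lintegral_enorm_le
      _ = ENNReal.ofReal s := by
          rw [← ENNReal.ofReal_tsum_of_nonneg (fun j => (hb j).nonneg) hc.summable, hc.tsum_eq]
  have hint : Integrable f μ := ⟨hmeas, hle.trans_lt ENNReal.ofReal_lt_top⟩
  have habs : ∀ {g : EuclideanSpace ℝ (Fin d) → ℝ} {t : ℝ}, 0 ≤ t → Integrable g μ →
      ∫⁻ x, ‖g x‖ₑ ∂μ ≤ ENNReal.ofReal t → ∫ x, |g x| ∂μ ≤ t := by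
    intro g t ht hg hgt
    have h1 := integral_norm_eq_lintegral_enorm hg.1
    simp only [Real.norm_eq_abs] at h1
    rw [h1]
    exact ENNReal.toReal_le_of_le_ofReal ht hgt
  refine ⟨hint, habs hs0 hint hle, ?_⟩
  have hsum := hasSum_integral_of_summable_integral_norm (fun i => (hb i).integrable)
    (hc.summable.of_nonneg_of_le (fun i => integral_nonneg fun _ => norm_nonneg _) fun i =>
      habs (hb i).nonneg (hb i).integrable (hb i).lintegral_enorm_le)
  have hfeq : ∫ x, f x ∂μ = ∫ x, ∑' i, b i x ∂μ := by
    refine integral_congr_ae ?_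
    filter_upwards [hs] with x hx
    exact hx.tsum_eq.symm
  rw [hfeq, ← hsum.tsum_eq]
  simp [fun i => (hb i).integral_eq_zero]

/-- Countable sums in the atomic block space. -/
theorem HasAtomicBlockSum.tsum [IsLocallyFiniteMeasure μ]
    {f : ℕ → EuclideanSpace ℝ (Fin d) → ℝ} {s : ℕ → ℝ} {F : EuclideanSpace ℝ (Fin d) → ℝ}
    (h : ∀ k, HasAtomicBlockSum n μ (f k) (s k)) (hs : Summable s)
    (hF : ∀ᵐ x ∂μ, HasSum (fun k => f k x) (F x)) :
    HasAtomicBlockSum n μ F (∑' k, s k) := by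
  choose b c hb hc hbs using h
  have hcs : Summable fun p : ℕ × ℕ => c p.1 p.2 := by
    rw [summable_prod_of_nonneg fun p => (hb p.1 p.2).nonneg]
    exact ⟨fun k => (hc k).summable, by simpa only [(hc _).tsum_eq] using hs⟩
  have hsum : HasSum (fun p : ℕ × ℕ => c p.1 p.2) (∑' k, s k) := by
    rw [(hcs.hasSum.prod_fiberwise hc).tsum_eq]
    exact hcs.hasSum
  refine hasAtomicBlockSum_of_countable (b := fun p : ℕ × ℕ => b p.1 p.2) (fun p => hb p.1 p.2)
    hsum ?_
  have hfin : ∑' p : ℕ × ℕ, ∫⁻ x, ‖b p.1 p.2 x‖ₑ ∂μ ≠ ∞ := by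
    refine ne_top_of_le_ne_top (ENNReal.ofReal_ne_top (r := ∑' k, s k))
      ((ENNReal.tsum_le_tsum fun p : ℕ × ℕ => (hb p.1 p.2).lintegral_enorm_le).trans ?_)
    rw [← ENNReal.ofReal_tsum_of_nonneg (fun p : ℕ × ℕ => (hb p.1 p.2).nonneg) hcs, hsum.tsum_eq]
  filter_upwards [hF, ae_all_iff.2 hbs,
    ae_summable_of_tsum_lintegral_ne_top (f := fun p : ℕ × ℕ => b p.1 p.2)
      (fun p => (hb p.1 p.2).integrable.1) hfin]
    with x hx hbx hsx
  rw [hx.unique (hsx.hasSum.prod_fiberwise hbx)]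
  exact hsx.hasSum

/-- A function with mean zero that is the sum of two bounded functions supported in cubes
`Q₀, Q₁ ⊆ R` is an atomic block. -/
theorem isAtomicBlock_add {R Q₀ Q₁ : Cube d} {f₀ f₁ : EuclideanSpace ℝ (Fin d) → ℝ}
    {v₀ v₁ w₀ w₁ : ℝ} (hR : R.Admissible μ) (hQ₀ : Q₀.Admissible μ) (hQ₁ : Q₁.Admissible μ)
    (hs₀ : Q₀.toSet ⊆ R.toSet) (hs₁ : Q₁.toSet ⊆ R.toSet)
    (hm₀ : Integrable f₀ μ) (hm₁ : Integrable f₁ μ)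
    (hz₀ : ∀ x, x ∉ Q₀.toSet → f₀ x = 0) (hz₁ : ∀ x, x ∉ Q₁.toSet → f₁ x = 0)
    (hv₀ : 0 ≤ v₀) (hv₁ : 0 ≤ v₁)
    (hb₀ : ∀ᵐ x ∂μ, |f₀ x| ≤ v₀) (hb₁ : ∀ᵐ x ∂μ, |f₁ x| ≤ v₁)
    (hw₀ : w₀ = μ.real (Q₀.dilate 2).toSet * K n μ Q₀ R)
    (hw₁ : w₁ = μ.real (Q₁.dilate 2).toSet * K n μ Q₁ R) (hp₀ : 0 < w₀) (hp₁ : 0 < w₁)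
    (hint : ∫ x, (f₀ x + f₁ x) ∂μ = 0) :
    IsAtomicBlock n μ (fun x => f₀ x + f₁ x) (v₀ * w₀ + v₁ * w₁) := by
  have hatom : ∀ {f : EuclideanSpace ℝ (Fin d) → ℝ} {v w : ℝ}, 0 ≤ v → 0 < w →
      (∀ᵐ x ∂μ, |f x| ≤ v) → ∀ᵐ x ∂μ, |(v * w)⁻¹ * f x| ≤ w⁻¹ := by
    intro f v w hv hw hf
    filter_upwards [hf] with x hx
    rw [abs_mul, mul_inv, abs_mul, abs_of_nonneg (inv_nonneg.2 hv),
      abs_of_nonneg (inv_nonneg.2 hw.le), mul_right_comm]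
    refine mul_le_of_le_one_left (inv_nonneg.2 hw.le) ?_
    exact inv_mul_le_one_of_le₀ hx hv
  have hcoef : ∀ {f : EuclideanSpace ℝ (Fin d) → ℝ} {v w : ℝ}, 0 ≤ v → 0 < w →
      (∀ᵐ x ∂μ, |f x| ≤ v) → ∀ᵐ x ∂μ, v * w * ((v * w)⁻¹ * f x) = f x := by
    intro f v w hv hw hf
    filter_upwards [hf] with x hx
    rcases hv.eq_or_lt with h0 | h0
    · rw [← h0, abs_nonpos_iff] at hx
      rw [hx]
      simp
    · field_simp
  refine ⟨R, hR, ?_, hm₀.add hm₁, hint,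
    fun j => if j = 0 then v₀ * w₀ else if j = 1 then v₁ * w₁ else 0,
    fun j => if j = 0 then Q₀ else Q₁,
    fun j => if j = 0 then fun x => (v₀ * w₀)⁻¹ * f₀ x else fun x => (v₁ * w₁)⁻¹ * f₁ x,
    fun j => ?_, ?_, ?_⟩
  · refine Eventually.of_forall fun x hx => ?_
    change f₀ x + f₁ x = 0
    rw [hz₀ x fun h => hx (hs₀ h), hz₁ x fun h => hx (hs₁ h), add_zero]
  · by_cases hj : j = 0
    · simp only [hj, if_true]
      refine ⟨hQ₀, hs₀, hm₀.1.const_mul _, Eventually.of_forall fun x hx => ?_, ?_⟩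
      · rw [hz₀ x hx, mul_zero]
      · rw [← hw₀]
        exact hatom hv₀ hp₀ hb₀
    · simp only [hj, if_false]
      refine ⟨hQ₁, hs₁, hm₁.1.const_mul _, Eventually.of_forall fun x hx => ?_, ?_⟩
      · rw [hz₁ x hx, mul_zero]
      · rw [← hw₁]
        exact hatom hv₁ hp₁ hb₁
  · have h := hasSum_sum_of_ne_finset_zero (L := .unconditional ℕ) (s := Finset.range 2)
      (f := fun j : ℕ => |if j = 0 then v₀ * w₀ else if j = 1 then v₁ * w₁ else 0|) fun j hj => by
        rw [Finset.mem_range, not_lt] at hj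
        have h0 : j ≠ 0 := by omega
        have h1 : j ≠ 1 := by omega
        simp [h0, h1]
    convert h using 1
    simp [Finset.sum_range_succ, abs_of_nonneg hv₀, abs_of_nonneg hv₁, abs_of_pos hp₀,
      abs_of_pos hp₁]
  · filter_upwards [hcoef hv₀ hp₀ hb₀, hcoef hv₁ hp₁ hb₁] with x hx₀ hx₁
    have h := hasSum_sum_of_ne_finset_zero (L := .unconditional ℕ) (s := Finset.range 2)
      (f := fun j : ℕ => (if j = 0 then v₀ * w₀ else if j = 1 then v₁ * w₁ else 0) *
        (if j = 0 then fun x => (v₀ * w₀)⁻¹ * f₀ x else fun x => (v₁ * w₁)⁻¹ * f₁ x) x)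
      fun j hj => by
        rw [Finset.mem_range, not_lt] at hj
        have h0 : j ≠ 0 := by omega
        have h1 : j ≠ 1 := by omega
        simp [h0, h1]
    convert h using 1
    rw [Finset.sum_range_succ, Finset.sum_range_one]
    simp only [if_true, one_ne_zero, if_false, hx₀, hx₁]

/-- For finite measures every bounded function with mean zero is an atomic block, supported in the
cube `ℝ^d`. -/
theorem hasAtomicBlockSum_of_bounded [NeZero μ] (hfin : μ Set.univ < ∞)
    {u : EuclideanSpace ℝ (Fin d) → ℝ} {v : ℝ} (hu : AEStronglyMeasurable u μ)
    (hv : 0 ≤ v) (hb : ∀ᵐ x ∂μ, |u x| ≤ v) (h0 : ∫ x, u x ∂μ = 0) :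
    HasAtomicBlockSum n μ u (v * μ.real Set.univ) := by
  have : IsFiniteMeasure μ := ⟨hfin⟩
  have hpos : 0 < μ.real Set.univ :=
    ENNReal.toReal_pos (Measure.measure_univ_pos.2 (NeZero.ne μ)).ne' hfin.ne
  have hint : Integrable u μ := ⟨hu, HasFiniteIntegral.of_bounded (C := v) hb⟩
  have h := isAtomicBlock_add (n := n) (μ := μ) (R := .whole) (Q₀ := .whole) (Q₁ := .whole)
    (f₀ := u) (f₁ := fun _ => 0) (v₀ := v) (v₁ := 0) hfin hfin hfin subset_rfl subset_rfl hint
    (integrable_zero _ _ _) (fun x hx => absurd (Set.mem_univ x) hx) (fun _ _ => rfl) hv le_rfl hb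
    (by simp) rfl rfl (mul_pos hpos one_pos) (mul_pos hpos one_pos) (by simpa using h0)
  have e : K n μ (Cube.whole (d := d)) Cube.whole = 1 := rfl
  simp only [add_zero, zero_mul, e, mul_one] at h
  exact h.hasAtomicBlockSum

/-! ### The Calderón–Zygmund decomposition -/

theorem exists_disjoint_measurable_refinement {ι α : Type*} [Countable ι] [MeasurableSpace α]
    {Q : ι → Set α} (hQ : ∀ i, MeasurableSet (Q i)) :
    ∃ P : ι → Set α, (∀ i, MeasurableSet (P i)) ∧ (∀ i, P i ⊆ Q i) ∧
      Pairwise (Function.onFun Disjoint P) ∧ ⋃ i, P i = ⋃ i, Q i := by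
  obtain ⟨e, he⟩ := exists_injective_nat ι
  refine ⟨fun i => Q i \ ⋃ j, ⋃ _ : e j < e i, Q j, fun i => (hQ i).diff
    (MeasurableSet.iUnion fun j => MeasurableSet.iUnion fun _ => hQ j), fun i => Set.sdiff_subset,
    ?_, ?_⟩
  · have key : ∀ i j, e i < e j → Disjoint (Q i \ ⋃ l, ⋃ _ : e l < e i, Q l)
        (Q j \ ⋃ l, ⋃ _ : e l < e j, Q l) := by
      intro i j hij
      rw [Set.disjoint_left]
      rintro x ⟨hx, -⟩ ⟨-, hx2⟩
      exact hx2 (Set.mem_iUnion₂.2 ⟨i, hij, hx⟩)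
    intro i j hij
    rcases lt_or_gt_of_ne (he.ne hij) with h | h
    · exact key i j h
    · exact (key j i h).symm
  · refine (Set.iUnion_mono fun i => Set.sdiff_subset).antisymm fun x hx => ?_
    obtain ⟨i₀, hi₀⟩ := Set.mem_iUnion.1 hx
    obtain ⟨i, hi, hmin⟩ := (measure e).wf.has_min {i | x ∈ Q i} ⟨i₀, hi₀⟩
    refine Set.mem_iUnion.2 ⟨i, hi, fun hcon => ?_⟩
    obtain ⟨j, hj, hxj⟩ := Set.mem_iUnion₂.1 hcon
    exact hmin j hxj hj

theorem abs_indicator_le {α : Type*} (s : Set α) (f : α → ℝ) (x : α) : |s.indicator f x| ≤ |f x| :=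
  norm_indicator_le_norm_self f x

/-- If the masses `m i` attached to the sets `R i` satisfy a Carleson packing condition, each of
them can be spread over a subset `A i` of at least half the measure of `R i` in such a way that the
total density stays bounded. The set `A i` consists of the points of `R i` at which the densities
coming from the sets of no larger size have a bounded sum. -/
theorem exists_subset_tsum_le {ι α : Type*} [Countable ι] [MeasurableSpace α] {ν : Measure α}
    {R : ι → Set α} (hR : ∀ i, MeasurableSet (R i)) (hR0 : ∀ i, ν (R i) ≠ 0)
    (hRt : ∀ i, ν (R i) ≠ ∞) (r : ι → ℤ) (m : ι → ℝ≥0∞) {M : ℝ≥0∞} (hM0 : M ≠ 0) (hMt : M ≠ ∞)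
    (hpack : ∀ i, (∑' j, ⨆ _ : r j ≤ r i ∧ (R j ∩ R i).Nonempty, m j) ≤ M * ν (R i)) :
    ∃ A : ι → Set α, (∀ i, MeasurableSet (A i)) ∧ (∀ i, A i ⊆ R i) ∧
      (∀ i, ν (R i) ≤ 2 * ν (A i)) ∧
      ∀ x, ∑' i, (A i).indicator (fun _ => m i / ν (R i)) x ≤ 2 * M := by
  classical
  set S : ι → α → ℝ≥0∞ := fun i x =>
    ∑' j, if r j ≤ r i then (R j).indicator (fun _ => m j / ν (R j)) x else 0 with hS
  have hterm : ∀ i j, Measurable fun x =>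
      if r j ≤ r i then (R j).indicator (fun _ => m j / ν (R j)) x else 0 := by
    intro i j
    by_cases h : r j ≤ r i
    · simp only [h, if_true]
      exact measurable_const.indicator (hR j)
    · simp only [h, if_false]
      exact measurable_const
  have hSm : ∀ i, Measurable (S i) := fun i => Measurable.tsum (hterm i)
  have hSint : ∀ i, ∫⁻ x in R i, S i x ∂ν ≤ M * ν (R i) := by
    intro i
    refine le_trans ?_ (hpack i)
    rw [hS, lintegral_tsum fun j => (hterm i j).aemeasurable]
    refine ENNReal.tsum_le_tsum fun j => ?_
    by_cases h : r j ≤ r i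
    · simp only [h, if_true, true_and]
      rw [lintegral_indicator_const (hR j), Measure.restrict_apply (hR j)]
      by_cases hne : (R j ∩ R i).Nonempty
      · rw [iSup_pos hne]
        calc m j / ν (R j) * ν (R j ∩ R i) ≤ m j / ν (R j) * ν (R j) := by
              gcongr
              exact Set.inter_subset_left
          _ = m j := ENNReal.div_mul_cancel (hR0 j) (hRt j)
      · rw [Set.not_nonempty_iff_eq_empty.1 hne, measure_empty, mul_zero]
        exact zero_le
    · simp [h]
  refine ⟨fun i => R i ∩ {x | S i x < 2 * M}, fun i =>
    (hR i).inter (measurableSet_lt (hSm i) measurable_const), fun i => Set.inter_subset_left,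
    fun i => ?_, fun x => ?_⟩
  · have h1 : 2 * M * ν (R i \ {x | S i x < 2 * M}) ≤ M * ν (R i) := by
      refine le_trans ?_ (hSint i)
      have h2 := mul_meas_ge_le_lintegral (μ := ν.restrict (R i)) (hSm i) (2 * M)
      rw [Measure.restrict_apply (measurableSet_le measurable_const (hSm i))] at h2
      refine le_trans (le_of_eq ?_) h2
      congr 2
      ext x
      simp only [Set.mem_sdiff, Set.mem_ofPred_eq, not_lt, Set.mem_inter_iff]
      exact and_comm
    have h3 : 2 * ν (R i \ {x | S i x < 2 * M}) ≤ ν (R i) := by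
      exact (ENNReal.mul_le_mul_iff_right hM0 hMt).1 ((le_of_eq (by ring)).trans h1)
    have h4 := measure_inter_add_sdiff (μ := ν) (R i)
      (measurableSet_lt (hSm i) (measurable_const (a := 2 * M)))
    have h5 : ν (R i) + ν (R i) ≤ 2 * ν (R i ∩ {x | S i x < 2 * M}) + ν (R i) := by
      calc ν (R i) + ν (R i) = 2 * (ν (R i ∩ {x | S i x < 2 * M}) +
            ν (R i \ {x | S i x < 2 * M})) := by rw [h4, two_mul]
        _ ≤ 2 * ν (R i ∩ {x | S i x < 2 * M}) + ν (R i) := by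
            rw [mul_add]
            gcongr
    exact (ENNReal.add_le_add_iff_right (hRt i)).1 h5
  · rw [ENNReal.tsum_eq_iSup_sum]
    refine iSup_le fun F => ?_
    rw [← Finset.sum_filter_add_sum_filter_not F fun i => x ∈ R i ∩ {x | S i x < 2 * M}]
    have hz : ∑ i ∈ F with ¬(x ∈ R i ∩ {x | S i x < 2 * M}),
        (R i ∩ {x | S i x < 2 * M}).indicator (fun _ => m i / ν (R i)) x = 0 :=
      Finset.sum_eq_zero fun i hi => Set.indicator_of_notMem (Finset.mem_filter.1 hi).2 _
    rw [hz, add_zero]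
    rcases (F.filter fun i => x ∈ R i ∩ {x | S i x < 2 * M}).eq_empty_or_nonempty with h0 | h0
    · rw [h0, Finset.sum_empty]
      exact zero_le
    · obtain ⟨i₀, hi₀, hmax⟩ := Finset.exists_max_image _ r h0
      refine le_trans ?_ ((Finset.mem_filter.1 hi₀).2.2 : S i₀ x < 2 * M).le
      refine le_trans (Finset.sum_le_sum fun i hi => ?_) (ENNReal.sum_le_tsum _)
      rw [if_pos (hmax i hi), Set.indicator_of_mem (Finset.mem_filter.1 hi).2,
        Set.indicator_of_mem (Finset.mem_filter.1 hi).2.1]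

/-- The stopping cubes of the Calderón–Zygmund decomposition of `u` at level `τ`: the disjoint
cubes `dyad x (k x)`, `x ∈ I`, whose doubles cover the set where `u` is large, together with larger
strongly doubling cubes `dyad x (r x)`. -/
theorem GrowthData.exists_stopping_cubes [IsLocallyFiniteMeasure μ] (D : GrowthData n μ β G)
    {u : EuclideanSpace ℝ (Fin d) → ℝ} {τ : ℝ} (hu : Integrable u μ) (hτ : 0 < τ)
    (hlt : ENNReal.ofReal (∫ x, |u x| ∂μ) < ENNReal.ofReal τ * μ Set.univ) :
    ∃ (I : Set (EuclideanSpace ℝ (Fin d))) (k r : EuclideanSpace ℝ (Fin d) → ℤ),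
      I.Countable ∧ I ⊆ μ.support ∧ I.PairwiseDisjoint (fun x => dset x (k x)) ∧
      (∀ x ∈ I, τ * mass μ x (k x + 4) ≤ ∫ y in dset x (k x), |u y| ∂μ) ∧
      (∀ x ∈ I, IsPeak β μ x (k x + 2) (r x)) ∧
      (∀ x ∈ I, ∫ y in dset x (r x + 2), |u y| ∂μ ≤ β ^ 6 * τ * mass μ x (r x)) ∧
      ∀ᵐ x ∂μ, x ∉ ⋃ z : I, dset (z : EuclideanSpace ℝ (Fin d)) (k z + 1) →
        |u x| ≤ β ^ 4 * τ := by
  have hβ := D.β_pos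
  have hA : 0 ≤ ∫ x, |u x| ∂μ := integral_nonneg fun _ => abs_nonneg _
  have hlt' : ENNReal.ofReal ((∫ x, |u x| ∂μ) / τ) < μ Set.univ := by
    rw [ENNReal.ofReal_div_of_pos hτ]
    exact ENNReal.div_lt_of_lt_mul' hlt
  obtain ⟨ρ, hρ⟩ := exists_scale_bound (div_nonneg hA hτ.le) hlt'
  set P : EuclideanSpace ℝ (Fin d) → ℤ → Prop := fun x k =>
    τ * mass μ x (k + 4) < ∫ y in dset x k, |u y| ∂μ with hP
  have hscale : ∀ x k, P x k → 2 ^ k * 8 ≤ supDist 0 x + ρ := by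
    intro x k hk
    refine hρ x k ?_
    rw [le_div_iff₀ hτ, mul_comm]
    exact hk.le.trans (setIntegral_le_integral hu.abs (Eventually.of_forall fun _ => abs_nonneg _))
  set Y : Set (EuclideanSpace ℝ (Fin d)) := {x | x ∈ μ.support ∧ ∃ k, P x k} with hY
  have hmax : ∀ x ∈ Y, ∃ k, P x k ∧ ∀ i, k < i → ¬P x i := fun x hx =>
    exists_greatest_scale hx.2 fun k hk => hscale x k hk
  choose! k hk hkmax using hmax
  have hr : ∀ x ∈ Y, ∃ r, IsPeak β μ x (k x + 2) r := fun x hx => D.exists_isPeak hx.1 _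
  choose! r hr using hr
  obtain ⟨I, hIY, hIc, hdisj, hcov⟩ := exists_disjoint_covering Y k fun x hx =>
    hscale x _ (hk x hx)
  refine ⟨I, k, r, hIc, fun x hx => (hIY hx).1, hdisj, fun x hx => (hk x (hIY hx)).le,
    fun x hx => hr x (hIY hx), fun x hx => ?_, ?_⟩
  · -- `k x` is the greatest scale with a large mean, and `r x + 2 > k x`
    have h1 := hkmax x (hIY hx) (r x + 2) (by have := (hr x (hIY hx)).1; omega)
    rw [hP, not_lt] at h1
    refine h1.trans ?_
    have h2 := (hr x (hIY hx)).stronglyDoubling.mass_add_le 6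
    rw [mul_comm (β ^ 6), mul_assoc]
    refine mul_le_mul_of_nonneg_left ?_ hτ.le
    rw [add_assoc]
    exact h2
  · filter_upwards [D.ae_exists_stronglyDoubling,
      ae_tendsto_average_dset hu.abs.locallyIntegrable] with x hx hlim hxU
    by_contra hcon
    rw [not_le] at hcon
    obtain ⟨N, hN⟩ := (hlim.eventually (lt_mem_nhds hcon)).exists_forall_of_atTop
    obtain ⟨j, hj, hSD⟩ := hx.2 (-(N : ℤ))
    obtain ⟨p, rfl⟩ : ∃ p : ℕ, j = -(p : ℤ) := ⟨(-j).toNat, by omega⟩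
    have h1 := hN p (by omega)
    have hpos := mass_pos hx.1 (-(p : ℤ))
    have hPx : P x (-(p : ℤ)) := by
      have e : μ.real (dset x (-(p : ℤ))) = mass μ x (-(p : ℤ)) := rfl
      rw [setAverage_eq, smul_eq_mul, ← div_eq_inv_mul, e, lt_div_iff₀ hpos] at h1
      refine lt_of_le_of_lt ?_ h1
      have h2 := hSD.mass_add_le 4
      rw [mul_comm (β ^ 4), mul_assoc]
      exact mul_le_mul_of_nonneg_left h2 hτ.le
    obtain ⟨z, hz, -, hzx⟩ := hcov x ⟨hx.1, _, hPx⟩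
    refine hxU (Set.mem_iUnion.2 ⟨⟨z, hz⟩, ?_⟩)
    rw [mem_dset, two_zpow_add_one]
    linarith

theorem hasSum_setIntegral_abs {ι : Type*} [Countable ι] {u : EuclideanSpace ℝ (Fin d) → ℝ}
    (hu : Integrable u μ) {P : ι → Set (EuclideanSpace ℝ (Fin d))}
    (hP : ∀ i, MeasurableSet (P i)) (hd : Pairwise (Function.onFun Disjoint P)) :
    HasSum (fun i => ∫ x in P i, |u x| ∂μ) (∫ x in ⋃ i, P i, |u x| ∂μ) :=
  hasSum_integral_iUnion hP hd hu.abs.integrableOn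

theorem ofReal_setIntegral_abs {u : EuclideanSpace ℝ (Fin d) → ℝ} (hu : Integrable u μ)
    (P : Set (EuclideanSpace ℝ (Fin d))) :
    ENNReal.ofReal (∫ x in P, |u x| ∂μ) = ∫⁻ x in P, ‖u x‖ₑ ∂μ := by
  simp_rw [Real.enorm_eq_ofReal_abs]
  exact ofReal_integral_eq_lintegral_ofReal hu.abs.integrableOn
    (Eventually.of_forall fun _ => abs_nonneg _)

/-- The Calderón–Zygmund decomposition `u = b + (u - b)` of a bounded function at level `τ`, where
`b` is a sum of atomic blocks `b_i` and `u - b` is bounded by a multiple of `τ`. As `u` is bounded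
by `v`, its restrictions to the stopping cubes are multiples of atoms. -/
theorem GrowthData.exists_calderonZygmund [IsLocallyFiniteMeasure μ] (D : GrowthData n μ β G)
    {u : EuclideanSpace ℝ (Fin d) → ℝ} {τ v : ℝ} (hu : Integrable u μ) (hτ : 0 < τ) (hv : 0 ≤ v)
    (hb : ∀ᵐ x ∂μ, |u x| ≤ v)
    (hlt : ENNReal.ofReal (∫ x, |u x| ∂μ) < ENNReal.ofReal τ * μ Set.univ) :
    ∃ (b : EuclideanSpace ℝ (Fin d) → ℝ) (s : ℝ), HasAtomicBlockSum n μ b s ∧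
      s ≤ (v * KBound n β G / τ + 2 * β) * ∫ x, |u x| ∂μ ∧
      (∀ᵐ x ∂μ, |u x - b x| ≤ 5 * β ^ 6 * τ) ∧
      ∫ x, |u x - b x| ∂μ ≤ ∫ x, |u x| ∂μ := by
  have hβ := D.β_pos
  have hKB : 0 < KBound n β G := zero_lt_one.trans_le D.one_le_KBound
  obtain ⟨I, k, r, hIc, hIsupp, hdisj, hcore, hpeak, hlarge, hsmall⟩ :=
    D.exists_stopping_cubes hu hτ hlt
  have : Countable I := hIc.to_subtype
  obtain ⟨P, hPm, hPQ, hPd, hPU⟩ := exists_disjoint_measurable_refinement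
    (Q := fun x : I => dset (x : EuclideanSpace ℝ (Fin d)) (k x + 1))
    fun x => measurableSet_dset _ _
  set α : I → ℝ := fun i => ∫ x in P i, |u x| ∂μ with hα
  have hα0 : ∀ i, 0 ≤ α i := fun i => integral_nonneg fun _ => abs_nonneg _
  set R : I → Set (EuclideanSpace ℝ (Fin d)) := fun i =>
    dset (i : EuclideanSpace ℝ (Fin d)) (r i) with hR
  have hRpos : ∀ i : I, 0 < mass μ i (r i) := fun i => mass_pos (hIsupp i.2) _
  have hkr : ∀ i : I, k i + 2 ≤ r i := fun i => (hpeak i i.2).1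
  have hQR : ∀ i : I, dset (i : EuclideanSpace ℝ (Fin d)) (k i + 1) ⊆ R i := fun i =>
    dset_mono (by have := hkr i; omega)
  have hPR : ∀ i, P i ⊆ R i := fun i => (hPQ i).trans (hQR i)
  have hαe : ∀ i, ENNReal.ofReal (α i) = ∫⁻ x in P i, ‖u x‖ₑ ∂μ := fun i =>
    ofReal_setIntegral_abs hu _
  have hpack : ∀ i : I, (∑' j : I, ⨆ _ : r j ≤ r i ∧ (R j ∩ R i).Nonempty,
      ENNReal.ofReal (α j)) ≤ ENNReal.ofReal (β ^ 6 * τ) * μ (R i) := by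
    intro i
    set W := dset (i : EuclideanSpace ℝ (Fin d)) (r i + 2) with hW
    calc (∑' j : I, ⨆ _ : r j ≤ r i ∧ (R j ∩ R i).Nonempty, ENNReal.ofReal (α j))
        ≤ ∑' j : I, ∫⁻ x in P j ∩ W, ‖u x‖ₑ ∂μ := by
          refine ENNReal.tsum_le_tsum fun j => iSup_le fun ⟨hji, z, hzj, hzi⟩ => ?_
          -- a cube `R j` that is not larger than `R i` and meets it lies in `4 R i`
          have hsub : P j ⊆ W := by
            refine (hPR j).trans (dset_subset ?_)
            rw [hR, mem_dset] at hzj hzi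
            have h1 := supDist_triangle (i : EuclideanSpace ℝ (Fin d)) z j
            rw [supDist_comm z] at h1
            have h2 := two_zpow_le hji
            have h3 := two_zpow_pos (r i)
            rw [two_zpow_add_two]
            linarith
          rw [Set.inter_eq_self_of_subset_left hsub, hαe]
      _ = ∫⁻ x in ⋃ j, P j ∩ W, ‖u x‖ₑ ∂μ :=
          (lintegral_iUnion (fun j => (hPm j).inter (measurableSet_dset _ _))
            (fun a b hab => (hPd hab).mono Set.inter_subset_left Set.inter_subset_left) _).symm
      _ ≤ ∫⁻ x in W, ‖u x‖ₑ ∂μ :=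
          lintegral_mono_set (Set.iUnion_subset fun j => Set.inter_subset_right)
      _ = ENNReal.ofReal (∫ x in W, |u x| ∂μ) := (ofReal_setIntegral_abs hu _).symm
      _ ≤ ENNReal.ofReal (β ^ 6 * τ * mass μ i (r i)) := ENNReal.ofReal_le_ofReal (hlarge i i.2)
      _ = ENNReal.ofReal (β ^ 6 * τ) * μ (R i) := by
          rw [ENNReal.ofReal_mul (by positivity), ofReal_mass]
  obtain ⟨A, hAm, hAR, hAhalf, hAsum⟩ := exists_subset_tsum_le (ν := μ) (R := R)
    (fun i => measurableSet_dset _ _)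
    (fun i => by rw [hR, ← ofReal_mass]; exact (ENNReal.ofReal_pos.2 (hRpos i)).ne')
    (fun i => measure_dset_ne_top _ _) (fun i => r i) (fun i => ENNReal.ofReal (α i))
    (M := ENNReal.ofReal (β ^ 6 * τ)) (ENNReal.ofReal_pos.2 (by positivity)).ne'
    ENNReal.ofReal_ne_top hpack
  have hAt : ∀ i, μ (A i) ≠ ∞ := fun i =>
    ne_top_of_le_ne_top (measure_dset_ne_top _ _) (measure_mono (hAR i))
  have hAmass : ∀ i : I, mass μ i (r i) ≤ 2 * μ.real (A i) := by
    intro i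
    have h := ENNReal.toReal_mono (ENNReal.mul_ne_top (by simp) (hAt i)) (hAhalf i)
    rwa [ENNReal.toReal_mul] at h
  have hApos : ∀ i : I, 0 < μ.real (A i) := fun i => by linarith [hRpos i, hAmass i]
  -- The functions `φ i = c i 1_{A i}` have the integrals of `u` over the pieces `P i`; subtracting
  -- them makes the mean of each block vanish.
  set c : I → ℝ := fun i => (∫ x in P i, u x ∂μ) / μ.real (A i) with hc
  have hm : ∀ i, |∫ x in P i, u x ∂μ| ≤ α i := fun i => abs_integral_le_integral_abs
  have hcle : ∀ i : I, |c i| ≤ 2 * α i / mass μ i (r i) := by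
    intro i
    rw [hc, abs_div, abs_of_pos (hApos i), div_le_div_iff₀ (hApos i) (hRpos i)]
    nlinarith [hm i, hAmass i, hα0 i, hApos i, hRpos i, abs_nonneg (∫ x in P i, u x ∂μ)]
  set φ : I → EuclideanSpace ℝ (Fin d) → ℝ := fun i => (A i).indicator fun _ => c i with hφ
  have hφsum : ∀ x, ∑' i, ‖φ i x‖ₑ ≤ ENNReal.ofReal (4 * (β ^ 6 * τ)) := by
    intro x
    calc ∑' i, ‖φ i x‖ₑ ≤
          ∑' i, 2 * (A i).indicator (fun _ => ENNReal.ofReal (α i) / μ (R i)) x := by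
          refine ENNReal.tsum_le_tsum fun i => ?_
          by_cases hx : x ∈ A i
          · simp only [hφ, Set.indicator_of_mem hx]
            rw [hR, ← ofReal_mass, ← ENNReal.ofReal_div_of_pos (hRpos i),
              Real.enorm_eq_ofReal_abs, ← ENNReal.ofReal_ofNat, ← ENNReal.ofReal_mul two_pos.le]
            refine ENNReal.ofReal_le_ofReal ((hcle i).trans (le_of_eq (mul_div_assoc _ _ _)))
          · simp [hφ, Set.indicator_of_notMem hx]
      _ ≤ 2 * (2 * ENNReal.ofReal (β ^ 6 * τ)) := by
          rw [ENNReal.tsum_mul_left]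
          gcongr
          exact hAsum x
      _ = ENNReal.ofReal (4 * (β ^ 6 * τ)) := by
          rw [ENNReal.ofReal_mul (p := 4) (by norm_num), ← mul_assoc, ENNReal.ofReal_ofNat]
          norm_num
  have hφs : ∀ x, Summable fun i => φ i x := fun x => Summable.of_nnnorm
    (ENNReal.tsum_coe_ne_top_iff_summable.1 (ne_top_of_le_ne_top ENNReal.ofReal_ne_top (hφsum x)))
  have hφint : ∀ i, Integrable (φ i) μ := fun i =>
    (integrable_indicator_iff (hAm i)).2 (integrableOn_const (hAt i))
  set U := ⋃ i, P i with hU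
  have hPsum : ∀ x, HasSum (fun i => (P i).indicator u x) (U.indicator u x) := by
    intro x
    by_cases hx : x ∈ U
    · obtain ⟨i, hi⟩ := Set.mem_iUnion.1 hx
      rw [Set.indicator_of_mem hx, ← Set.indicator_of_mem hi u]
      refine hasSum_single i fun j hj => Set.indicator_of_notMem (fun hxj => ?_) _
      exact Set.disjoint_left.1 (hPd hj) hxj hi
    · rw [Set.indicator_of_notMem hx]
      convert hasSum_zero using 2 with i
      exact Set.indicator_of_notMem (fun h => hx (Set.mem_iUnion.2 ⟨i, h⟩)) _
  set cost : I → ℝ := fun i => v * (mass μ i (k i + 2) *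
    K n μ (dyad (i : EuclideanSpace ℝ (Fin d)) (k i + 1)) (dyad i (r i))) +
    2 * α i / mass μ i (r i) * (mass μ i (r i + 1)) with hcost
  have hblock : ∀ i : I, IsAtomicBlock n μ (fun x => (P i).indicator u x + -φ i x) (cost i) := by
    intro i
    have hadm := hIsupp i.2
    have hK1 : 0 < K n μ (dyad (i : EuclideanSpace ℝ (Fin d)) (k i + 1)) (dyad i (r i)) :=
      zero_lt_one.trans_le (one_le_K_dyad (by have := hkr i; omega))
    have hneg : Integrable (fun x => -φ i x) μ := (hφint i).neg
    refine isAtomicBlock_add (R := dyad (i : EuclideanSpace ℝ (Fin d)) (r i))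
      (Q₀ := dyad (i : EuclideanSpace ℝ (Fin d)) (k i + 1))
      (Q₁ := dyad (i : EuclideanSpace ℝ (Fin d)) (r i))
      (admissible_dyad hadm _) (admissible_dyad hadm _) (admissible_dyad hadm _) (hQR i) subset_rfl
      (hu.indicator (hPm i)) hneg (fun x hx => Set.indicator_of_notMem
        (fun h => hx (hPQ i h)) _) (fun x hx => ?_) hv
      (div_nonneg (mul_nonneg two_pos.le (hα0 i)) (hRpos i).le) ?_ ?_ ?_ ?_
      (mul_pos (mass_pos hadm _) hK1) (mass_pos hadm _) ?_
    · rw [neg_eq_zero]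
      exact Set.indicator_of_notMem (fun h => hx (hAR i h)) _
    · filter_upwards [hb] with x hx
      exact (abs_indicator_le _ _ _).trans hx
    · refine Eventually.of_forall fun x => ?_
      rw [abs_neg]
      exact (abs_indicator_le _ _ _).trans (hcle i)
    · rw [dilate_two_dyad, add_assoc]
      rfl
    · rw [dilate_two_dyad, K_dyad_self, mul_one]
      rfl
    · rw [integral_add (hu.indicator (hPm i)) hneg, integral_neg,
        integral_indicator (hPm i), integral_indicator_const _ (hAm i), hc, smul_eq_mul,
        mul_div_cancel₀ _ (hApos i).ne', add_neg_cancel]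
  have hQsum := hasSum_setIntegral_abs (μ := μ) hu
    (P := fun i : I => dset (i : EuclideanSpace ℝ (Fin d)) (k i))
    (fun i => measurableSet_dset _ _)
    (fun i j hij => hdisj i.2 j.2 fun h => hij (Subtype.ext h))
  have hαsum : HasSum α (∫ x in U, |u x| ∂μ) := hasSum_setIntegral_abs hu hPm hPd
  have hle : ∀ S : Set (EuclideanSpace ℝ (Fin d)), ∫ x in S, |u x| ∂μ ≤ ∫ x, |u x| ∂μ := fun S =>
    setIntegral_le_integral hu.abs (Eventually.of_forall fun _ => abs_nonneg _)
  have hcostle : ∀ i : I, cost i ≤ v * KBound n β G / τ *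
      ∫ x in dset (i : EuclideanSpace ℝ (Fin d)) (k i), |u x| ∂μ + 2 * β * α i := by
    intro i
    have hadm := hIsupp i.2
    have h1 : K n μ (dyad (i : EuclideanSpace ℝ (Fin d)) (k i + 1)) (dyad i (r i)) ≤
        KBound n β G := (hpeak i i.2).K_le D (by omega) (by omega) (by
          rw [supDist_self]; positivity)
    -- The doubled cube of the first atom has mass at most `1 / τ` times the integral of `|u|` over
    -- the disjoint core; thus these masses can be added up.
    have h2 : mass μ (i : EuclideanSpace ℝ (Fin d)) (k i + 2) ≤
        (∫ x in dset (i : EuclideanSpace ℝ (Fin d)) (k i), |u x| ∂μ) / τ := by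
      rw [le_div_iff₀ hτ, mul_comm]
      exact (mul_le_mul_of_nonneg_left (mass_mono (by omega)) hτ.le).trans (hcore i i.2)
    have h3 : mass μ (i : EuclideanSpace ℝ (Fin d)) (r i + 1) ≤ β * mass μ i (r i) := by
      simpa using (hpeak i i.2).stronglyDoubling.mass_add_le 1
    refine add_le_add ?_ ?_
    · calc v * (mass μ i (k i + 2) * _) ≤
            v * ((∫ x in dset (i : EuclideanSpace ℝ (Fin d)) (k i), |u x| ∂μ) / τ *
              KBound n β G) := by
            refine mul_le_mul_of_nonneg_left (mul_le_mul h2 h1 ?_ ?_) hv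
            · exact zero_le_one.trans (one_le_K_dyad (by have := hkr i; omega))
            · exact (mass_nonneg _ _).trans h2
        _ = _ := by ring
    · calc 2 * α i / mass μ i (r i) * mass μ i (r i + 1) ≤
            2 * α i / mass μ i (r i) * (β * mass μ i (r i)) :=
            mul_le_mul_of_nonneg_left h3
              (div_nonneg (mul_nonneg two_pos.le (hα0 i)) (hRpos i).le)
        _ = 2 * β * α i := by
            have := (hRpos i).ne'
            field_simp
  have hbound := (hQsum.mul_left (v * KBound n β G / τ)).add (hαsum.mul_left (2 * β))
  have hcs : Summable cost := hbound.summable.of_nonneg_of_le (fun i => (hblock i).nonneg) hcostle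
  set b : EuclideanSpace ℝ (Fin d) → ℝ := fun x => U.indicator u x + -∑' i, φ i x with hbdef
  have hbsum : HasAtomicBlockSum n μ b (∑' i, cost i) :=
    hasAtomicBlockSum_of_countable hblock hcs.hasSum
      (Eventually.of_forall fun x => (hPsum x).add (hφs x).hasSum.neg)
  have hdiff : ∀ x, u x - b x = Uᶜ.indicator u x + ∑' i, φ i x := by
    intro x
    rw [hbdef]
    by_cases hx : x ∈ U
    · simp [hx]
    · simp [hx]
  have hφabs : ∀ x, |∑' i, φ i x| ≤ 4 * (β ^ 6 * τ) := by
    intro x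
    have h := (enorm_tsum_le_tsum_enorm (f := fun i => φ i x)).trans (hφsum x)
    rw [Real.enorm_eq_ofReal_abs] at h
    exact (ENNReal.ofReal_le_ofReal_iff (by positivity)).1 h
  refine ⟨b, _, hbsum, ?_, ?_, ?_⟩
  · refine (hasSum_le hcostle hcs.hasSum hbound).trans ?_
    rw [add_mul]
    exact add_le_add (mul_le_mul_of_nonneg_left (hle _) (by positivity))
      (mul_le_mul_of_nonneg_left (hle _) (by positivity))
  · filter_upwards [hsmall] with x hx
    rw [hdiff]
    have h1 : |Uᶜ.indicator u x| ≤ β ^ 6 * τ := by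
      by_cases hxU : x ∈ U
      · rw [Set.indicator_of_notMem (Set.notMem_compl_iff.2 hxU), abs_zero]
        positivity
      · rw [Set.indicator_of_mem hxU]
        refine (hx fun h => hxU (by rw [hPU]; exact h)).trans ?_
        gcongr
        · exact D.one_lt.le
        · norm_num
    calc |Uᶜ.indicator u x + ∑' i, φ i x| ≤ |Uᶜ.indicator u x| + |∑' i, φ i x| := abs_add_le _ _
      _ ≤ 5 * β ^ 6 * τ := by linarith [hφabs x]
  · have hint : Integrable (fun x => u x - b x) μ := hu.sub hbsum.integrable_and.1
    have hUm : MeasurableSet U := MeasurableSet.iUnion hPm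
    have h1 : ∫⁻ x, ‖u x - b x‖ₑ ∂μ ≤ ∫⁻ x, ‖u x‖ₑ ∂μ := by
      calc ∫⁻ x, ‖u x - b x‖ₑ ∂μ
          ≤ ∫⁻ x, (Uᶜ.indicator (fun y => ‖u y‖ₑ) x + ∑' i, ‖φ i x‖ₑ) ∂μ := by
            refine lintegral_mono fun x => ?_
            rw [hdiff]
            refine (enorm_add_le _ _).trans (add_le_add ?_ enorm_tsum_le_tsum_enorm)
            rw [enorm_indicator_eq_indicator_enorm]
        _ = ∫⁻ x in Uᶜ, ‖u x‖ₑ ∂μ + ∑' i, ∫⁻ x, ‖φ i x‖ₑ ∂μ := by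
            rw [lintegral_add_left' (hu.1.enorm.indicator hUm.compl),
              lintegral_indicator hUm.compl, lintegral_tsum fun i => (hφint i).1.enorm]
        _ ≤ ∫⁻ x in Uᶜ, ‖u x‖ₑ ∂μ + ∑' i, ∫⁻ x in P i, ‖u x‖ₑ ∂μ := by
            refine add_le_add le_rfl (ENNReal.tsum_le_tsum fun i => ?_)
            rw [← hαe i]
            have h2 : ∀ x, ‖φ i x‖ₑ = (A i).indicator (fun _ => ‖c i‖ₑ) x := fun x =>
              enorm_indicator_eq_indicator_enorm _ _
            simp_rw [h2]
            rw [lintegral_indicator_const (hAm i), ← ENNReal.ofReal_toReal (hAt i),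
              Real.enorm_eq_ofReal_abs, ← ENNReal.ofReal_mul (abs_nonneg _)]
            refine ENNReal.ofReal_le_ofReal (le_trans (le_of_eq ?_) (hm i))
            have h3 : (μ (A i)).toReal = μ.real (A i) := rfl
            rw [h3, hc, abs_div, abs_of_pos (hApos i), div_mul_cancel₀ _ (hApos i).ne']
        _ = ∫⁻ x, ‖u x‖ₑ ∂μ := by
            rw [← lintegral_iUnion hPm hPd, add_comm, lintegral_add_compl _ hUm]
    have e1 := integral_norm_eq_lintegral_enorm hint.1
    have e2 := integral_norm_eq_lintegral_enorm hu.1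
    simp only [Real.norm_eq_abs] at e1 e2
    rw [e1, e2]
    exact ENNReal.toReal_mono hu.2.ne h1

/-- One step of the iterated decomposition: a function bounded by `l` is a sum of atomic blocks up
to a remainder bounded by `l / 4`. If the Calderón–Zygmund decomposition is not available, then `μ`
is finite and the whole space is the support of a single block. -/
theorem GrowthData.exists_step [IsLocallyFiniteMeasure μ] [NeZero μ] (D : GrowthData n μ β G) :
    ∃ C : ℝ, 0 < C ∧ ∀ (u : EuclideanSpace ℝ (Fin d) → ℝ) (l : ℝ), 0 < l → Integrable u μ →
      (∀ᵐ x ∂μ, |u x| ≤ l) → (μ Set.univ < ∞ → ∫ x, u x ∂μ = 0) →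
      ∃ (b : EuclideanSpace ℝ (Fin d) → ℝ) (s : ℝ), HasAtomicBlockSum n μ b s ∧
        s ≤ C * ∫ x, |u x| ∂μ ∧ ENNReal.ofReal s ≤ ENNReal.ofReal (C * l) * μ Set.univ ∧
        (∀ᵐ x ∂μ, |u x - b x| ≤ l / 4) ∧ ∫ x, |u x - b x| ∂μ ≤ ∫ x, |u x| ∂μ := by
  have hβ := D.one_lt
  have hβ0 := D.β_pos
  have hβ6 : 1 ≤ β ^ 6 := one_le_pow₀ hβ.le
  have hKB := D.one_le_KBound
  refine ⟨20 * β ^ 6 * KBound n β G + 2 * β, by positivity, fun u l hl hu hb h0 => ?_⟩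
  set C := 20 * β ^ 6 * KBound n β G + 2 * β with hC
  have hC20 : 20 * β ^ 6 ≤ C := by nlinarith
  have hC1 : 1 ≤ C := by linarith
  have hA : 0 ≤ ∫ x, |u x| ∂μ := integral_nonneg fun _ => abs_nonneg _
  -- this level makes the bound `5 β ^ 6 τ` for the remainder equal to `l / 4`
  set τ := l / (20 * β ^ 6) with hτ
  have hτ0 : 0 < τ := by positivity
  have hτl : τ ≤ l := div_le_self hl.le (by linarith)
  rcases lt_or_ge (ENNReal.ofReal (∫ x, |u x| ∂μ)) (ENNReal.ofReal τ * μ Set.univ) with hlt | hge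
  · obtain ⟨b, s, hbs, hs, hub, hubi⟩ := D.exists_calderonZygmund hu hτ0 hl.le hb hlt
    have hs' : s ≤ C * ∫ x, |u x| ∂μ := by
      refine hs.trans (le_of_eq ?_)
      rw [hC, hτ]
      field_simp
    refine ⟨b, s, hbs, hs', ?_, ?_, hubi⟩
    · calc ENNReal.ofReal s ≤ ENNReal.ofReal (C * ∫ x, |u x| ∂μ) := ENNReal.ofReal_le_ofReal hs'
        _ = ENNReal.ofReal C * ENNReal.ofReal (∫ x, |u x| ∂μ) :=
            ENNReal.ofReal_mul (zero_le_one.trans hC1)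
        _ ≤ ENNReal.ofReal C * (ENNReal.ofReal l * μ Set.univ) := by
            gcongr
            exact hlt.le.trans (by gcongr)
        _ = ENNReal.ofReal (C * l) * μ Set.univ := by
            rw [← mul_assoc, ENNReal.ofReal_mul (zero_le_one.trans hC1)]
    · filter_upwards [hub] with x hx
      refine hx.trans (le_of_eq ?_)
      rw [hτ]
      field_simp
      norm_num
  · have hfin : μ Set.univ < ∞ := by
      by_contra hcon
      rw [not_lt, top_le_iff] at hcon
      rw [hcon, ENNReal.mul_top (ENNReal.ofReal_pos.2 hτ0).ne', top_le_iff] at hge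
      exact ENNReal.ofReal_ne_top hge
    refine ⟨u, l * μ.real Set.univ, hasAtomicBlockSum_of_bounded hfin hu.1 hl.le hb (h0 hfin),
      ?_, ?_, ?_, ?_⟩
    · have h1 : τ * μ.real Set.univ ≤ ∫ x, |u x| ∂μ := by
        have h2 := ENNReal.toReal_mono ENNReal.ofReal_ne_top hge
        rwa [ENNReal.toReal_mul, ENNReal.toReal_ofReal hτ0.le, ENNReal.toReal_ofReal hA] at h2
      calc l * μ.real Set.univ = 20 * β ^ 6 * (τ * μ.real Set.univ) := by
            rw [hτ]
            field_simp
        _ ≤ C * ∫ x, |u x| ∂μ := by gcongr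
    · rw [ENNReal.ofReal_mul hl.le, measureReal_def, ENNReal.ofReal_toReal hfin.ne]
      gcongr
      exact le_mul_of_one_le_left hl.le hC1
    · refine Eventually.of_forall fun x => ?_
      rw [sub_self, abs_zero]
      positivity
    · simpa using hA

/-! ### Iterated decomposition of bounded functions -/

/-- The function `g` minus its mean. For an infinite measure this is `g` itself, since averages are
then zero by convention. -/
def centre (μ : Measure (EuclideanSpace ℝ (Fin d))) (g : EuclideanSpace ℝ (Fin d) → ℝ) :
    EuclideanSpace ℝ (Fin d) → ℝ :=
  fun x => g x - ⨍ y, g y ∂μ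

theorem average_eq_zero_of_infinite (h : ¬μ Set.univ < ∞) (g : EuclideanSpace ℝ (Fin d) → ℝ) :
    ⨍ y, g y ∂μ = 0 := by
  rw [not_lt, top_le_iff] at h
  rw [average_eq, measureReal_def, h]
  simp

theorem abs_average_le {g : EuclideanSpace ℝ (Fin d) → ℝ} {m : ℝ} (hm : 0 ≤ m)
    (hg : ∀ᵐ x ∂μ, |g x| ≤ m) : |⨍ y, g y ∂μ| ≤ m := by
  by_cases h : μ Set.univ < ∞
  · have : IsFiniteMeasure μ := ⟨h⟩
    rw [average_eq, smul_eq_mul, abs_mul, abs_of_nonneg (inv_nonneg.2 measureReal_nonneg)]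
    have h1 : |∫ x, g x ∂μ| ≤ m * μ.real Set.univ := by
      simpa only [Real.norm_eq_abs] using norm_integral_le_of_norm_le_const (f := g) hg
    rcases (measureReal_nonneg (μ := μ) (s := Set.univ)).eq_or_lt with h0 | h0
    · rw [← h0]
      simpa using hm
    · rw [inv_mul_le_iff₀ h0, mul_comm]
      exact h1
  · rw [average_eq_zero_of_infinite h, abs_zero]
    exact hm

theorem integrable_average (g : EuclideanSpace ℝ (Fin d) → ℝ) :
    Integrable (fun _ : EuclideanSpace ℝ (Fin d) => ⨍ y, g y ∂μ) μ := by
  by_cases h : μ Set.univ < ∞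
  · have : IsFiniteMeasure μ := ⟨h⟩
    exact integrable_const _
  · rw [average_eq_zero_of_infinite h]
    exact integrable_zero _ _ _

theorem integral_abs_average_le (g : EuclideanSpace ℝ (Fin d) → ℝ) :
    ∫ _, |⨍ y, g y ∂μ| ∂μ ≤ ∫ x, |g x| ∂μ := by
  have hA : 0 ≤ ∫ x, |g x| ∂μ := integral_nonneg fun _ => abs_nonneg _
  rw [integral_const, smul_eq_mul, average_eq, smul_eq_mul, abs_mul,
    abs_of_nonneg (inv_nonneg.2 measureReal_nonneg), ← mul_assoc]
  refine (mul_le_of_le_one_left (abs_nonneg _) (mul_inv_le_one)).trans ?_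
  exact abs_integral_le_integral_abs

theorem integrable_centre {g : EuclideanSpace ℝ (Fin d) → ℝ} (hg : Integrable g μ) :
    Integrable (centre μ g) μ :=
  hg.sub (integrable_average g)

theorem integral_centre {g : EuclideanSpace ℝ (Fin d) → ℝ} (hg : Integrable g μ)
    (h : μ Set.univ < ∞) : ∫ x, centre μ g x ∂μ = 0 := by
  have : IsFiniteMeasure μ := ⟨h⟩
  unfold centre
  rw [integral_sub hg (integrable_average g), integral_average, sub_self]

theorem abs_centre_le {g : EuclideanSpace ℝ (Fin d) → ℝ} {m : ℝ} (hm : 0 ≤ m)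
    (hg : ∀ᵐ x ∂μ, |g x| ≤ m) : ∀ᵐ x ∂μ, |centre μ g x| ≤ 2 * m := by
  filter_upwards [hg] with x hx
  refine (abs_sub _ _).trans ?_
  linarith [abs_average_le hm hg]

theorem integral_abs_centre_le {g : EuclideanSpace ℝ (Fin d) → ℝ} (hg : Integrable g μ) :
    ∫ x, |centre μ g x| ∂μ ≤ 2 * ∫ x, |g x| ∂μ := by
  have h1 : ∫ x, |centre μ g x| ∂μ ≤ ∫ x, (|g x| + |⨍ y, g y ∂μ|) ∂μ :=
    integral_mono (integrable_centre hg).abs (hg.abs.add (integrable_average g).abs)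
      fun x => abs_sub _ _
  rw [integral_add hg.abs (integrable_average g).abs] at h1
  linarith [integral_abs_average_le (μ := μ) g]

theorem centre_sub {f g : EuclideanSpace ℝ (Fin d) → ℝ} (hf : Integrable f μ)
    (hg : Integrable g μ) (x : EuclideanSpace ℝ (Fin d)) :
    centre μ (fun y => f y - g y) x = centre μ f x - centre μ g x := by
  simp only [centre, average_eq, smul_eq_mul]
  rw [integral_sub hf hg]
  ring

/-- The part of `f` where `|f| > t`. -/
def highPart (f : EuclideanSpace ℝ (Fin d) → ℝ) (t : ℝ) : EuclideanSpace ℝ (Fin d) → ℝ :=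
  {x | t < |f x|}.indicator f

theorem measurableSet_lt_abs {f : EuclideanSpace ℝ (Fin d) → ℝ} (hf : Measurable f) (t : ℝ) :
    MeasurableSet {x | t < |f x|} :=
  measurableSet_lt measurable_const hf.norm

theorem integrable_highPart {f : EuclideanSpace ℝ (Fin d) → ℝ} (hf : Measurable f)
    (hi : Integrable f μ) (t : ℝ) : Integrable (highPart f t) μ :=
  hi.indicator (measurableSet_lt_abs hf t)

theorem highPart_of_lt {f : EuclideanSpace ℝ (Fin d) → ℝ} {t : ℝ} {x : EuclideanSpace ℝ (Fin d)}
    (h : t < |f x|) : highPart f t x = f x :=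
  Set.indicator_of_mem (s := {x | t < |f x|}) h f

theorem highPart_of_le {f : EuclideanSpace ℝ (Fin d) → ℝ} {t : ℝ} {x : EuclideanSpace ℝ (Fin d)}
    (h : |f x| ≤ t) : highPart f t x = 0 :=
  Set.indicator_of_notMem (s := {x | t < |f x|}) (fun h' => absurd h (not_le.2 h')) f

theorem abs_highPart_le (f : EuclideanSpace ℝ (Fin d) → ℝ) (t : ℝ)
    (x : EuclideanSpace ℝ (Fin d)) : |highPart f t x| ≤ |f x| :=
  abs_indicator_le _ f x

theorem abs_sub_highPart_le (f : EuclideanSpace ℝ (Fin d) → ℝ) {t : ℝ} (ht : 0 ≤ t)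
    (x : EuclideanSpace ℝ (Fin d)) : |f x - highPart f t x| ≤ t := by
  rcases le_or_gt |f x| t with h | h
  · rwa [highPart_of_le h, sub_zero]
  · rwa [highPart_of_lt h, sub_self, abs_zero]

theorem abs_highPart_sub {f : EuclideanSpace ℝ (Fin d) → ℝ} {s t : ℝ} (hst : s ≤ t)
    (x : EuclideanSpace ℝ (Fin d)) :
    |highPart f s x - highPart f t x| = |highPart f s x| - |highPart f t x| := by
  rcases le_or_gt |f x| t with h | h
  · rw [highPart_of_le h, sub_zero, abs_zero, sub_zero]
  · rw [highPart_of_lt h, highPart_of_lt (hst.trans_lt h)]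
    simp

theorem abs_highPart_sub_le (f : EuclideanSpace ℝ (Fin d) → ℝ) {s t : ℝ} (hst : s ≤ t)
    (ht : 0 ≤ t) (x : EuclideanSpace ℝ (Fin d)) : |highPart f s x - highPart f t x| ≤ t := by
  rcases le_or_gt |f x| t with h | h
  · rw [highPart_of_le h, sub_zero]
    exact (abs_highPart_le f s x).trans h
  · rw [highPart_of_lt h, highPart_of_lt (hst.trans_lt h), sub_self, abs_zero]
    exact ht

/-- Recursive construction of a sequence along which an invariant holds. -/
theorem exists_seq_of_step {α δ : Type*} [Nonempty δ] {Inv : ℕ → α → Prop}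
    {Rel : ℕ → α → δ → α → Prop} {a : α}
    (h0 : Inv 0 a) (hstep : ∀ i x, Inv i x → ∃ y z, Rel i x y z ∧ Inv (i + 1) z) :
    ∃ (ρ : ℕ → α) (y : ℕ → δ), ρ 0 = a ∧ ∀ i, Inv i (ρ i) ∧ Rel i (ρ i) (y i) (ρ (i + 1)) := by
  have : Nonempty α := ⟨a⟩
  choose! y z hyz using hstep
  have hinv : ∀ i, Inv i (Nat.rec a (fun i x => z i x) i) := fun i => by
    induction i with
    | zero => exact h0
    | succ i ih => exact (hyz i _ ih).2
  exact ⟨fun i => Nat.rec a (fun i x => z i x) i, fun i => y i (Nat.rec a (fun i x => z i x) i),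
    rfl, fun i => ⟨hinv i, (hyz i _ (hinv i)).1⟩⟩

/-- `f` is decomposed at the levels `Λ / 2 ^ i` into sums of atomic blocks `b i` of cost at most
`s i`, up to remainders bounded by multiples of the levels. -/
structure IsDecomposition (n : ℕ) (μ : Measure (EuclideanSpace ℝ (Fin d)))
    (f : EuclideanSpace ℝ (Fin d) → ℝ) (Λ C : ℝ) (b : ℕ → EuclideanSpace ℝ (Fin d) → ℝ)
    (s : ℕ → ℝ) : Prop where
  sum : ∀ i, HasAtomicBlockSum n μ (b i) (s i)
  cost : ∀ i, s i ≤ C * ∫ x, |highPart f (Λ / 2 ^ (i + 1)) x| ∂μ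
  cost_univ : ∀ i, ENNReal.ofReal (s i) ≤ ENNReal.ofReal (C * (Λ / 2 ^ i)) * μ Set.univ
  bound : ∀ i, ∀ᵐ x ∂μ, |b i x| ≤ 5 * (Λ / 2 ^ i)
  remainder : ∀ i, ∀ᵐ x ∂μ, |f x - ∑ j ∈ Finset.range i, b j x| ≤ 4 * (Λ / 2 ^ i)
  integral_remainder : ∀ i,
    ∫ x, |f x - ∑ j ∈ Finset.range i, b j x| ∂μ ≤ 5 * ∫ x, |f x| ∂μ

/-- The iterated decomposition. The `i`-th step is applied to the sum of the previous remainder and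
of the part of `f` between the levels `Λ / 2 ^ (i + 1)` and `Λ / 2 ^ i`. -/
theorem GrowthData.exists_isDecomposition [IsLocallyFiniteMeasure μ] [NeZero μ]
    (D : GrowthData n μ β G) :
    ∃ C : ℝ, 0 < C ∧ ∀ (f : EuclideanSpace ℝ (Fin d) → ℝ) (Λ : ℝ), 0 < Λ → Measurable f →
      Integrable f μ → (∀ᵐ x ∂μ, |f x| ≤ Λ) → (μ Set.univ < ∞ → ∫ x, f x ∂μ = 0) →
      ∃ b s, IsDecomposition n μ f Λ C b s := by
  obtain ⟨C, hC, hstep⟩ := D.exists_step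
  refine ⟨4 * C, by positivity, fun f Λ hΛ hfm hf hfΛ hf0 => ?_⟩
  set L : ℕ → ℝ := fun i => Λ / 2 ^ i with hL
  have hLpos : ∀ i, 0 < L i := fun i => by positivity
  have hLsucc : ∀ i, L i = 2 * L (i + 1) := fun i => by
    simp only [hL, pow_succ]
    field_simp
  have hLle : ∀ i, L (i + 1) ≤ L i := fun i => by linarith [hLsucc i, hLpos (i + 1)]
  have hhi : ∀ i, Integrable (highPart f (L i)) μ := fun i => integrable_highPart hfm hf _
  -- `w i` is the part of `f` that has not yet been used before step `i`. For finite `μ` it is made to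
  -- have mean zero. The actual remainder differs from it by at most `2 L i`.
  set w : ℕ → EuclideanSpace ℝ (Fin d) → ℝ := fun i x => f x - centre μ (highPart f (L i)) x with hw
  have hwi : ∀ i, Integrable (w i) μ := fun i => hf.sub (integrable_centre (hhi i))
  have hw0 : ∀ i, μ Set.univ < ∞ → ∫ x, w i x ∂μ = 0 := fun i h => by
    rw [hw, integral_sub hf (integrable_centre (hhi i)), hf0 h, integral_centre (hhi i) h, sub_zero]
  have hwabs : ∀ i x, |w i x| ≤ 2 * L i := by
    intro i x
    have h1 : |⨍ y, highPart f (L i) y ∂μ| ≤ L i := by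
      by_cases h : μ Set.univ < ∞
      · have h2 : ⨍ y, highPart f (L i) y ∂μ = -⨍ y, (f y - highPart f (L i) y) ∂μ := by
          simp only [average_eq, smul_eq_mul]
          rw [integral_sub hf (hhi i), hf0 h]
          ring
        rw [h2, abs_neg]
        exact abs_average_le (hLpos i).le
          (Eventually.of_forall fun x => abs_sub_highPart_le f (hLpos i).le x)
      · rw [average_eq_zero_of_infinite h, abs_zero]
        exact (hLpos i).le
    have h3 : w i x = (f x - highPart f (L i) x) + ⨍ y, highPart f (L i) y ∂μ := by
      simp only [hw, centre]
      ring
    rw [h3]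
    refine (abs_add_le _ _).trans ?_
    linarith [abs_sub_highPart_le f (hLpos i).le x]
  have hint_hi : ∀ i, ∫ x, |highPart f (L i) x| ∂μ ≤ ∫ x, |f x| ∂μ := fun i =>
    integral_mono (hhi i).abs hf.abs fun x => abs_highPart_le f _ x
  have hwint : ∀ i, ∫ x, |w i x| ∂μ ≤ 3 * ∫ x, |f x| ∂μ := by
    intro i
    have h1 : ∫ x, |w i x| ∂μ ≤ ∫ x, (|f x| + |centre μ (highPart f (L i)) x|) ∂μ :=
      integral_mono (hwi i).abs (hf.abs.add (integrable_centre (hhi i)).abs) fun x => abs_sub _ _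
    rw [integral_add hf.abs (integrable_centre (hhi i)).abs] at h1
    linarith [integral_abs_centre_le (hhi i), hint_hi i]
  set g : ℕ → EuclideanSpace ℝ (Fin d) → ℝ := fun i x =>
    highPart f (L (i + 1)) x - highPart f (L i) x with hg
  have hgi : ∀ i, Integrable (g i) μ := fun i => (hhi _).sub (hhi _)
  have hwg : ∀ i x, w i x - w (i + 1) x = centre μ (g i) x := by
    intro i x
    rw [hg, centre_sub (hhi _) (hhi _), hw]
    ring
  have hgabs : ∀ i, ∀ᵐ x ∂μ, |centre μ (g i) x| ≤ 2 * L i := fun i =>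
    abs_centre_le (hLpos i).le
      (Eventually.of_forall fun x => abs_highPart_sub_le f (hLle i) (hLpos i).le x)
  have hgint : ∀ i, ∫ x, |centre μ (g i) x| ∂μ ≤
      2 * (∫ x, |highPart f (L (i + 1)) x| ∂μ - ∫ x, |highPart f (L i) x| ∂μ) := by
    intro i
    refine (integral_abs_centre_le (hgi i)).trans (le_of_eq ?_)
    rw [← integral_sub (hhi _).abs (hhi _).abs]
    congr 1
    exact integral_congr_ae (Eventually.of_forall fun x => abs_highPart_sub (hLle i) x)
  set Inv : ℕ → (EuclideanSpace ℝ (Fin d) → ℝ) → Prop := fun i ρ =>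
    Integrable ρ μ ∧ (μ Set.univ < ∞ → ∫ x, ρ x ∂μ = 0) ∧ (∀ᵐ x ∂μ, |ρ x - w i x| ≤ 2 * L i) ∧
      ∫ x, |ρ x - w i x| ∂μ ≤ 2 * ∫ x, |highPart f (L i) x| ∂μ with hInv
  have hInv0 : Inv 0 f := by
    have hz : ∀ᵐ x ∂μ, highPart f (L 0) x = 0 := by
      filter_upwards [hfΛ] with x hx
      exact highPart_of_le (by simpa [hL] using hx)
    have hz' : ⨍ y, highPart f (L 0) y ∂μ = 0 := by
      rw [average_eq, integral_eq_zero_of_ae hz, smul_zero]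
    have hd : ∀ᵐ x ∂μ, |f x - w 0 x| = 0 := by
      filter_upwards [hz] with x hx
      simp [hw, centre, hx, hz']
    refine ⟨hf, hf0, ?_, ?_⟩
    · filter_upwards [hd] with x hx
      rw [hx]
      have := hLpos 0
      positivity
    · rw [integral_eq_zero_of_ae hd]
      exact mul_nonneg two_pos.le (integral_nonneg fun _ => abs_nonneg _)
  have hsucc : ∀ i ρ, Inv i ρ → ∃ (y : (EuclideanSpace ℝ (Fin d) → ℝ) × ℝ) (ρ' : _),
      (HasAtomicBlockSum n μ y.1 y.2 ∧
      y.2 ≤ 4 * C * (∫ x, |highPart f (L (i + 1)) x| ∂μ) ∧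
      ENNReal.ofReal y.2 ≤ ENNReal.ofReal (4 * C * L i) * μ Set.univ ∧
      (∀ᵐ x ∂μ, |y.1 x| ≤ 5 * L i) ∧ ρ' = fun x => ρ x - y.1 x) ∧ Inv (i + 1) ρ' := by
    rintro i ρ ⟨hρi, hρ0, hρabs, hρint⟩
    -- The error `ρ - w i` of the previous step and the new part `centre μ (g i)` of `f` are each bounded
    -- by `2 L i`; one step reduces the bound `4 L i` of the sum to `L i = 2 L (i + 1)`.
    set u : EuclideanSpace ℝ (Fin d) → ℝ := fun x => ρ x - w (i + 1) x with hu
    have hui : Integrable u μ := hρi.sub (hwi _)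
    have hu0 : ∀ x, u x = (ρ x - w i x) + centre μ (g i) x := by
      intro x
      rw [← hwg, hu]
      ring
    have huabs : ∀ᵐ x ∂μ, |u x| ≤ 4 * L i := by
      filter_upwards [hρabs, hgabs i] with x h1 h2
      rw [hu0]
      exact (abs_add_le _ _).trans (by linarith)
    have huint : ∫ x, |u x| ∂μ ≤ 2 * ∫ x, |highPart f (L (i + 1)) x| ∂μ := by
      have h1 : ∫ x, |u x| ∂μ ≤ ∫ x, (|ρ x - w i x| + |centre μ (g i) x|) ∂μ :=
        integral_mono hui.abs ((hρi.sub (hwi i)).abs.add (integrable_centre (hgi i)).abs)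
          fun x => by
            simp only [hu0]
            exact abs_add_le _ _
      have h2 : Integrable (fun x => |ρ x - w i x|) μ := (hρi.sub (hwi i)).abs
      rw [integral_add h2 (integrable_centre (hgi i)).abs] at h1
      linarith [hgint i]
    obtain ⟨b, s, hb, hs, hs', hub, hubi⟩ := hstep u (4 * L i) (by linarith [hLpos i]) hui huabs
      fun h => by
        rw [hu, integral_sub hρi (hwi _), hρ0 h, hw0 _ h, sub_zero]
    have hbi := hb.integrable_and
    have hsub : ∀ x, ρ x - b x - w (i + 1) x = u x - b x := fun x => by
      rw [hu]
      ring
    refine ⟨(b, s), fun x => ρ x - b x, ⟨hb, ?_, ?_, ?_, rfl⟩, hρi.sub hbi.1, fun h => ?_, ?_, ?_⟩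
    · refine hs.trans ?_
      have h1 := mul_le_mul_of_nonneg_left huint hC.le
      have h2 : 0 ≤ C * ∫ x, |highPart f (L (i + 1)) x| ∂μ :=
        mul_nonneg hC.le (integral_nonneg fun _ => abs_nonneg _)
      change C * ∫ x, |u x| ∂μ ≤ _
      linarith
    · refine hs'.trans (le_of_eq ?_)
      congr 2
      ring
    · filter_upwards [huabs, hub] with x h1 h2
      have h3 := abs_sub (u x) (u x - b x)
      rw [sub_sub_cancel] at h3
      change |b x| ≤ _
      linarith
    · rw [integral_sub hρi hbi.1, hρ0 h, hbi.2.2, sub_zero]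
    · filter_upwards [hub] with x hx
      rw [hsub]
      linarith [hLsucc i]
    · simp_rw [hsub]
      exact hubi.trans huint
  obtain ⟨ρ, bs, hρ0, hρ⟩ := exists_seq_of_step (Inv := Inv) (a := f)
    (Rel := fun i ρ (y : (EuclideanSpace ℝ (Fin d) → ℝ) × ℝ) ρ' =>
      HasAtomicBlockSum n μ y.1 y.2 ∧
      y.2 ≤ 4 * C * (∫ x, |highPart f (L (i + 1)) x| ∂μ) ∧
      ENNReal.ofReal y.2 ≤ ENNReal.ofReal (4 * C * L i) * μ Set.univ ∧
      (∀ᵐ x ∂μ, |y.1 x| ≤ 5 * L i) ∧ ρ' = fun x => ρ x - y.1 x) hInv0 hsucc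
  have hρsum : ∀ i x, ρ i x = f x - ∑ j ∈ Finset.range i, (bs j).1 x := by
    intro i x
    induction i with
    | zero => simp [hρ0]
    | succ i ih =>
      have h1 : ρ (i + 1) x = ρ i x - (bs i).1 x := congrFun (hρ i).2.2.2.2.2 x
      rw [h1, Finset.sum_range_succ, ih]
      ring
  refine ⟨fun i => (bs i).1, fun i => (bs i).2, fun i => (hρ i).2.1, fun i => (hρ i).2.2.1,
    fun i => (hρ i).2.2.2.1, fun i => (hρ i).2.2.2.2.1, fun i => ?_, fun i => ?_⟩
  · filter_upwards [(hρ i).1.2.2.1] with x hx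
    rw [← hρsum]
    have h1 := abs_add_le (ρ i x - w i x) (w i x)
    rw [sub_add_cancel] at h1
    linarith [hwabs i x]
  · simp_rw [← hρsum]
    have h1 : ∫ x, |ρ i x| ∂μ ≤ ∫ x, (|ρ i x - w i x| + |w i x|) ∂μ :=
      integral_mono (hρ i).1.1.abs (((hρ i).1.1.sub (hwi i)).abs.add (hwi i).abs) fun x => by
        have h1 := abs_add_le (ρ i x - w i x) (w i x)
        rwa [sub_add_cancel] at h1
    have h2 : Integrable (fun x => |ρ i x - w i x|) μ := ((hρ i).1.1.sub (hwi i)).abs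
    rw [integral_add h2 (hwi i).abs] at h1
    linarith [(hρ i).1.2.2.2, hint_hi i, hwint i]

/-! ### Sums over dyadic levels -/

theorem two_rpow_neg_lt_one {q : ℝ} (hq : 0 < q) : (2 : ℝ) ^ (-q) < 1 :=
  Real.rpow_lt_one_of_one_lt_of_neg one_lt_two (neg_lt_zero.2 hq)

theorem half_rpow {y : ℝ} (hy : 0 ≤ y) (q : ℝ) : (y / 2) ^ q = y ^ q * 2 ^ (-q) := by
  rw [Real.div_rpow hy two_pos.le, Real.rpow_neg two_pos.le, div_eq_mul_inv]

theorem sum_range_le_of_telescoping {φ F : ℝ → ℝ} (h : ∀ y, 0 < y → φ y ≤ F y - F (y / 2))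
    {y : ℝ} (hy : 0 < y) (N : ℕ) :
    ∑ j ∈ Finset.range N, φ (y / 2 ^ j) ≤ F y - F (y / 2 ^ N) := by
  induction N with
  | zero => simp
  | succ N ih =>
    rw [Finset.sum_range_succ]
    have h1 := h (y / 2 ^ N) (by positivity)
    rw [div_div, ← pow_succ] at h1
    linarith

theorem sum_rpow_below_le {q : ℝ} (hq : 0 < q) {Λ t : ℝ} (hΛ : 0 < Λ) (ht : 0 ≤ t) (N : ℕ) :
    ∑ j ∈ Finset.range N, (if Λ / 2 ^ j < t then (Λ / 2 ^ j) ^ q else 0) ≤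
      t ^ q / (1 - 2 ^ (-q)) := by
  have hc : 0 < 1 - (2 : ℝ) ^ (-q) := sub_pos.2 (two_rpow_neg_lt_one hq)
  have key : ∀ y : ℝ, 0 < y → (if y < t then y ^ q else 0) ≤
      (min y t) ^ q / (1 - 2 ^ (-q)) - (min (y / 2) t) ^ q / (1 - 2 ^ (-q)) := by
    intro y hy
    split_ifs with h
    · rw [min_eq_left h.le, min_eq_left (by linarith), half_rpow hy.le, ← sub_div, le_div_iff₀ hc]
      exact le_of_eq (by ring)
    · rw [sub_nonneg]
      refine div_le_div_of_nonneg_right (Real.rpow_le_rpow (le_min (by linarith) ht) ?_ hq.le) hc.le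
      exact min_le_min (by linarith) le_rfl
  refine (sum_range_le_of_telescoping key hΛ N).trans ((sub_le_self _ ?_).trans ?_)
  · exact div_nonneg (Real.rpow_nonneg (le_min (by positivity) ht) _) hc.le
  · exact div_le_div_of_nonneg_right
      (Real.rpow_le_rpow (le_min hΛ.le ht) (min_le_right _ _) hq.le) hc.le

theorem sum_min_rpow_le {a c : ℝ} (ha : 0 < a) (hc : 0 < c) {y : ℝ} (hy : 0 < y) (N : ℕ) :
    ∑ j ∈ Finset.range N, min ((y / 2 ^ j) ^ (-a)) ((y / 2 ^ j) ^ c) ≤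
      1 / (1 - 2 ^ (-c)) + 2 ^ a / (2 ^ a - 1) := by
  have hc0 : 0 < 1 - (2 : ℝ) ^ (-c) := sub_pos.2 (two_rpow_neg_lt_one hc)
  have ha0 : 0 < (2 : ℝ) ^ a - 1 := sub_pos.2 (Real.one_lt_rpow one_lt_two ha)
  have hmono : ∀ y : ℝ, 0 < y → (min (y / 2) 1) ^ c ≤ (min y 1) ^ c := fun y hy =>
    Real.rpow_le_rpow (le_min (by linarith) zero_le_one) (min_le_min (by linarith) le_rfl) hc.le
  have hanti : ∀ y : ℝ, 0 < y → (max y (1 / 2)) ^ (-a) ≤ (max (y / 2) (1 / 2)) ^ (-a) :=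
    fun y hy => Real.rpow_le_rpow_of_nonpos (lt_max_of_lt_right (by norm_num))
      (max_le_max (by linarith) le_rfl) (neg_nonpos.2 ha.le)
  have key : ∀ y : ℝ, 0 < y → min (y ^ (-a)) (y ^ c) ≤
      ((min y 1) ^ c / (1 - 2 ^ (-c)) - (max y (1 / 2)) ^ (-a) / (2 ^ a - 1)) -
      ((min (y / 2) 1) ^ c / (1 - 2 ^ (-c)) - (max (y / 2) (1 / 2)) ^ (-a) / (2 ^ a - 1)) := by
    intro y hy
    have e1 := div_le_div_of_nonneg_right (hmono y hy) hc0.le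
    have e2 := div_le_div_of_nonneg_right (hanti y hy) ha0.le
    rcases le_total y 1 with h | h
    · have e3 : (min y 1) ^ c / (1 - 2 ^ (-c)) - (min (y / 2) 1) ^ c / (1 - 2 ^ (-c)) = y ^ c := by
        rw [min_eq_left h, min_eq_left (by linarith), half_rpow hy.le, ← sub_div,
          div_eq_iff hc0.ne']
        ring
      linarith [min_le_right (y ^ (-a)) (y ^ c)]
    · have e3 : (max (y / 2) (1 / 2)) ^ (-a) / (2 ^ a - 1) -
          (max y (1 / 2)) ^ (-a) / (2 ^ a - 1) = y ^ (-a) := by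
        rw [max_eq_left (by linarith), max_eq_left (by linarith), half_rpow hy.le, ← sub_div,
          div_eq_iff ha0.ne', neg_neg]
        ring
      linarith [min_le_left (y ^ (-a)) (y ^ c)]
  refine (sum_range_le_of_telescoping key hy N).trans ?_
  have b1 : (min y 1) ^ c / (1 - 2 ^ (-c)) ≤ 1 / (1 - 2 ^ (-c)) :=
    div_le_div_of_nonneg_right (Real.rpow_le_one (le_min hy.le zero_le_one) (min_le_right _ _)
      hc.le) hc0.le
  have b2 : 0 ≤ (max y (1 / 2)) ^ (-a) / (2 ^ a - 1) :=
    div_nonneg (Real.rpow_nonneg (le_max_of_le_left hy.le) _) ha0.le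
  have hyN : 0 < y / 2 ^ N := by positivity
  have b3 : 0 ≤ (min (y / 2 ^ N) 1) ^ c / (1 - 2 ^ (-c)) :=
    div_nonneg (Real.rpow_nonneg (le_min hyN.le zero_le_one) _) hc0.le
  have b4 : (max (y / 2 ^ N) (1 / 2)) ^ (-a) / (2 ^ a - 1) ≤ 2 ^ a / (2 ^ a - 1) := by
    refine div_le_div_of_nonneg_right ((Real.rpow_le_rpow_of_nonpos (by norm_num)
      (le_max_right _ _) (neg_nonpos.2 ha.le)).trans (le_of_eq ?_)) ha0.le
    rw [one_div, Real.inv_rpow two_pos.le, Real.rpow_neg two_pos.le, inv_inv]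
  linarith

/-- A single weighted term `L ^ (p - r) a ^ r ≤ s ^ p` bounds `a` by a power of `L / s`. This power is
negative for `r < p` and positive for `r > p`, so that the two bounds are summable over the levels
`L` above and below `s` respectively. -/
theorem le_mul_div_rpow {a L s p r : ℝ} (ha : 0 ≤ a) (hL : 0 < L) (hs : 0 < s) (hr : 0 < r)
    (h : L ^ (p - r) * a ^ r ≤ s ^ p) : a ≤ s * (L / s) ^ (1 - p / r) := by
  have h1 : (a / L) ^ r ≤ (s / L) ^ p := by
    rw [Real.div_rpow ha hL.le, Real.div_rpow hs.le hL.le, div_le_div_iff₀ (by positivity)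
      (by positivity)]
    rw [Real.rpow_sub hL, div_mul_eq_mul_div, div_le_iff₀ (by positivity)] at h
    linarith
  have h2 : a / L ≤ (s / L) ^ (p / r) := by
    have h3 := Real.rpow_le_rpow (by positivity) h1 (inv_nonneg.2 hr.le)
    rwa [Real.rpow_rpow_inv (by positivity) hr.ne', ← Real.rpow_mul (by positivity),
      ← div_eq_mul_inv] at h3
  rw [div_le_iff₀ hL] at h2
  refine h2.trans (le_of_eq ?_)
  rw [Real.rpow_sub (by positivity), Real.rpow_one, ← inv_div L s, Real.inv_rpow (by positivity)]
  field_simp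

/-- The pointwise substitute for real interpolation: an `ℓ^p` estimate of a sum over dyadic levels
follows from weighted `ℓ^{r₁}` and `ℓ^{r₂}` estimates with `r₁ < p < r₂`. -/
theorem exists_rpow_sum_le {r₁ p r₂ : ℝ} (hr : 0 < r₁) (h₁ : r₁ < p) (h₂ : p < r₂) :
    ∃ C : ℝ, 0 < C ∧ ∀ (Λ : ℝ) (a : ℕ → ℝ) (N : ℕ), 0 < Λ → (∀ j, 0 ≤ a j) →
      (∑ j ∈ Finset.range N, a j) ^ p ≤ C * ∑ j ∈ Finset.range N,
        ((Λ / 2 ^ j) ^ (p - r₁) * a j ^ r₁ + (Λ / 2 ^ j) ^ (p - r₂) * a j ^ r₂) := by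
  have hp : 0 < p := hr.trans h₁
  have hr₂ : 0 < r₂ := hp.trans h₂
  have hα : 0 < p / r₁ - 1 := sub_pos.2 ((one_lt_div hr).2 h₁)
  have hγ : 0 < 1 - p / r₂ := sub_pos.2 ((div_lt_one hr₂).2 h₂)
  set M : ℝ := 1 / (1 - 2 ^ (-(1 - p / r₂))) + 2 ^ (p / r₁ - 1) / (2 ^ (p / r₁ - 1) - 1) with hM
  have hM0 : 0 < M := by
    have h3 : 0 < 1 - (2 : ℝ) ^ (-(1 - p / r₂)) := sub_pos.2 (two_rpow_neg_lt_one hγ)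
    have h4 : 0 < (2 : ℝ) ^ (p / r₁ - 1) - 1 := sub_pos.2 (Real.one_lt_rpow one_lt_two hα)
    positivity
  refine ⟨M ^ p, by positivity, fun Λ a N hΛ ha => ?_⟩
  set e : ℕ → ℝ := fun j =>
    (Λ / 2 ^ j) ^ (p - r₁) * a j ^ r₁ + (Λ / 2 ^ j) ^ (p - r₂) * a j ^ r₂ with he
  have hL : ∀ j : ℕ, 0 < Λ / 2 ^ j := fun j => by positivity
  have he1 : ∀ j, 0 ≤ (Λ / 2 ^ j) ^ (p - r₁) * a j ^ r₁ := fun j =>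
    mul_nonneg (Real.rpow_nonneg (hL j).le _) (Real.rpow_nonneg (ha j) _)
  have he2 : ∀ j, 0 ≤ (Λ / 2 ^ j) ^ (p - r₂) * a j ^ r₂ := fun j =>
    mul_nonneg (Real.rpow_nonneg (hL j).le _) (Real.rpow_nonneg (ha j) _)
  have he0 : ∀ j, 0 ≤ e j := fun j => add_nonneg (he1 j) (he2 j)
  set B := ∑ j ∈ Finset.range N, e j with hB
  have hB0 : 0 ≤ B := Finset.sum_nonneg fun j _ => he0 j
  have hle : ∀ j ∈ Finset.range N, e j ≤ B := fun j hj =>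
    Finset.single_le_sum (fun i _ => he0 i) hj
  rcases hB0.eq_or_lt with h0 | h0
  · have hz : ∀ j ∈ Finset.range N, a j = 0 := by
      intro j hj
      have h3 := hle j hj
      rw [← h0] at h3
      have h4 : (Λ / 2 ^ j) ^ (p - r₁) * a j ^ r₁ = 0 := by
        have h5 := he1 j
        have h6 := he2 j
        simp only [he] at h3
        linarith
      rcases mul_eq_zero.1 h4 with h5 | h5
      · exact absurd h5 (Real.rpow_pos_of_pos (hL j) _).ne'
      · exact (Real.rpow_eq_zero (ha j) hr.ne').1 h5
    rw [Finset.sum_eq_zero hz, Real.zero_rpow hp.ne', ← h0, mul_zero]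
  · set s := B ^ p⁻¹ with hs
    have hs0 : 0 < s := Real.rpow_pos_of_pos h0 _
    have hsp : s ^ p = B := Real.rpow_inv_rpow hB0 hp.ne'
    have h3 : ∀ j ∈ Finset.range N, a j ≤ s * min ((Λ / s / 2 ^ j) ^ (-(p / r₁ - 1)))
        ((Λ / s / 2 ^ j) ^ (1 - p / r₂)) := by
      intro j hj
      have h4 := hle j hj
      rw [← hsp] at h4
      simp only [he] at h4
      rw [mul_min_of_nonneg _ _ hs0.le, neg_sub, div_right_comm]
      exact le_min (le_mul_div_rpow (ha j) (hL j) hs0 hr (by linarith [he2 j]))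
        (le_mul_div_rpow (ha j) (hL j) hs0 hr₂ (by linarith [he1 j]))
    have h4 : ∑ j ∈ Finset.range N, a j ≤ s * M := by
      refine (Finset.sum_le_sum h3).trans ?_
      rw [← Finset.mul_sum]
      exact mul_le_mul_of_nonneg_left (sum_min_rpow_le hα hγ (div_pos hΛ hs0) N) hs0.le
    refine (Real.rpow_le_rpow (Finset.sum_nonneg fun j _ => ha j) h4 hp.le).trans (le_of_eq ?_)
    rw [Real.mul_rpow hs0.le hM0.le, hsp, mul_comm]

/-! ### The a priori estimate -/

/-- The two endpoint estimates for an operator on `H^{1,∞}_{atb}(μ)`, with common constant `C`. -/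
structure EndpointBounds (n : ℕ) (β : ℝ) (μ : Measure (EuclideanSpace ℝ (Fin d)))
    (T : H1atb n μ →ₗ[ℝ] Lp ℝ 1 μ) (C : ℝ) : Prop where
  pos : 0 < C
  norm_le : ∀ (f : H1atb n μ) (s : ℝ),
    HasAtomicBlockSum n μ (f : EuclideanSpace ℝ (Fin d) →ₘ[μ] ℝ) s → ‖T f‖ ≤ C * s
  rbmoBound : ∀ (f : H1atb n μ) (l : ℝ), 0 < l →
    (∀ᵐ x ∂μ, |(f : EuclideanSpace ℝ (Fin d) →ₘ[μ] ℝ) x| ≤ l) → RBMOBound n β μ (T f) (C * l)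

theorem RBMOBound.mono {h : EuclideanSpace ℝ (Fin d) → ℝ} {σ σ' : ℝ} (hh : RBMOBound n β μ h σ)
    (hσ : σ ≤ σ') : RBMOBound n β μ h σ' where
  nonneg := hh.nonneg.trans hσ
  locallyIntegrable := hh.locallyIntegrable
  oscillation Q hQ := ⟨(hh.oscillation Q hQ).1, (hh.oscillation Q hQ).2.trans
    (mul_le_mul_of_nonneg_right hσ measureReal_nonneg)⟩
  regularity Q R hQ hR hQd hRd hQR := (hh.regularity Q R hQ hR hQd hRd hQR).trans
    (mul_le_mul_of_nonneg_right hσ (zero_le_one.trans (one_le_K hQ R)))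

theorem integral_abs_eq_norm (F : Lp ℝ 1 μ) : ∫ x, |F x| ∂μ = ‖F‖ := by
  rw [L1.norm_eq_integral_norm]
  rfl

/-- The image of a function bounded by a multiple of `l` with block decompositions of cost `s` lies
in every `L^r`: it has norm at most a multiple of `s` in `L¹` and of `l` in `RBMO`. -/
theorem EndpointBounds.exists_lintegral_rpow_le [IsLocallyFiniteMeasure μ] [NeZero μ]
    (D : GrowthData n μ β G) {T : H1atb n μ →ₗ[ℝ] Lp ℝ 1 μ} {C : ℝ}
    (hT : EndpointBounds n β μ T C) {r : ℝ} (hr : 1 ≤ r) {C₀ : ℝ} (hC₀ : 0 < C₀) :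
    ∃ C' : ℝ, 0 ≤ C' ∧ ∀ (f : H1atb n μ) (l s : ℝ), 0 < l →
      (∀ᵐ x ∂μ, |(f : EuclideanSpace ℝ (Fin d) →ₘ[μ] ℝ) x| ≤ C₀ * l) →
      HasAtomicBlockSum n μ (f : EuclideanSpace ℝ (Fin d) →ₘ[μ] ℝ) s →
      ENNReal.ofReal s ≤ ENNReal.ofReal (C₀ * l) * μ Set.univ →
      ∫⁻ x, ENNReal.ofReal (|T f x| ^ r) ∂μ ≤ ENNReal.ofReal (C' * (l ^ (r - 1) * s)) := by
  obtain ⟨C', hC', hJN⟩ := D.exists_lintegral_rpow_le hr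
  have hC := hT.pos
  refine ⟨C' * ((C * C₀) ^ (r - 1) * C), by positivity, fun f l s hl hfl hfs hs => ?_⟩
  have h := hJN (T f) (C * (C₀ * l)) (C * s) ⟨hT.rbmoBound f _ (by positivity) hfl, by positivity,
    L1.integrable_coeFn _, by rw [integral_abs_eq_norm]; exact hT.norm_le f s hfs, ?_⟩
  · refine h.trans (le_of_eq ?_)
    rw [← mul_assoc C C₀ l, Real.mul_rpow (by positivity) hl.le]
    congr 1
    ring
  · rw [ENNReal.ofReal_mul hC.le, ENNReal.ofReal_mul hC.le, mul_assoc]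
    gcongr

/-- A sum of atomic blocks as an element of the atomic block space. -/
def HasAtomicBlockSum.toH1atb [IsLocallyFiniteMeasure μ] {f : EuclideanSpace ℝ (Fin d) → ℝ} {s : ℝ}
    (h : HasAtomicBlockSum n μ f s) : H1atb n μ :=
  ⟨AEEqFun.mk f h.integrable_and.1.1, s, h.congr (AEEqFun.coeFn_mk f _).symm⟩

theorem HasAtomicBlockSum.coeFn_toH1atb [IsLocallyFiniteMeasure μ]
    {f : EuclideanSpace ℝ (Fin d) → ℝ} {s : ℝ} (h : HasAtomicBlockSum n μ f s) :
    ((h.toH1atb : EuclideanSpace ℝ (Fin d) →ₘ[μ] ℝ) : EuclideanSpace ℝ (Fin d) → ℝ) =ᵐ[μ] f :=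
  AEEqFun.coeFn_mk f _

theorem coeFn_finset_sum_h1atb {ι : Type*} (t : Finset ι) (b : ι → H1atb n μ) :
    (((∑ j ∈ t, b j : H1atb n μ) : EuclideanSpace ℝ (Fin d) →ₘ[μ] ℝ) :
      EuclideanSpace ℝ (Fin d) → ℝ) =ᵐ[μ]
      fun x => ∑ j ∈ t, (b j : EuclideanSpace ℝ (Fin d) →ₘ[μ] ℝ) x := by
  classical
  induction t using Finset.induction_on with
  | empty =>
    simp only [Finset.sum_empty]
    exact AEEqFun.coeFn_zero
  | insert a t ha ih =>
    rw [Finset.sum_insert ha]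
    filter_upwards [ih, AEEqFun.coeFn_add (b a : EuclideanSpace ℝ (Fin d) →ₘ[μ] ℝ)
      (∑ j ∈ t, b j : H1atb n μ)] with x h1 h2
    rw [Finset.sum_insert ha, ← h1]
    exact h2

theorem coeFn_finset_sum_lp {ι : Type*} {q : ℝ≥0∞} (t : Finset ι) (F : ι → Lp ℝ q μ) :
    ((∑ j ∈ t, F j : Lp ℝ q μ) : EuclideanSpace ℝ (Fin d) → ℝ) =ᵐ[μ]
      fun x => ∑ j ∈ t, F j x := by
  classical
  induction t using Finset.induction_on with
  | empty =>
    simp only [Finset.sum_empty]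
    exact Lp.coeFn_zero _ _ _
  | insert a t ha ih =>
    rw [Finset.sum_insert ha]
    filter_upwards [ih, Lp.coeFn_add (F a) (∑ j ∈ t, F j)] with x h1 h2
    rw [Finset.sum_insert ha, ← h1]
    exact h2

theorem integrable_rpow_of_bounded {f : EuclideanSpace ℝ (Fin d) → ℝ} {Λ p : ℝ} (hp : 1 < p)
    (hf : Integrable f μ) (hΛ : ∀ᵐ x ∂μ, |f x| ≤ Λ) : Integrable (fun x => |f x| ^ p) μ := by
  refine (hf.abs.const_mul (Λ ^ (p - 1))).mono'
    ((hf.1.norm.aemeasurable.pow_const p).aestronglyMeasurable) ?_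
  filter_upwards [hΛ] with x hx
  rw [Real.norm_eq_abs, abs_of_nonneg (Real.rpow_nonneg (abs_nonneg _) _)]
  calc |f x| ^ p = |f x| ^ (p - 1) * |f x| := by
        rcases (abs_nonneg (f x)).eq_or_lt with h | h
        · rw [← h, Real.zero_rpow (by linarith), mul_zero]
        · rw [← Real.rpow_add_one h.ne', sub_add_cancel]
    _ ≤ Λ ^ (p - 1) * |f x| := by
        gcongr

/-- The costs in the iterated decomposition of `f`, weighted by the levels, add up to at most the
`p`-th power of the norm of `f` in `L^p`. -/
theorem sum_rpow_mul_integral_highPart_le {f : EuclideanSpace ℝ (Fin d) → ℝ} {Λ p : ℝ}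
    (hp : 1 < p) (hΛ0 : 0 < Λ) (hfm : Measurable f) (hf : Integrable f μ)
    (hΛ : ∀ᵐ x ∂μ, |f x| ≤ Λ) (N : ℕ) :
    ∑ j ∈ Finset.range N, (Λ / 2 ^ j) ^ (p - 1) * ∫ x, |highPart f (Λ / 2 ^ (j + 1)) x| ∂μ ≤
      2 ^ (p - 1) / (1 - 2 ^ (-(p - 1))) * ∫ x, |f x| ^ p ∂μ := by
  have hi : ∀ j, Integrable (fun x => (Λ / 2 ^ j) ^ (p - 1) *
      |highPart f (Λ / 2 ^ (j + 1)) x|) μ := fun j => (integrable_highPart hfm hf _).abs.const_mul _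
  have e : ∀ j, (Λ / 2 ^ j) ^ (p - 1) * ∫ x, |highPart f (Λ / 2 ^ (j + 1)) x| ∂μ =
      ∫ x, (Λ / 2 ^ j) ^ (p - 1) * |highPart f (Λ / 2 ^ (j + 1)) x| ∂μ := fun j =>
    (integral_const_mul _ _).symm
  simp_rw [e]
  rw [← integral_finsetSum _ fun j _ => hi j, ← integral_const_mul]
  refine integral_mono (integrable_finsetSum _ fun j _ => hi j)
    ((integrable_rpow_of_bounded hp hf hΛ).const_mul _) fun x => ?_
  have h1 : ∀ j, (Λ / 2 ^ j) ^ (p - 1) * |highPart f (Λ / 2 ^ (j + 1)) x| =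
      (if Λ / 2 ^ j < 2 * |f x| then (Λ / 2 ^ j) ^ (p - 1) else 0) * |f x| := by
    intro j
    have h2 : Λ / 2 ^ j = 2 * (Λ / 2 ^ (j + 1)) := by
      rw [pow_succ]
      field_simp
    rcases le_or_gt |f x| (Λ / 2 ^ (j + 1)) with h | h
    · rw [highPart_of_le h, abs_zero, mul_zero, if_neg (by rw [h2]; linarith), zero_mul]
    · rw [highPart_of_lt h, if_pos (by rw [h2]; linarith)]
  simp only [h1]
  rw [← Finset.sum_mul]
  refine (mul_le_mul_of_nonneg_right (sum_rpow_below_le (by linarith : 0 < p - 1) hΛ0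
    (by positivity : 0 ≤ 2 * |f x|) N) (abs_nonneg _)).trans (le_of_eq ?_)
  rw [Real.mul_rpow two_pos.le (abs_nonneg _)]
  rcases (abs_nonneg (f x)).eq_or_lt with h | h
  · rw [← h, Real.zero_rpow (by linarith : p ≠ 0)]
    ring
  · have h2 : |f x| ^ p = |f x| ^ (p - 1) * |f x| := by
      rw [← Real.rpow_add_one h.ne', sub_add_cancel]
    rw [h2]
    ring

theorem measurable_ofReal_abs_rpow {q : ℝ≥0∞} (F : Lp ℝ q μ) (r : ℝ) :
    Measurable fun x => ENNReal.ofReal (|F x| ^ r) :=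
  ((Lp.stronglyMeasurable F).measurable.norm.pow_const r).ennreal_ofReal

theorem add_rpow_le {p a b : ℝ} (hp : 0 ≤ p) (ha : 0 ≤ a) (hb : 0 ≤ b) :
    (a + b) ^ p ≤ 2 ^ p * (a ^ p + b ^ p) := by
  have h1 : a + b ≤ 2 * max a b := by linarith [le_max_left a b, le_max_right a b]
  refine (Real.rpow_le_rpow (add_nonneg ha hb) h1 hp).trans ?_
  rw [Real.mul_rpow two_pos.le (le_max_of_le_left ha)]
  refine mul_le_mul_of_nonneg_left ?_ (by positivity)
  have h2 := Real.rpow_nonneg ha p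
  have h3 := Real.rpow_nonneg hb p
  rcases max_cases a b with ⟨h, -⟩ | ⟨h, -⟩ <;> rw [h] <;> linarith

theorem tendsto_div_two_pow_rpow_mul {q Λ : ℝ} (hq : 0 < q) (hΛ : 0 < Λ) (c M : ℝ) :
    Tendsto (fun N : ℕ => c * ((Λ / 2 ^ N) ^ q * (M * (N + 1)))) atTop (𝓝 0) := by
  have h0 : 0 ≤ (2 : ℝ) ^ (-q) := by positivity
  have h1 := two_rpow_neg_lt_one hq
  have h2 := (tendsto_self_mul_const_pow_of_lt_one h0 h1).add
    (tendsto_pow_atTop_nhds_zero_of_lt_one h0 h1)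
  have h3 := h2.const_mul (c * Λ ^ q * M)
  rw [add_zero, mul_zero] at h3
  refine h3.congr fun N => ?_
  have h4 : ((2 : ℝ) ^ (-q)) ^ N = ((2 : ℝ) ^ N) ^ (-q) := by
    rw [← Real.rpow_natCast, ← Real.rpow_mul two_pos.le, ← Real.rpow_natCast 2 N,
      ← Real.rpow_mul two_pos.le, mul_comm]
  rw [h4, Real.div_rpow hΛ.le (by positivity), Real.rpow_neg (by positivity)]
  field_simp

/-- The `L^p` estimate for bounded functions in the atomic block space. The images of the pieces
of the iterated decomposition are estimated in `L^r` for some `r < p` and for some `r > p` by the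
John–Nirenberg inequality, and these estimates are added up over the levels. -/
theorem EndpointBounds.exists_lintegral_rpow_le_integral [IsLocallyFiniteMeasure μ] [NeZero μ]
    (D : GrowthData n μ β G) {T : H1atb n μ →ₗ[ℝ] Lp ℝ 1 μ} {C : ℝ}
    (hT : EndpointBounds n β μ T C) {p : ℝ} (hp : 1 < p) :
    ∃ C' : ℝ, 0 ≤ C' ∧ ∀ (f : H1atb n μ) (Λ : ℝ),
      (∀ᵐ x ∂μ, |(f : EuclideanSpace ℝ (Fin d) →ₘ[μ] ℝ) x| ≤ Λ) →
      ∫⁻ x, ENNReal.ofReal (|T f x| ^ p) ∂μ ≤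
        ENNReal.ofReal (C' * ∫ x, |(f : EuclideanSpace ℝ (Fin d) →ₘ[μ] ℝ) x| ^ p ∂μ) := by
  obtain ⟨Cd, hCd, hdec⟩ := D.exists_isDecomposition
  have hC₀ : 0 < 5 + Cd := by positivity
  -- the exponents `(1 + p) / 2` and `2 p` lie on the two sides of `p`
  obtain ⟨C₁, hC₁, h₁⟩ := hT.exists_lintegral_rpow_le D (r := (1 + p) / 2) (by linarith) hC₀
  obtain ⟨C₂, hC₂, h₂⟩ := hT.exists_lintegral_rpow_le D (r := 2 * p) (by linarith) hC₀
  obtain ⟨C₃, hC₃, h₃⟩ := hT.exists_lintegral_rpow_le D hp.le hC₀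
  obtain ⟨Cs, hCs, hsum⟩ := exists_rpow_sum_le (r₁ := (1 + p) / 2) (p := p) (r₂ := 2 * p)
    (by linarith) (by linarith) (by linarith)
  have hKq : 0 ≤ (2 : ℝ) ^ (p - 1) / (1 - 2 ^ (-(p - 1))) :=
    div_nonneg (by positivity) (sub_pos.2 (two_rpow_neg_lt_one (by linarith))).le
  set Kq := (2 : ℝ) ^ (p - 1) / (1 - 2 ^ (-(p - 1))) with hKqdef
  refine ⟨2 ^ p * (Cs * ((C₁ + C₂) * (Cd * Kq))), by positivity, fun f Λ₀ hΛ₀ => ?_⟩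
  obtain ⟨sf, hsf⟩ := f.2
  set F : EuclideanSpace ℝ (Fin d) → ℝ := ⇑(f : EuclideanSpace ℝ (Fin d) →ₘ[μ] ℝ) with hF
  have hFm : Measurable F := (AEEqFun.stronglyMeasurable _).measurable
  obtain ⟨hFi, -, hF0⟩ := hsf.integrable_and
  set Λ := max Λ₀ 1 with hΛdef
  have hΛ : 0 < Λ := lt_max_of_lt_right one_pos
  have hFΛ : ∀ᵐ x ∂μ, |F x| ≤ Λ := by
    filter_upwards [hΛ₀] with x hx
    exact hx.trans (le_max_left _ _)
  obtain ⟨b, s, hbs⟩ := hdec F Λ hΛ hFm hFi hFΛ fun _ => hF0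
  have hI : 0 ≤ ∫ x, |F x| ∂μ := integral_nonneg fun _ => abs_nonneg _
  have hIp : 0 ≤ ∫ x, |F x| ^ p ∂μ := integral_nonneg fun _ => Real.rpow_nonneg (abs_nonneg _) _
  have hs0 : ∀ j, 0 ≤ s j := fun j => (hbs.sum j).nonneg
  have hL : ∀ j : ℕ, 0 < Λ / 2 ^ j := fun j => by positivity
  set B : ℕ → H1atb n μ := fun j => (hbs.sum j).toH1atb with hB
  have hBcoe : ∀ j, ((B j : EuclideanSpace ℝ (Fin d) →ₘ[μ] ℝ) :
      EuclideanSpace ℝ (Fin d) → ℝ) =ᵐ[μ] b j := fun j => (hbs.sum j).coeFn_toH1atb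
  have hBabs : ∀ j, ∀ᵐ x ∂μ, |(B j : EuclideanSpace ℝ (Fin d) →ₘ[μ] ℝ) x| ≤
      (5 + Cd) * (Λ / 2 ^ j) := by
    intro j
    filter_upwards [hBcoe j, hbs.bound j] with x h4 h5
    rw [h4]
    nlinarith [hL j]
  have hBs : ∀ j, HasAtomicBlockSum n μ (B j : EuclideanSpace ℝ (Fin d) →ₘ[μ] ℝ) (s j) := fun j =>
    (hbs.sum j).congr (hBcoe j).symm
  have hBcost : ∀ j, ENNReal.ofReal (s j) ≤ ENNReal.ofReal ((5 + Cd) * (Λ / 2 ^ j)) * μ Set.univ :=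
    fun j => (hbs.cost_univ j).trans (by
      gcongr
      linarith)
  -- The weights turn the estimates in `L^r` into the same bound `(Λ / 2 ^ j) ^ (p - 1) * s j` for every
  -- exponent `r`.
  have hpiece : ∀ (j : ℕ) (r C' : ℝ), 0 ≤ C' →
      (∫⁻ x, ENNReal.ofReal (|T (B j) x| ^ r) ∂μ ≤
        ENNReal.ofReal (C' * ((Λ / 2 ^ j) ^ (r - 1) * s j))) →
      ENNReal.ofReal ((Λ / 2 ^ j) ^ (p - r)) * ∫⁻ x, ENNReal.ofReal (|T (B j) x| ^ r) ∂μ ≤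
        ENNReal.ofReal (C' * ((Λ / 2 ^ j) ^ (p - 1) * s j)) := by
    intro j r C' hC' h
    refine (mul_le_mul_right h _).trans (le_of_eq ?_)
    rw [← ENNReal.ofReal_mul (Real.rpow_nonneg (hL j).le _)]
    congr 1
    have e : (Λ / 2 ^ j) ^ (p - 1) = (Λ / 2 ^ j) ^ (p - r) * (Λ / 2 ^ j) ^ (r - 1) := by
      rw [← Real.rpow_add (hL j)]
      congr 1
      ring
    rw [e]
    ring
  have hmain : ∀ N : ℕ, ∫⁻ x, ENNReal.ofReal ((∑ j ∈ Finset.range N, |T (B j) x|) ^ p) ∂μ ≤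
      ENNReal.ofReal (Cs * ((C₁ + C₂) * (Cd * Kq)) * ∫ x, |F x| ^ p ∂μ) := by
    intro N
    have hm : ∀ (j : ℕ) (r : ℝ), Measurable fun x => ENNReal.ofReal ((Λ / 2 ^ j) ^ (p - r)) *
        ENNReal.ofReal (|T (B j) x| ^ r) := fun j r =>
      (measurable_ofReal_abs_rpow (T (B j)) r).const_mul _
    have hm2 : ∀ j : ℕ, Measurable fun x => ENNReal.ofReal ((Λ / 2 ^ j) ^ (p - (1 + p) / 2)) *
        ENNReal.ofReal (|T (B j) x| ^ ((1 + p) / 2)) +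
        ENNReal.ofReal ((Λ / 2 ^ j) ^ (p - 2 * p)) * ENNReal.ofReal (|T (B j) x| ^ (2 * p)) :=
      fun j => (hm j _).add (hm j _)
    calc ∫⁻ x, ENNReal.ofReal ((∑ j ∈ Finset.range N, |T (B j) x|) ^ p) ∂μ
        ≤ ∫⁻ x, ENNReal.ofReal Cs * ∑ j ∈ Finset.range N,
            (ENNReal.ofReal ((Λ / 2 ^ j) ^ (p - (1 + p) / 2)) *
              ENNReal.ofReal (|T (B j) x| ^ ((1 + p) / 2)) +
            ENNReal.ofReal ((Λ / 2 ^ j) ^ (p - 2 * p)) *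
              ENNReal.ofReal (|T (B j) x| ^ (2 * p))) ∂μ := by
          refine lintegral_mono fun x => ?_
          refine (ENNReal.ofReal_le_ofReal (hsum Λ (fun j => |T (B j) x|) N hΛ
            fun j => abs_nonneg _)).trans (le_of_eq ?_)
          have e1 : ∀ (j : ℕ) (r : ℝ), 0 ≤ (Λ / 2 ^ j) ^ (p - r) * |T (B j) x| ^ r := fun j r =>
            mul_nonneg (Real.rpow_nonneg (hL j).le _) (Real.rpow_nonneg (abs_nonneg _) _)
          rw [ENNReal.ofReal_mul hCs.le,
            ENNReal.ofReal_sum_of_nonneg fun j _ => add_nonneg (e1 j _) (e1 j _)]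
          refine congrArg _ (Finset.sum_congr rfl fun j _ => ?_)
          rw [ENNReal.ofReal_add (e1 j _) (e1 j _),
            ENNReal.ofReal_mul (Real.rpow_nonneg (hL j).le _),
            ENNReal.ofReal_mul (Real.rpow_nonneg (hL j).le _)]
      _ = ENNReal.ofReal Cs * ∑ j ∈ Finset.range N,
            (ENNReal.ofReal ((Λ / 2 ^ j) ^ (p - (1 + p) / 2)) *
              ∫⁻ x, ENNReal.ofReal (|T (B j) x| ^ ((1 + p) / 2)) ∂μ +
            ENNReal.ofReal ((Λ / 2 ^ j) ^ (p - 2 * p)) *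
              ∫⁻ x, ENNReal.ofReal (|T (B j) x| ^ (2 * p)) ∂μ) := by
          rw [lintegral_const_mul _ (Finset.measurable_sum _ fun j _ => hm2 j),
            lintegral_finsetSum _ fun j _ => hm2 j]
          refine congrArg _ (Finset.sum_congr rfl fun j _ => ?_)
          rw [lintegral_add_left (hm j _), lintegral_const_mul _ (measurable_ofReal_abs_rpow _ _),
            lintegral_const_mul _ (measurable_ofReal_abs_rpow _ _)]
      _ ≤ ENNReal.ofReal Cs * ∑ j ∈ Finset.range N,
            ENNReal.ofReal ((C₁ + C₂) * ((Λ / 2 ^ j) ^ (p - 1) * s j)) := by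
          refine mul_le_mul_right (Finset.sum_le_sum fun j _ => ?_) _
          have e1 : 0 ≤ (Λ / 2 ^ j) ^ (p - 1) * s j :=
            mul_nonneg (Real.rpow_nonneg (hL j).le _) (hs0 j)
          rw [add_mul, ENNReal.ofReal_add (mul_nonneg hC₁ e1) (mul_nonneg hC₂ e1)]
          exact add_le_add
            (hpiece j _ C₁ hC₁ (h₁ (B j) _ _ (hL j) (hBabs j) (hBs j) (hBcost j)))
            (hpiece j _ C₂ hC₂ (h₂ (B j) _ _ (hL j) (hBabs j) (hBs j) (hBcost j)))
      _ = ENNReal.ofReal (Cs * ((C₁ + C₂) *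
            ∑ j ∈ Finset.range N, (Λ / 2 ^ j) ^ (p - 1) * s j)) := by
          rw [← ENNReal.ofReal_sum_of_nonneg fun j _ => mul_nonneg (by positivity)
            (mul_nonneg (Real.rpow_nonneg (hL j).le _) (hs0 j)), ← ENNReal.ofReal_mul hCs.le,
            ← Finset.mul_sum]
      _ ≤ _ := by
          refine ENNReal.ofReal_le_ofReal ?_
          rw [mul_assoc Cs, mul_assoc (C₁ + C₂), mul_assoc Cd]
          refine mul_le_mul_of_nonneg_left (mul_le_mul_of_nonneg_left ?_ (by positivity)) hCs.le
          refine le_trans ?_ (mul_le_mul_of_nonneg_left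
            (sum_rpow_mul_integral_highPart_le hp hΛ hFm hFi hFΛ N) hCd.le)
          rw [Finset.mul_sum]
          refine Finset.sum_le_sum fun j _ => ?_
          rw [mul_left_comm]
          exact mul_le_mul_of_nonneg_left (hbs.cost j) (Real.rpow_nonneg (hL j).le _)
  -- The images of the remainders are negligible: for infinite `μ` the cost of `rem N` grows at most
  -- linearly in `N`, and for finite `μ` the remainder is a single block supported in the whole space.
  set rem : ℕ → H1atb n μ := fun N => f - ∑ j ∈ Finset.range N, B j with hrem
  have hremcoe : ∀ N, ((rem N : EuclideanSpace ℝ (Fin d) →ₘ[μ] ℝ) :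
      EuclideanSpace ℝ (Fin d) → ℝ) =ᵐ[μ] fun x => F x - ∑ j ∈ Finset.range N, b j x := by
    intro N
    have hall : ∀ᵐ x ∂μ, ∀ j, (B j : EuclideanSpace ℝ (Fin d) →ₘ[μ] ℝ) x = b j x :=
      ae_all_iff.2 hBcoe
    filter_upwards [AEEqFun.coeFn_sub (f : EuclideanSpace ℝ (Fin d) →ₘ[μ] ℝ)
      (∑ j ∈ Finset.range N, B j : H1atb n μ), coeFn_finset_sum_h1atb (Finset.range N) B, hall]
      with x h4 h5 h6
    simp only [h6] at h5
    rw [← h5]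
    exact h4
  have hremabs : ∀ N, ∀ᵐ x ∂μ, |(rem N : EuclideanSpace ℝ (Fin d) →ₘ[μ] ℝ) x| ≤
      4 * (Λ / 2 ^ N) := by
    intro N
    filter_upwards [hremcoe N, hbs.remainder N] with x h4 h5
    rwa [h4]
  have hremcost : ∃ M : ℝ, 0 ≤ M ∧ ∀ N : ℕ, ∃ t,
      HasAtomicBlockSum n μ (rem N : EuclideanSpace ℝ (Fin d) →ₘ[μ] ℝ) t ∧
      t ≤ M * (N + 1) ∧ ENNReal.ofReal t ≤ ENNReal.ofReal ((5 + Cd) * (Λ / 2 ^ N)) * μ Set.univ := by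
    by_cases hfin : μ Set.univ < ∞
    · refine ⟨4 * Λ * μ.real Set.univ, by positivity, fun N => ⟨4 * (Λ / 2 ^ N) * μ.real Set.univ,
        hasAtomicBlockSum_of_bounded hfin (AEEqFun.aestronglyMeasurable _)
          (by positivity) (hremabs N) ?_, ?_, ?_⟩⟩
      · obtain ⟨t, ht⟩ := (rem N).2
        exact ht.integrable_and.2.2
      · have h4 : Λ / 2 ^ N ≤ Λ := div_le_self hΛ.le (one_le_pow₀ one_le_two)
        calc 4 * (Λ / 2 ^ N) * μ.real Set.univ ≤ 4 * Λ * μ.real Set.univ := by gcongr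
          _ ≤ 4 * Λ * μ.real Set.univ * (N + 1) :=
              le_mul_of_one_le_right (by positivity) (by linarith [N.cast_nonneg (α := ℝ)])
      · rw [ENNReal.ofReal_mul (by positivity), measureReal_def, ENNReal.ofReal_toReal hfin.ne]
        gcongr
        linarith
    · refine ⟨sf + Cd * ∫ x, |F x| ∂μ, add_nonneg hsf.nonneg (by positivity), fun N =>
        ⟨sf + ∑ j ∈ Finset.range N, s j, ?_, ?_, ?_⟩⟩
      · exact (hsf.sub (HasAtomicBlockSum.finset_sum _ fun j _ => hbs.sum j)).congr
          (hremcoe N).symm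
      · have h4 : ∀ j ∈ Finset.range N, s j ≤ Cd * ∫ x, |F x| ∂μ := fun j _ =>
          (hbs.cost j).trans (mul_le_mul_of_nonneg_left (integral_mono
            (integrable_highPart hFm hFi _).abs hFi.abs fun x => abs_highPart_le F _ x) hCd.le)
        have h5 := Finset.sum_le_sum h4
        rw [Finset.sum_const, Finset.card_range, nsmul_eq_mul] at h5
        have h6 : 0 ≤ sf * (N : ℝ) := mul_nonneg hsf.nonneg N.cast_nonneg
        have h7 : 0 ≤ Cd * ∫ x, |F x| ∂μ := by positivity
        linarith
      · rw [not_lt, top_le_iff] at hfin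
        rw [hfin, ENNReal.mul_top (ENNReal.ofReal_pos.2 (by positivity)).ne']
        exact le_top
  obtain ⟨M, hM, hMrem⟩ := hremcost
  have hremT : ∀ N : ℕ, ∫⁻ x, ENNReal.ofReal (|T (rem N) x| ^ p) ∂μ ≤
      ENNReal.ofReal (C₃ * ((Λ / 2 ^ N) ^ (p - 1) * (M * (N + 1)))) := by
    intro N
    obtain ⟨t, ht, htM, htu⟩ := hMrem N
    refine (h₃ (rem N) _ t (hL N) ?_ ht htu).trans (ENNReal.ofReal_le_ofReal ?_)
    · filter_upwards [hremabs N] with x hx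
      exact hx.trans (mul_le_mul_of_nonneg_right (by linarith) (hL N).le)
    · exact mul_le_mul_of_nonneg_left
        (mul_le_mul_of_nonneg_left htM (Real.rpow_nonneg (hL N).le _)) hC₃
  have hbound : ∀ N : ℕ, ∫⁻ x, ENNReal.ofReal (|T f x| ^ p) ∂μ ≤ ENNReal.ofReal (2 ^ p) *
      (ENNReal.ofReal (Cs * ((C₁ + C₂) * (Cd * Kq)) * ∫ x, |F x| ^ p ∂μ) +
        ENNReal.ofReal (C₃ * ((Λ / 2 ^ N) ^ (p - 1) * (M * (N + 1))))) := by
    intro N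
    have hTf : T f = (∑ j ∈ Finset.range N, T (B j)) + T (rem N) := by
      rw [hrem, map_sub, map_sum, add_sub_cancel]
    have hpt : ∀ᵐ x ∂μ, ENNReal.ofReal (|T f x| ^ p) ≤ ENNReal.ofReal (2 ^ p) *
        (ENNReal.ofReal ((∑ j ∈ Finset.range N, |T (B j) x|) ^ p) +
          ENNReal.ofReal (|T (rem N) x| ^ p)) := by
      rw [hTf]
      filter_upwards [Lp.coeFn_add (∑ j ∈ Finset.range N, T (B j)) (T (rem N)),
        coeFn_finset_sum_lp (Finset.range N) fun j => T (B j)] with x h4 h5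
      rw [h4, Pi.add_apply, h5]
      have h6 : 0 ≤ ∑ j ∈ Finset.range N, |T (B j) x| := Finset.sum_nonneg fun _ _ => abs_nonneg _
      rw [← ENNReal.ofReal_add (Real.rpow_nonneg h6 _) (Real.rpow_nonneg (abs_nonneg _) _),
        ← ENNReal.ofReal_mul (by positivity)]
      refine ENNReal.ofReal_le_ofReal (le_trans ?_ (add_rpow_le (by linarith) h6 (abs_nonneg _)))
      refine Real.rpow_le_rpow (abs_nonneg _) ((abs_add_le _ _).trans ?_) (by linarith)
      exact add_le_add (Finset.abs_sum_le_sum_abs _ _) le_rfl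
    refine (lintegral_mono_ae hpt).trans ?_
    rw [lintegral_const_mul' _ _ ENNReal.ofReal_ne_top,
      lintegral_add_right _ (measurable_ofReal_abs_rpow _ _)]
    exact mul_le_mul_right (add_le_add (hmain N) (hremT N)) _
  have hlim : Tendsto (fun N : ℕ => ENNReal.ofReal (2 ^ p) *
      (ENNReal.ofReal (Cs * ((C₁ + C₂) * (Cd * Kq)) * ∫ x, |F x| ^ p ∂μ) +
        ENNReal.ofReal (C₃ * ((Λ / 2 ^ N) ^ (p - 1) * (M * (N + 1)))))) atTop
      (𝓝 (ENNReal.ofReal (2 ^ p) *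
        (ENNReal.ofReal (Cs * ((C₁ + C₂) * (Cd * Kq)) * ∫ x, |F x| ^ p ∂μ) +
          ENNReal.ofReal 0))) :=
    ENNReal.Tendsto.const_mul ((ENNReal.tendsto_ofReal
      (tendsto_div_two_pow_rpow_mul (by linarith) hΛ C₃ M)).const_add _)
      (Or.inr ENNReal.ofReal_ne_top)
  refine (ge_of_tendsto' hlim hbound).trans (le_of_eq ?_)
  rw [ENNReal.ofReal_zero, add_zero, ← ENNReal.ofReal_mul (by positivity), mul_assoc (2 ^ p)]

/-! ### Approximation in `L^p` -/

theorem one_lt_toReal {p : ℝ≥0∞} (hp : 1 < p) (hp' : p < ∞) : 1 < p.toReal := by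
  have h := (ENNReal.toReal_lt_toReal ENNReal.one_ne_top hp'.ne).2 hp
  rwa [ENNReal.toReal_one] at h

theorem eLpNorm_eq_lintegral_ofReal {p : ℝ≥0∞} (hp : 1 < p) (hp' : p < ∞)
    (f : EuclideanSpace ℝ (Fin d) → ℝ) :
    eLpNorm f p μ = (∫⁻ x, ENNReal.ofReal (|f x| ^ p.toReal) ∂μ) ^ (1 / p.toReal) := by
  rw [eLpNorm_eq_lintegral_rpow_enorm_toReal (zero_lt_one.trans hp).ne' hp'.ne]
  congr 1
  refine lintegral_congr fun x => ?_
  rw [Real.enorm_eq_ofReal_abs, ENNReal.ofReal_rpow_of_nonneg (abs_nonneg _) (by positivity)]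

theorem tendsto_eLpNorm_of_dominated {p : ℝ≥0∞} (hp : 1 < p) (hp' : p < ∞)
    {f : EuclideanSpace ℝ (Fin d) → ℝ} (hf : MemLp f p μ)
    {F : ℕ → EuclideanSpace ℝ (Fin d) → ℝ} (hF : ∀ m, AEStronglyMeasurable (F m) μ)
    (hle : ∀ m x, |F m x| ≤ |f x|) (hlim : ∀ x, Tendsto (fun m => F m x) atTop (𝓝 0)) :
    Tendsto (fun m => eLpNorm (F m) p μ) atTop (𝓝 0) := by
  have hq := one_lt_toReal hp hp'
  have hq0 : 0 < p.toReal := by linarith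
  have h1 : Tendsto (fun m => ∫⁻ x, ENNReal.ofReal (|F m x| ^ p.toReal) ∂μ) atTop
      (𝓝 (∫⁻ _, 0 ∂μ)) := by
    refine tendsto_lintegral_of_dominated_convergence' (fun x => ENNReal.ofReal (|f x| ^ p.toReal))
      (fun m => ((hF m).norm.aemeasurable.pow_const _).ennreal_ofReal)
      (fun m => Eventually.of_forall fun x => ?_) ?_ (Eventually.of_forall fun x => ?_)
    · exact ENNReal.ofReal_le_ofReal (Real.rpow_le_rpow (abs_nonneg _) (hle m x) hq0.le)
    · exact (hf.integrable_norm_rpow (zero_lt_one.trans hp).ne' hp'.ne).lintegral_lt_top.ne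
    · have h2 := ((hlim x).abs.rpow_const (p := p.toReal) (Or.inr hq0.le))
      rw [abs_zero, Real.zero_rpow hq0.ne'] at h2
      simpa using ENNReal.tendsto_ofReal h2
  simp_rw [eLpNorm_eq_lintegral_ofReal hp hp']
  have h3 := h1.ennrpow_const (1 / p.toReal)
  rwa [lintegral_zero, ENNReal.zero_rpow_of_pos (by positivity)] at h3

theorem rpow_le_rpow_sub_one_mul {q y m : ℝ} (hq : 1 < q) (hy : 0 ≤ y) (hm : y ≤ m) :
    y ^ q ≤ m ^ (q - 1) * y := by
  rcases hy.eq_or_lt with h | h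
  · rw [← h, Real.zero_rpow (by linarith), mul_zero]
  · calc y ^ q = y ^ (q - 1) * y := by rw [← Real.rpow_add_one h.ne', sub_add_cancel]
      _ ≤ m ^ (q - 1) * y :=
        mul_le_mul_of_nonneg_right (Real.rpow_le_rpow hy hm (by linarith)) hy

theorem eLpNorm_le_of_bounded {p : ℝ≥0∞} (hp : 1 < p) (hp' : p < ∞)
    {f : EuclideanSpace ℝ (Fin d) → ℝ} {m A : ℝ} (hm : 0 ≤ m)
    (hf : ∀ᵐ x ∂μ, |f x| ≤ m) (hA : ∫⁻ x, ‖f x‖ₑ ∂μ ≤ ENNReal.ofReal A) :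
    eLpNorm f p μ ≤ ENNReal.ofReal (m ^ (p.toReal - 1) * A) ^ (1 / p.toReal) := by
  have hq := one_lt_toReal hp hp'
  rw [eLpNorm_eq_lintegral_ofReal hp hp']
  refine ENNReal.rpow_le_rpow ?_ (by positivity)
  have hmq := Real.rpow_nonneg hm (p.toReal - 1)
  calc ∫⁻ x, ENNReal.ofReal (|f x| ^ p.toReal) ∂μ
      ≤ ∫⁻ x, ENNReal.ofReal (m ^ (p.toReal - 1)) * ‖f x‖ₑ ∂μ := by
        refine lintegral_mono_ae ?_
        filter_upwards [hf] with x hx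
        rw [Real.enorm_eq_ofReal_abs, ← ENNReal.ofReal_mul hmq]
        exact ENNReal.ofReal_le_ofReal (rpow_le_rpow_sub_one_mul hq (abs_nonneg _) hx)
    _ = ENNReal.ofReal (m ^ (p.toReal - 1)) * ∫⁻ x, ‖f x‖ₑ ∂μ :=
        lintegral_const_mul' _ _ ENNReal.ofReal_ne_top
    _ ≤ ENNReal.ofReal (m ^ (p.toReal - 1) * A) := by
        rw [ENNReal.ofReal_mul hmq]
        gcongr

theorem tendsto_ofReal_rpow_zero {q : ℝ} (hq : 0 < q) {a : ℕ → ℝ} (ha : Tendsto a atTop (𝓝 0)) :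
    Tendsto (fun m => ENNReal.ofReal (a m) ^ q) atTop (𝓝 0) := by
  have h := (ENNReal.tendsto_ofReal ha).ennrpow_const q
  rwa [ENNReal.ofReal_zero, ENNReal.zero_rpow_of_pos hq] at h

theorem measurable_highPart {f : EuclideanSpace ℝ (Fin d) → ℝ} (hf : Measurable f) (t : ℝ) :
    Measurable (highPart f t) :=
  hf.indicator (measurableSet_lt_abs hf t)

theorem exists_add_one_le_mul_two_pow_rpow {q : ℝ} (hq : 0 < q) :
    ∃ c : ℝ, 0 < c ∧ ∀ k : ℕ, (k : ℝ) + 1 ≤ c * (2 ^ k) ^ q := by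
  have h := tendsto_div_two_pow_rpow_mul hq one_pos 1 1
  obtain ⟨c, hc⟩ := h.bddAbove_range
  refine ⟨max c 1, lt_max_of_lt_right one_pos, fun k => ?_⟩
  have h1 := hc ⟨k, rfl⟩
  have h2 : (0 : ℝ) < (2 ^ k) ^ q := by positivity
  simp only [one_mul] at h1
  rw [Real.div_rpow zero_le_one (by positivity), Real.one_rpow, one_div_mul_eq_div,
    div_le_iff₀ h2] at h1
  exact h1.trans (mul_le_mul_of_nonneg_right (le_max_left _ _) h2.le)

/-- The part of `f` where `2 ^ k < |f| ≤ 2 ^ (k + 1)`. -/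
def bandPart (f : EuclideanSpace ℝ (Fin d) → ℝ) (k : ℕ) : EuclideanSpace ℝ (Fin d) → ℝ :=
  fun x => highPart f (2 ^ k) x - highPart f (2 ^ (k + 1)) x

theorem two_pow_le_two_pow_succ (k : ℕ) : (2 : ℝ) ^ k ≤ 2 ^ (k + 1) :=
  pow_le_pow_right₀ one_le_two k.le_succ

theorem bandPart_eq_zero_or (f : EuclideanSpace ℝ (Fin d) → ℝ) (k : ℕ)
    (x : EuclideanSpace ℝ (Fin d)) :
    bandPart f k x = 0 ∨ 2 ^ k < |f x| ∧ |f x| ≤ 2 ^ (k + 1) ∧ bandPart f k x = f x := by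
  unfold bandPart
  rcases le_or_gt |f x| (2 ^ k) with h | h
  · left
    rw [highPart_of_le h, highPart_of_le (h.trans (two_pow_le_two_pow_succ k)), sub_zero]
  · rcases le_or_gt |f x| (2 ^ (k + 1)) with h' | h'
    · right
      exact ⟨h, h', by rw [highPart_of_lt h, highPart_of_le h', sub_zero]⟩
    · left
      rw [highPart_of_lt h, highPart_of_lt h', sub_self]

theorem measurable_bandPart {f : EuclideanSpace ℝ (Fin d) → ℝ} (hf : Measurable f) (k : ℕ) :
    Measurable (bandPart f k) :=
  (measurable_highPart hf _).sub (measurable_highPart hf _)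

theorem abs_bandPart_le (f : EuclideanSpace ℝ (Fin d) → ℝ) (k : ℕ)
    (x : EuclideanSpace ℝ (Fin d)) : |bandPart f k x| ≤ 2 ^ (k + 1) := by
  rcases bandPart_eq_zero_or f k x with h | ⟨-, h, h'⟩
  · rw [h, abs_zero]
    positivity
  · rwa [h']

theorem hasSum_bandPart (f : EuclideanSpace ℝ (Fin d) → ℝ) (K : ℕ)
    (x : EuclideanSpace ℝ (Fin d)) :
    HasSum (fun k => bandPart f (k + K) x) (highPart f (2 ^ K) x) := by
  obtain ⟨N, hN⟩ := pow_unbounded_of_one_lt |f x| one_lt_two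
  have h1 : ∀ k : ℕ, N ≤ k → highPart f (2 ^ k) x = 0 := fun k hk =>
    highPart_of_le (hN.le.trans (pow_le_pow_right₀ one_le_two hk))
  have h2 : ∑ k ∈ Finset.range N, bandPart f (k + K) x = highPart f (2 ^ K) x := by
    have h3 := Finset.sum_range_sub' (fun k => highPart f (2 ^ (k + K)) x) N
    rw [h1 (N + K) (by omega), sub_zero, zero_add] at h3
    rw [← h3]
    refine Finset.sum_congr rfl fun k _ => ?_
    rw [bandPart, add_right_comm]
  rw [← h2]
  refine hasSum_sum_of_ne_finset_zero (L := .unconditional ℕ) fun k hk => ?_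
  have h3 : N ≤ k := by simpa using hk
  rw [bandPart, h1 _ (by omega), h1 _ (by omega), sub_zero]

theorem sum_abs_bandPart_rpow_le {q : ℝ} (hq : 0 < q) (f : EuclideanSpace ℝ (Fin d) → ℝ) (N : ℕ)
    (x : EuclideanSpace ℝ (Fin d)) :
    ∑ k ∈ Finset.range N, |bandPart f k x| ^ q ≤ |f x| ^ q := by
  have h1 : ∀ k, |bandPart f k x| ^ q ≤
      |highPart f (2 ^ k) x| ^ q - |highPart f (2 ^ (k + 1)) x| ^ q := by
    intro k
    rcases bandPart_eq_zero_or f k x with h | ⟨h1, h2, h3⟩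
    · have h2 : highPart f (2 ^ k) x = highPart f (2 ^ (k + 1)) x := sub_eq_zero.1 h
      rw [h, h2, abs_zero, Real.zero_rpow hq.ne', sub_self]
    · rw [h3, highPart_of_lt h1, highPart_of_le h2, abs_zero, Real.zero_rpow hq.ne', sub_zero]
  refine (Finset.sum_le_sum fun k _ => h1 k).trans ?_
  rw [Finset.sum_range_sub']
  refine (sub_le_self _ (Real.rpow_nonneg (abs_nonneg _) _)).trans ?_
  exact Real.rpow_le_rpow (abs_nonneg _) (abs_highPart_le f _ x) hq.le

/-- On the `k`-th band `|f| ^ (q - 1)` is at least `2 ^ (k (q - 1))`, which dominates `k + 1` up to a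
constant. -/
theorem exists_summable_bandPart {q : ℝ} (hq : 1 < q) {f : EuclideanSpace ℝ (Fin d) → ℝ}
    (hfm : Measurable f) (hf : Integrable (fun x => |f x| ^ q) μ) :
    (∀ k, Integrable (bandPart f k) μ) ∧
      Summable fun k : ℕ => ((k : ℝ) + 1) * ∫ x, |bandPart f k x| ∂μ := by
  have hq0 : 0 < q := by linarith
  obtain ⟨c, hc, hck⟩ := exists_add_one_le_mul_two_pow_rpow (by linarith : 0 < q - 1)
  have h1 : ∀ (k : ℕ) (x), ((k : ℝ) + 1) * |bandPart f k x| ≤ c * |bandPart f k x| ^ q := by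
    intro k x
    rcases bandPart_eq_zero_or f k x with h | ⟨h1, -, h3⟩
    · rw [h, abs_zero, Real.zero_rpow hq0.ne', mul_zero, mul_zero]
    · rw [h3]
      have hpos : 0 < |f x| := lt_trans (by positivity) h1
      have e : |f x| ^ q = |f x| ^ (q - 1) * |f x| := by
        rw [← Real.rpow_add_one hpos.ne', sub_add_cancel]
      rw [e, ← mul_assoc]
      refine mul_le_mul_of_nonneg_right ((hck k).trans ?_) (abs_nonneg _)
      exact mul_le_mul_of_nonneg_left
        (Real.rpow_le_rpow (by positivity) h1.le (by linarith)) hc.le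
  have h2 : ∀ k x, |bandPart f k x| ^ q ≤ |f x| ^ q := fun k x =>
    (Finset.single_le_sum (fun i _ => Real.rpow_nonneg (abs_nonneg (bandPart f i x)) q)
      (Finset.self_mem_range_succ k)).trans (sum_abs_bandPart_rpow_le hq0 f (k + 1) x)
  have hi : ∀ k, Integrable (bandPart f k) μ := by
    intro k
    refine (hf.const_mul c).mono' (measurable_bandPart hfm k).aestronglyMeasurable
      (Eventually.of_forall fun x => ?_)
    have h3 := (h1 k x).trans (mul_le_mul_of_nonneg_left (h2 k x) hc.le)
    rw [Real.norm_eq_abs]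
    refine le_trans ?_ h3
    exact le_mul_of_one_le_left (abs_nonneg _) (by linarith [k.cast_nonneg (α := ℝ)])
  refine ⟨hi, summable_of_sum_range_le (c := c * ∫ x, |f x| ^ q ∂μ)
    (fun k => mul_nonneg (by positivity) (integral_nonneg fun _ => abs_nonneg _)) fun N => ?_⟩
  simp_rw [← integral_const_mul]
  rw [← integral_finsetSum _ fun k _ => (hi k).abs.const_mul _]
  refine integral_mono (integrable_finsetSum _ fun k _ => (hi k).abs.const_mul _)
    (hf.const_mul c) fun x => ?_
  refine (Finset.sum_le_sum fun k _ => h1 k x).trans ?_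
  rw [← Finset.mul_sum]
  exact mul_le_mul_of_nonneg_left (sum_abs_bandPart_rpow_le hq0 f N x) hc.le

/-- A function in `L^p` is bounded up to a sum of atomic blocks that is small both in cost and in
`L^p`. The numbers of steps applied to the centred band parts of `f` grow linearly with the band, so
that the remainders have summable bounds while the total cost is controlled by `‖f‖_p`. -/
theorem GrowthData.exists_bounded_add_small [IsLocallyFiniteMeasure μ] [NeZero μ]
    (D : GrowthData n μ β G) {p : ℝ≥0∞} (hp : 1 < p) (hp' : p < ∞)
    {f : EuclideanSpace ℝ (Fin d) → ℝ} (hfm : Measurable f) (hf : MemLp f p μ) :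
    ∃ (b : ℕ → EuclideanSpace ℝ (Fin d) → ℝ) (s Λ : ℕ → ℝ),
      (∀ K, HasAtomicBlockSum n μ (b K) (s K)) ∧ Tendsto s atTop (𝓝 0) ∧
      Tendsto (fun K => eLpNorm (b K) p μ) atTop (𝓝 0) ∧
      ∀ K, ∀ᵐ x ∂μ, |f x - b K x| ≤ Λ K := by
  obtain ⟨C, hC, hdec⟩ := D.exists_isDecomposition
  have hq := one_lt_toReal hp hp'
  have hp0 : p ≠ 0 := (zero_lt_one.trans hp).ne'
  obtain ⟨hgi, hasum⟩ := exists_summable_bandPart hq hfm (hf.integrable_norm_rpow hp0 hp'.ne)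
  set g : ℕ → EuclideanSpace ℝ (Fin d) → ℝ := bandPart f with hg
  set a : ℕ → ℝ := fun k => ((k : ℝ) + 1) * ∫ x, |g k x| ∂μ with ha
  have hga : ∀ k, ∫ x, |g k x| ∂μ ≤ a k := fun k =>
    le_mul_of_one_le_left (integral_nonneg fun _ => abs_nonneg _)
      (by linarith [k.cast_nonneg (α := ℝ)])
  have ha0 : ∀ k, 0 ≤ a k := fun k => (integral_nonneg fun _ => abs_nonneg _).trans (hga k)
  have hasumK : ∀ K, Summable fun k => a (k + K) := fun K => (summable_nat_add_iff K).2 hasum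
  have hA : Tendsto (fun K => ∑' k, a (k + K)) atTop (𝓝 0) := tendsto_sum_nat_add a
  set A : ℕ → ℝ := fun K => ∑' k, a (k + K) with hAdef
  have hA0 : ∀ K, 0 ≤ A K := fun K => tsum_nonneg fun k => ha0 _
  choose b s hbs using fun k : ℕ => hdec (centre μ (g k)) (2 * 2 ^ (k + 1)) (by positivity)
    ((measurable_bandPart hfm k).sub_const _) (integrable_centre (hgi k))
    (abs_centre_le (by positivity) (Eventually.of_forall fun x => abs_bandPart_le f k x))
    (integral_centre (hgi k))
  have hcint : ∀ k, ∫ x, |centre μ (g k) x| ∂μ ≤ 2 * a k := fun k =>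
    (integral_abs_centre_le (hgi k)).trans (by linarith [hga k])
  -- `2 k + 2` steps bring the bound `4 * 2 ^ (k + 2)` for the remainder down to `4 / 2 ^ k`
  set B : ℕ → EuclideanSpace ℝ (Fin d) → ℝ := fun k x =>
    ∑ j ∈ Finset.range (2 * k + 2), b k j x with hB
  set r : ℕ → EuclideanSpace ℝ (Fin d) → ℝ := fun k x => centre μ (g k) x - B k x with hr
  have hBsum : ∀ k, HasAtomicBlockSum n μ (B k) (∑ j ∈ Finset.range (2 * k + 2), s k j) :=
    fun k => HasAtomicBlockSum.finset_sum _ fun j _ => (hbs k).sum j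
  have hcost : ∀ k, ∑ j ∈ Finset.range (2 * k + 2), s k j ≤ 4 * C * a k := by
    intro k
    have h1 : ∀ j ∈ Finset.range (2 * k + 2), s k j ≤ C * (2 * ∫ x, |g k x| ∂μ) := fun j _ =>
      ((hbs k).cost j).trans (mul_le_mul_of_nonneg_left ((integral_mono (integrable_highPart
        ((measurable_bandPart hfm k).sub_const _) (integrable_centre (hgi k)) _).abs
        (integrable_centre (hgi k)).abs fun x => abs_highPart_le _ _ x).trans
        (integral_abs_centre_le (hgi k))) hC.le)
    refine (Finset.sum_le_sum h1).trans (le_of_eq ?_)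
    rw [Finset.sum_const, Finset.card_range, nsmul_eq_mul, ha]
    push_cast
    ring
  have hrabs : ∀ k, ∀ᵐ x ∂μ, |r k x| ≤ 4 * (1 / 2) ^ k := by
    intro k
    filter_upwards [(hbs k).remainder (2 * k + 2)] with x hx
    refine hx.trans (le_of_eq ?_)
    rw [one_div_pow]
    have : (2 : ℝ) ^ (2 * k + 2) = 2 ^ k * (2 * 2 ^ (k + 1)) := by ring
    rw [this]
    field_simp
  have hri : ∀ k, Integrable (r k) μ := fun k =>
    (integrable_centre (hgi k)).sub (hBsum k).integrable_and.1
  have hrint : ∀ k, ∫ x, |r k x| ∂μ ≤ 10 * a k := fun k =>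
    ((hbs k).integral_remainder (2 * k + 2)).trans (by linarith [hcint k])
  have hrall : ∀ᵐ x ∂μ, ∀ k, |r k x| ≤ 4 * (1 / 2) ^ k := ae_all_iff.2 hrabs
  have hgeo : ∀ K, Summable fun k : ℕ => 4 * ((1 : ℝ) / 2) ^ (k + K) := fun K =>
    (summable_nat_add_iff K (f := fun k : ℕ => 4 * ((1 : ℝ) / 2) ^ k)).2
      (summable_geometric_two.mul_left 4)
  have hrsum : ∀ K, ∀ᵐ x ∂μ, Summable fun k => r (k + K) x := fun K => by
    filter_upwards [hrall] with x hx
    exact Summable.of_norm_bounded (hgeo K) fun k => hx _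
  set R : ℕ → EuclideanSpace ℝ (Fin d) → ℝ := fun K x => ∑' k, r (k + K) x with hR
  have hRabs : ∀ K, ∀ᵐ x ∂μ, |R K x| ≤ 8 := by
    intro K
    filter_upwards [hrall] with x hx
    refine (tsum_of_norm_bounded (f := fun k => r (k + K) x) (hgeo K).hasSum
      fun k => hx (k + K)).trans ?_
    have h1 : ∑' k : ℕ, 4 * ((1 : ℝ) / 2) ^ (k + K) ≤ ∑' k : ℕ, 4 * ((1 : ℝ) / 2) ^ k :=
      (hgeo K).tsum_le_tsum (fun k => mul_le_mul_of_nonneg_left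
        (pow_le_pow_of_le_one (by norm_num) (by norm_num) (by omega)) (by norm_num))
        (summable_geometric_two.mul_left 4)
    refine h1.trans (le_of_eq ?_)
    rw [tsum_mul_left, tsum_geometric_two]
    norm_num
  have hRint : ∀ K, ∫⁻ x, ‖R K x‖ₑ ∂μ ≤ ENNReal.ofReal (10 * A K) := by
    intro K
    calc ∫⁻ x, ‖R K x‖ₑ ∂μ ≤ ∫⁻ x, ∑' k, ‖r (k + K) x‖ₑ ∂μ :=
          lintegral_mono fun x => enorm_tsum_le_tsum_enorm
      _ = ∑' k, ∫⁻ x, ‖r (k + K) x‖ₑ ∂μ := lintegral_tsum fun k => (hri _).1.enorm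
      _ ≤ ∑' k, ENNReal.ofReal (10 * a (k + K)) := by
          refine ENNReal.tsum_le_tsum fun k => ?_
          have h1 := ofReal_integral_norm_eq_lintegral_enorm (hri (k + K))
          rw [← h1]
          exact ENNReal.ofReal_le_ofReal (hrint _)
      _ = ENNReal.ofReal (10 * A K) := by
          rw [← ENNReal.ofReal_tsum_of_nonneg (fun k => mul_nonneg (by norm_num) (ha0 _))
            ((hasumK K).mul_left 10), tsum_mul_left]
  -- for infinite `μ` the inverse of the total mass is zero by convention, as are all averages
  set κ := (μ.real Set.univ)⁻¹ with hκ
  have hκ0 : 0 ≤ κ := inv_nonneg.2 measureReal_nonneg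
  have havg : ∀ k, |⨍ x, g k x ∂μ| ≤ κ * a k := by
    intro k
    rw [average_eq, smul_eq_mul, abs_mul, abs_of_nonneg hκ0]
    exact mul_le_mul_of_nonneg_left (abs_integral_le_integral_abs.trans (hga k)) hκ0
  have havgs : ∀ K, Summable fun k => ⨍ x, g (k + K) x ∂μ := fun K =>
    Summable.of_norm_bounded ((hasumK K).mul_left κ) fun k => havg _
  set c : ℕ → ℝ := fun K => ∑' k, ⨍ x, g (k + K) x ∂μ with hc
  have hcabs : ∀ K, |c K| ≤ κ * A K := fun K => by
    have h1 := tsum_of_norm_bounded (f := fun k => ⨍ x, g (k + K) x ∂μ)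
      ((hasumK K).mul_left κ).hasSum fun k => havg (k + K)
    rwa [tsum_mul_left] at h1
  have hcn : Tendsto (fun K => eLpNorm (fun _ : EuclideanSpace ℝ (Fin d) => c K) p μ) atTop
      (𝓝 0) := by
    have h1 : Tendsto (fun K => ENNReal.ofReal (κ * A K) * μ Set.univ ^ (1 / p.toReal)) atTop
        (𝓝 0) := by
      by_cases hfin : μ Set.univ < ∞
      · have h2 := ENNReal.Tendsto.mul_const (b := μ Set.univ ^ (1 / p.toReal))
          (ENNReal.tendsto_ofReal (hA.const_mul κ)) (Or.inr
            (ENNReal.rpow_ne_top_of_nonneg (by positivity) hfin.ne))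
        rwa [mul_zero, ENNReal.ofReal_zero, zero_mul] at h2
      · rw [not_lt, top_le_iff] at hfin
        have h2 : κ = 0 := by
          rw [hκ, measureReal_def, hfin]
          simp
        simp [h2]
    refine tendsto_of_tendsto_of_tendsto_of_le_of_le tendsto_const_nhds h1 (fun _ => zero_le)
      fun K => ?_
    rw [eLpNorm_const _ hp0 (NeZero.ne μ), Real.enorm_eq_ofReal_abs]
    exact mul_le_mul_left (ENNReal.ofReal_le_ofReal (hcabs K)) _
  have hcosts : ∀ K, Summable fun k => ∑ j ∈ Finset.range (2 * (k + K) + 2), s (k + K) j :=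
    fun K => Summable.of_nonneg_of_le (fun k => (hBsum (k + K)).nonneg) (fun k => hcost (k + K))
      ((hasumK K).mul_left (4 * C))
  set F : ℕ → EuclideanSpace ℝ (Fin d) → ℝ := fun K x => highPart f (2 ^ K) x - c K - R K x with hF
  have hFsum : ∀ K, HasAtomicBlockSum n μ (F K)
      (∑' k, ∑ j ∈ Finset.range (2 * (k + K) + 2), s (k + K) j) := by
    intro K
    refine HasAtomicBlockSum.tsum (fun k => hBsum (k + K)) (hcosts K) ?_
    filter_upwards [hrsum K] with x hx
    refine (((hasSum_bandPart f K x).sub (havgs K).hasSum).sub hx.hasSum).congr_fun ?_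
    intro k
    simp only [hr, centre, hg]
    ring
  have hRm : ∀ K, AEStronglyMeasurable (R K) μ := by
    intro K
    have h1 : R K = fun x => highPart f (2 ^ K) x - c K - F K x := by
      funext x
      simp only [hF]
      ring
    rw [h1]
    exact ((measurable_highPart hfm _).aestronglyMeasurable.sub aestronglyMeasurable_const).sub
      (hFsum K).integrable_and.1.1
  refine ⟨F, _, fun K => 2 ^ K + κ * A K + 8, hFsum, ?_, ?_, fun K => ?_⟩
  · have h1 := hA.const_mul (4 * C)
    rw [mul_zero] at h1
    refine tendsto_of_tendsto_of_tendsto_of_le_of_le tendsto_const_nhds h1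
      (fun K => (hFsum K).nonneg) fun K => ?_
    rw [hAdef]
    simp only
    rw [← tsum_mul_left]
    exact (hcosts K).tsum_le_tsum (fun k => hcost (k + K)) ((hasumK K).mul_left (4 * C))
  · have h1 : Tendsto (fun K => eLpNorm (highPart f (2 ^ K)) p μ) atTop (𝓝 0) := by
      refine tendsto_eLpNorm_of_dominated hp hp' hf
        (fun K => (measurable_highPart hfm _).aestronglyMeasurable)
        (fun K x => abs_highPart_le f _ x) fun x => ?_
      obtain ⟨N, hN⟩ := pow_unbounded_of_one_lt |f x| one_lt_two
      refine tendsto_const_nhds.congr' ?_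
      filter_upwards [eventually_ge_atTop N] with K hK
      exact (highPart_of_le (hN.le.trans (pow_le_pow_right₀ one_le_two hK))).symm
    have h2 : Tendsto (fun K => ENNReal.ofReal (8 ^ (p.toReal - 1) * (10 * A K)) ^ (1 / p.toReal))
        atTop (𝓝 0) := by
      refine tendsto_ofReal_rpow_zero (by positivity) ?_
      have h3 := (hA.const_mul 10).const_mul ((8 : ℝ) ^ (p.toReal - 1))
      rwa [mul_zero, mul_zero] at h3
    have h3 := (h1.add hcn).add h2
    rw [add_zero, add_zero] at h3
    refine tendsto_of_tendsto_of_tendsto_of_le_of_le tendsto_const_nhds h3 (fun _ => zero_le)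
      fun K => ?_
    have m1 := (measurable_highPart hfm (2 ^ K)).aestronglyMeasurable (μ := μ)
    have m2 : AEStronglyMeasurable (fun _ : EuclideanSpace ℝ (Fin d) => c K) μ :=
      aestronglyMeasurable_const
    refine (eLpNorm_sub_le (m1.sub m2) (hRm K) hp.le).trans (add_le_add
      (eLpNorm_sub_le m1 m2 hp.le) ?_)
    exact eLpNorm_le_of_bounded hp hp' (by norm_num) (hRabs K) (hRint K)
  · filter_upwards [hRabs K] with x hx
    have h1 : f x - F K x = (f x - highPart f (2 ^ K) x) + c K + R K x := by
      simp only [hF]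
      ring
    rw [h1]
    refine (abs_add_three _ _ _).trans ?_
    linarith [abs_sub_highPart_le f (by positivity : (0 : ℝ) ≤ 2 ^ K) x, hcabs K]

theorem integrable_highPart_of_memLp {p : ℝ≥0∞} (hp : 1 < p) (hp' : p < ∞)
    {f : EuclideanSpace ℝ (Fin d) → ℝ} (hfm : Measurable f) (hf : MemLp f p μ) {t : ℝ}
    (ht : 0 < t) : Integrable (highPart f t) μ := by
  have hq := one_lt_toReal hp hp'
  have h1 : Integrable (fun x => |f x| ^ p.toReal) μ :=
    hf.integrable_norm_rpow (zero_lt_one.trans hp).ne' hp'.ne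
  refine (h1.const_mul (t ^ (p.toReal - 1))⁻¹).mono'
    (measurable_highPart hfm t).aestronglyMeasurable (Eventually.of_forall fun x => ?_)
  rw [Real.norm_eq_abs]
  rcases le_or_gt |f x| t with h | h
  · rw [highPart_of_le h, abs_zero]
    positivity
  · rw [highPart_of_lt h, inv_mul_eq_div, le_div_iff₀ (by positivity)]
    have hpos : 0 < |f x| := ht.trans h
    have e : |f x| ^ p.toReal = |f x| * |f x| ^ (p.toReal - 1) := by
      rw [mul_comm, ← Real.rpow_add_one hpos.ne', sub_add_cancel]
    rw [e]
    exact mul_le_mul_of_nonneg_left (Real.rpow_le_rpow ht.le h.le (by linarith)) hpos.le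

/-- Bounded functions in `L^p` are limits, both uniformly and in `L^p`, of bounded sums of atomic
blocks. -/
theorem GrowthData.exists_approximation [IsLocallyFiniteMeasure μ] [NeZero μ]
    (D : GrowthData n μ β G) {p : ℝ≥0∞} (hp : 1 < p) (hp' : p < ∞)
    {u : EuclideanSpace ℝ (Fin d) → ℝ} {Λ : ℝ} (hum : Measurable u) (hu : MemLp u p μ)
    (huΛ : ∀ᵐ x ∂μ, |u x| ≤ Λ) (hu0 : μ Set.univ < ∞ → ∫ x, u x ∂μ = 0) {ε : ℝ} (hε : 0 < ε) :
    ∃ (c : EuclideanSpace ℝ (Fin d) → ℝ) (s : ℝ), HasAtomicBlockSum n μ c s ∧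
      (∀ᵐ x ∂μ, |u x - c x| ≤ ε) ∧ eLpNorm (fun x => u x - c x) p μ ≤ ENNReal.ofReal ε := by
  by_cases hfin : μ Set.univ < ∞
  · refine ⟨u, max Λ 0 * μ.real Set.univ, hasAtomicBlockSum_of_bounded hfin
      hum.aestronglyMeasurable (le_max_right _ _) ?_ (hu0 hfin), ?_, ?_⟩
    · filter_upwards [huΛ] with x hx
      exact hx.trans (le_max_left _ _)
    · simpa using hε.le
    · simp
  have hq := one_lt_toReal hp hp'
  obtain ⟨C, hC, hdec⟩ := D.exists_isDecomposition
  have hlow : Tendsto (fun m : ℕ => eLpNorm (fun x => u x - highPart u ((1 / 2) ^ m) x) p μ) atTop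
      (𝓝 0) := by
    refine tendsto_eLpNorm_of_dominated hp hp' hu
      (fun m => (hum.sub (measurable_highPart hum _)).aestronglyMeasurable) (fun m x => ?_)
      fun x => ?_
    · rcases le_or_gt |u x| ((1 / 2) ^ m) with h | h
      · rw [highPart_of_le h, sub_zero]
      · rw [highPart_of_lt h, sub_self, abs_zero]
        exact abs_nonneg _
    · refine squeeze_zero_norm (fun m => abs_sub_highPart_le u (by positivity) x)
        (tendsto_pow_atTop_nhds_zero_of_lt_one (by norm_num) (by norm_num))
  have hε2 : (0 : ℝ≥0∞) < ENNReal.ofReal (ε / 2) := ENNReal.ofReal_pos.2 (by positivity)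
  have hpow : Tendsto (fun m : ℕ => ((1 : ℝ) / 2) ^ m) atTop (𝓝 0) :=
    tendsto_pow_atTop_nhds_zero_of_lt_one (by norm_num) (by norm_num)
  obtain ⟨m, hm1, hm2⟩ := ((hlow.eventually (gt_mem_nhds hε2)).and
    (hpow.eventually (gt_mem_nhds (by positivity : 0 < ε / 2)))).exists
  set f := highPart u ((1 / 2) ^ m) with hf
  have hfi : Integrable f μ := integrable_highPart_of_memLp hp hp' hum hu (by positivity)
  set L := max Λ 1 with hL
  have hL0 : 0 < L := lt_max_of_lt_right one_pos
  have hfL : ∀ᵐ x ∂μ, |f x| ≤ L := by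
    filter_upwards [huΛ] with x hx
    exact (abs_highPart_le u _ x).trans (hx.trans (le_max_left _ _))
  obtain ⟨b, s, hbs⟩ := hdec f L hL0 (measurable_highPart hum _) hfi hfL fun h => absurd h hfin
  have hlev : Tendsto (fun N : ℕ => 4 * (L / 2 ^ N)) atTop (𝓝 0) := by
    have h := hpow.const_mul (4 * L)
    rw [mul_zero] at h
    refine h.congr fun N => ?_
    rw [one_div_pow]
    ring
  have hI : 0 ≤ ∫ x, |f x| ∂μ := integral_nonneg fun _ => abs_nonneg _
  have hlevp : Tendsto (fun N : ℕ => ENNReal.ofReal ((4 * (L / 2 ^ N)) ^ (p.toReal - 1) *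
      (5 * ∫ x, |f x| ∂μ)) ^ (1 / p.toReal)) atTop (𝓝 0) := by
    refine tendsto_ofReal_rpow_zero (by positivity) ?_
    have h := (hlev.rpow_const (p := p.toReal - 1) (Or.inr (by linarith))).mul_const
      (5 * ∫ x, |f x| ∂μ)
    rwa [Real.zero_rpow (by linarith), zero_mul] at h
  obtain ⟨N, hN1, hN2⟩ := ((hlev.eventually (gt_mem_nhds (by positivity : 0 < ε / 2))).and
    (hlevp.eventually (gt_mem_nhds hε2))).exists
  have hsum : HasAtomicBlockSum n μ (fun x => ∑ j ∈ Finset.range N, b j x)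
      (∑ j ∈ Finset.range N, s j) := HasAtomicBlockSum.finset_sum _ fun j _ => hbs.sum j
  have hsplit : (fun x => u x - ∑ j ∈ Finset.range N, b j x) =
      (fun x => u x - f x) + fun x => f x - ∑ j ∈ Finset.range N, b j x := by
    funext x
    simp
  have hri : Integrable (fun x => f x - ∑ j ∈ Finset.range N, b j x) μ :=
    hfi.sub hsum.integrable_and.1
  refine ⟨_, _, hsum, ?_, ?_⟩
  · filter_upwards [hbs.remainder N] with x hx
    have h1 := congrFun hsplit x
    simp only [Pi.add_apply] at h1
    rw [h1]
    refine (abs_add_le _ _).trans ?_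
    have h2 := abs_sub_highPart_le u (by positivity : (0 : ℝ) ≤ (1 / 2) ^ m) x
    linarith
  · rw [hsplit]
    refine (eLpNorm_add_le (hum.sub (measurable_highPart hum _)).aestronglyMeasurable hri.1
      hp.le).trans ?_
    have h1 : ENNReal.ofReal ε = ENNReal.ofReal (ε / 2) + ENNReal.ofReal (ε / 2) := by
      rw [← ENNReal.ofReal_add (by positivity) (by positivity), add_halves]
    rw [h1]
    refine add_le_add hm1.le (le_trans ?_ hN2.le)
    refine eLpNorm_le_of_bounded hp hp' (by positivity) (hbs.remainder N) ?_
    rw [← ofReal_integral_norm_eq_lintegral_enorm hri]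
    exact ENNReal.ofReal_le_ofReal (hbs.integral_remainder N)

/-! ### The extension to `L^p` -/

theorem memLp_of_bounded {p : ℝ≥0∞} (hp : 1 < p) (hp' : p < ∞)
    {f : EuclideanSpace ℝ (Fin d) → ℝ} {Λ : ℝ} (hf : Integrable f μ)
    (hΛ : ∀ᵐ x ∂μ, |f x| ≤ Λ) : MemLp f p μ := by
  have hΛ' : ∀ᵐ x ∂μ, |f x| ≤ max Λ 0 := by
    filter_upwards [hΛ] with x hx
    exact hx.trans (le_max_left _ _)
  refine ⟨hf.1, (eLpNorm_le_of_bounded hp hp' (le_max_right _ _) hΛ'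
    (ofReal_integral_norm_eq_lintegral_enorm hf).ge).trans_lt ?_⟩
  exact ENNReal.rpow_lt_top_of_nonneg (by positivity) ENNReal.ofReal_ne_top

theorem EndpointBounds.exists_eLpNorm_le [IsLocallyFiniteMeasure μ] [NeZero μ]
    (D : GrowthData n μ β G) {T : H1atb n μ →ₗ[ℝ] Lp ℝ 1 μ} {C : ℝ}
    (hT : EndpointBounds n β μ T C) {p : ℝ≥0∞} (hp : 1 < p) (hp' : p < ∞) :
    ∃ C' : ℝ, 0 ≤ C' ∧ ∀ (f : H1atb n μ) (Λ : ℝ),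
      (∀ᵐ x ∂μ, |(f : EuclideanSpace ℝ (Fin d) →ₘ[μ] ℝ) x| ≤ Λ) →
      eLpNorm (T f) p μ ≤
        ENNReal.ofReal C' * eLpNorm (f : EuclideanSpace ℝ (Fin d) →ₘ[μ] ℝ) p μ := by
  have hq := one_lt_toReal hp hp'
  obtain ⟨C', hC', h⟩ := hT.exists_lintegral_rpow_le_integral D hq
  refine ⟨C' ^ (1 / p.toReal), by positivity, fun f Λ hf => ?_⟩
  obtain ⟨s, hs⟩ := f.2
  have hi := integrable_rpow_of_bounded hq hs.integrable_and.1 hf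
  rw [eLpNorm_eq_lintegral_ofReal hp hp', eLpNorm_eq_lintegral_ofReal hp hp',
    ← ENNReal.ofReal_rpow_of_nonneg hC' (by positivity),
    ← ENNReal.mul_rpow_of_nonneg _ _ (by positivity)]
  refine ENNReal.rpow_le_rpow ((h f Λ hf).trans (le_of_eq ?_)) (by positivity)
  rw [ENNReal.ofReal_mul hC', ofReal_integral_eq_lintegral_ofReal hi
    (Eventually.of_forall fun x => Real.rpow_nonneg (abs_nonneg _) _)]

/-- The bounded functions in the atomic block space. -/
def boundedH1 (n : ℕ) (μ : Measure (EuclideanSpace ℝ (Fin d))) : Submodule ℝ (H1atb n μ) where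
  carrier := {f | ∃ Λ : ℝ, ∀ᵐ x ∂μ, |(f : EuclideanSpace ℝ (Fin d) →ₘ[μ] ℝ) x| ≤ Λ}
  zero_mem' := by
    refine ⟨0, ?_⟩
    filter_upwards [AEEqFun.coeFn_zero (μ := μ) (β := ℝ)] with x hx
    rw [Submodule.coe_zero, hx]
    simp
  add_mem' := by
    rintro f g ⟨Λ, hf⟩ ⟨Λ', hg⟩
    refine ⟨Λ + Λ', ?_⟩
    filter_upwards [hf, hg, AEEqFun.coeFn_add (f : EuclideanSpace ℝ (Fin d) →ₘ[μ] ℝ) g]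
      with x h1 h2 h3
    rw [Submodule.coe_add, h3]
    exact (abs_add_le _ _).trans (add_le_add h1 h2)
  smul_mem' := by
    rintro r f ⟨Λ, hf⟩
    refine ⟨|r| * Λ, ?_⟩
    filter_upwards [hf, AEEqFun.coeFn_smul r (f : EuclideanSpace ℝ (Fin d) →ₘ[μ] ℝ)] with x h1 h2
    rw [Submodule.coe_smul, h2, Pi.smul_apply, smul_eq_mul, abs_mul]
    exact mul_le_mul_of_nonneg_left h1 (abs_nonneg _)

/-- A linear map into classes of functions whose values lie in `L^p`, as a map into `L^p`. -/
def lpLift {V : Type*} [AddCommMonoid V] [Module ℝ V] (p : ℝ≥0∞)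
    (L : V →ₗ[ℝ] EuclideanSpace ℝ (Fin d) →ₘ[μ] ℝ) (h : ∀ v, L v ∈ Lp ℝ p μ) :
    V →ₗ[ℝ] Lp ℝ p μ where
  toFun v := ⟨L v, h v⟩
  map_add' v w := Subtype.ext (map_add L v w)
  map_smul' r v := Subtype.ext (map_smul L r v)

/-- The inclusion of `L^p` into the space of classes of functions. -/
def lpIncl (p : ℝ≥0∞) : Lp ℝ p μ →ₗ[ℝ] EuclideanSpace ℝ (Fin d) →ₘ[μ] ℝ where
  toFun f := f
  map_add' _ _ := rfl
  map_smul' _ _ := rfl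

theorem memLp_of_mem_boundedH1 [IsLocallyFiniteMeasure μ] {p : ℝ≥0∞} (hp : 1 < p) (hp' : p < ∞)
    (f : boundedH1 n μ) :
    MemLp ((f : H1atb n μ) : EuclideanSpace ℝ (Fin d) →ₘ[μ] ℝ) p μ := by
  obtain ⟨Λ, hΛ⟩ := f.2
  obtain ⟨s, hs⟩ := (f : H1atb n μ).2
  exact memLp_of_bounded hp hp' hs.integrable_and.1 hΛ

theorem exists_abs_average_le {p : ℝ≥0∞} [Fact (1 ≤ p)] (hfin : μ Set.univ < ∞) :
    ∃ M : ℝ, 0 ≤ M ∧ ∀ u : Lp ℝ p μ, |⨍ x, u x ∂μ| ≤ M * ‖u‖ := by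
  have : IsFiniteMeasure μ := ⟨hfin⟩
  have hp : (1 : ℝ≥0∞) ≤ p := Fact.out
  set κ := (μ.real Set.univ)⁻¹ with hκ
  have hκ0 : 0 ≤ κ := inv_nonneg.2 measureReal_nonneg
  have hpow : 0 ≤ 1 / (1 : ℝ≥0∞).toReal - 1 / p.toReal := by
    rcases eq_or_ne p ∞ with rfl | h
    · simp
    · have h1 : 1 ≤ p.toReal := by
        have := ENNReal.toReal_mono h hp
        rwa [ENNReal.toReal_one] at this
      rw [ENNReal.toReal_one, sub_nonneg]
      exact one_div_le_one_div_of_le one_pos h1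
  set W := μ Set.univ ^ (1 / (1 : ℝ≥0∞).toReal - 1 / p.toReal) with hW
  have hWt : W ≠ ∞ := ENNReal.rpow_ne_top_of_nonneg hpow hfin.ne
  refine ⟨κ * W.toReal, by positivity, fun u => ?_⟩
  have hum : MemLp u p μ := Lp.memLp u
  have h1 : ∫ x, |u x| ∂μ ≤ ‖u‖ * W.toReal := by
    have h2 := eLpNorm_le_eLpNorm_mul_rpow_measure_univ hp hum.1
    have h3 := ENNReal.toReal_mono (ENNReal.mul_ne_top hum.2.ne hWt) h2
    rw [ENNReal.toReal_mul, ← Lp.norm_def, eLpNorm_one_eq_lintegral_enorm,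
      ← integral_norm_eq_lintegral_enorm hum.1] at h3
    exact h3
  rw [average_eq, smul_eq_mul, abs_mul, abs_of_nonneg hκ0, mul_assoc]
  refine mul_le_mul_of_nonneg_left (abs_integral_le_integral_abs.trans (h1.trans ?_)) hκ0
  rw [mul_comm]

/-- `w` is the constant function `1` if it lies in `L^p`, and zero otherwise. -/
def IsUnitOrZero {p : ℝ≥0∞} (w : Lp ℝ p μ) : Prop :=
  (μ Set.univ < ∞ → w =ᵐ[μ] fun _ => (1 : ℝ)) ∧ (¬μ Set.univ < ∞ → w = 0)

theorem exists_isUnitOrZero (p : ℝ≥0∞) : ∃ w : Lp ℝ p μ, IsUnitOrZero w := by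
  by_cases hfin : μ Set.univ < ∞
  · have : IsFiniteMeasure μ := ⟨hfin⟩
    exact ⟨(memLp_const 1).toLp _, fun _ => MemLp.coeFn_toLp _, fun h => absurd hfin h⟩
  · exact ⟨0, fun h => absurd h hfin, fun _ => rfl⟩

theorem IsUnitOrZero.coeFn_average_smul {p : ℝ≥0∞} {w : Lp ℝ p μ} (hw : IsUnitOrZero w)
    (g : EuclideanSpace ℝ (Fin d) → ℝ) :
    ((⨍ y, g y ∂μ) • w : Lp ℝ p μ) =ᵐ[μ] fun _ => ⨍ y, g y ∂μ := by
  by_cases hfin : μ Set.univ < ∞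
  · filter_upwards [Lp.coeFn_smul (⨍ y, g y ∂μ) w, hw.1 hfin] with x h1 h2
    rw [h1, Pi.smul_apply, h2, smul_eq_mul, mul_one]
  · rw [average_eq_zero_of_infinite hfin, zero_smul]
    exact Lp.coeFn_zero _ _ _

theorem memLp_average {p : ℝ≥0∞} (g : EuclideanSpace ℝ (Fin d) → ℝ) :
    MemLp (fun _ : EuclideanSpace ℝ (Fin d) => ⨍ y, g y ∂μ) p μ := by
  obtain ⟨w, hw⟩ := exists_isUnitOrZero (μ := μ) p
  exact (memLp_congr_ae (hw.coeFn_average_smul g)).1 (Lp.memLp _)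

/-- Up to constants, bounded sums of atomic blocks are dense in `L^p`. -/
theorem GrowthData.exists_norm_sub_lt [IsLocallyFiniteMeasure μ] [NeZero μ]
    (D : GrowthData n μ β G) {p : ℝ≥0∞} [Fact (1 ≤ p)] (hp : 1 < p) (hp' : p < ∞)
    {w : Lp ℝ p μ} (hw : IsUnitOrZero w) (e : boundedH1 n μ →ₗ[ℝ] Lp ℝ p μ)
    (he : ∀ v, (e v : EuclideanSpace ℝ (Fin d) →ₘ[μ] ℝ) = (v : H1atb n μ)) (u : Lp ℝ p μ) {ε : ℝ}
    (hε : 0 < ε) : ∃ (v : boundedH1 n μ) (c : ℝ), ‖u - (e v + c • w)‖ ≤ ε := by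
  have hum : MemLp u p μ := Lp.memLp u
  have humeas : Measurable u := (Lp.stronglyMeasurable u).measurable
  obtain ⟨b, s, Λ, hb, -, hbn, hbΛ⟩ := D.exists_bounded_add_small hp hp' humeas hum
  have hε2 : (0 : ℝ≥0∞) < ENNReal.ofReal (ε / 2) := ENNReal.ofReal_pos.2 (by positivity)
  obtain ⟨K, hK⟩ := (hbn.eventually (gt_mem_nhds hε2)).exists
  have hbm := (hb K).integrable_and.1.1
  have hbLp : MemLp (b K) p μ := ⟨hbm, hK.trans ENNReal.ofReal_lt_top⟩
  obtain ⟨b', hb'm, hbb'⟩ := hbm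
  set g : EuclideanSpace ℝ (Fin d) → ℝ := fun x => u x - b' x with hg
  have hgLp : MemLp g p μ := hum.sub ((memLp_congr_ae hbb').1 hbLp)
  set y : EuclideanSpace ℝ (Fin d) → ℝ := centre μ g with hy
  have hyLp : MemLp y p μ := hgLp.sub (memLp_average g)
  have hym : Measurable y := (humeas.sub hb'm.measurable).sub_const _
  have hgΛ : ∀ᵐ x ∂μ, |g x| ≤ max (Λ K) 0 := by
    filter_upwards [hbΛ K, hbb'] with x h1 h2
    rw [hg]
    simp only
    rw [← h2]
    exact h1.trans (le_max_left _ _)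
  have hyΛ := abs_centre_le (le_max_right _ _) hgΛ
  obtain ⟨c, t, hc, hcabs, hcn⟩ := D.exists_approximation hp hp' hym hyLp hyΛ (fun hfin => by
    have : IsFiniteMeasure μ := ⟨hfin⟩
    exact integral_centre (hgLp.integrable hp.le) hfin) (half_pos hε)
  have hvmem : hc.toH1atb ∈ boundedH1 n μ := by
    refine ⟨2 * max (Λ K) 0 + ε / 2, ?_⟩
    filter_upwards [hc.coeFn_toH1atb, hyΛ, hcabs] with x h1 h2 h3
    rw [h1]
    have h4 := abs_sub (y x) (y x - c x)
    rw [sub_sub_cancel] at h4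
    exact h4.trans (add_le_add h2 h3)
  obtain ⟨v, hv⟩ : ∃ v : boundedH1 n μ, (v : H1atb n μ) = hc.toH1atb := ⟨⟨_, hvmem⟩, rfl⟩
  refine ⟨v, ⨍ x, g x ∂μ, ?_⟩
  have hev : e v =ᵐ[μ] c := by
    rw [he, hv]
    exact hc.coeFn_toH1atb
  have hae : (u - (e v + (⨍ x, g x ∂μ) • w) : Lp ℝ p μ) =ᵐ[μ]
      (b K + fun x => y x - c x : EuclideanSpace ℝ (Fin d) → ℝ) := by
    filter_upwards [Lp.coeFn_sub u (e v + (⨍ x, g x ∂μ) • w),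
      Lp.coeFn_add (e v) ((⨍ x, g x ∂μ) • w), hw.coeFn_average_smul g, hev, hbb']
      with x h1 h2 h3 h4 h5
    rw [h1, Pi.sub_apply, h2, Pi.add_apply, h3, h4, Pi.add_apply, h5]
    simp only [hy, centre, hg]
    ring
  rw [Lp.norm_def]
  refine ENNReal.toReal_le_of_le_ofReal hε.le ?_
  rw [eLpNorm_congr_ae hae]
  refine (eLpNorm_add_le hbLp.1 (hyLp.1.sub hc.integrable_and.1.1) hp.le).trans ?_
  have h1 : ENNReal.ofReal ε = ENNReal.ofReal (ε / 2) + ENNReal.ofReal (ε / 2) := by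
    rw [← ENNReal.ofReal_add (by positivity) (by positivity), add_halves]
  rw [h1]
  exact add_le_add hK.le hcn

theorem exists_lp_inclusion [IsLocallyFiniteMeasure μ] {p : ℝ≥0∞} (hp : 1 < p) (hp' : p < ∞) :
    ∃ e : boundedH1 n μ →ₗ[ℝ] Lp ℝ p μ,
      ∀ v, (e v : EuclideanSpace ℝ (Fin d) →ₘ[μ] ℝ) = (v : H1atb n μ) :=
  ⟨lpLift p ((H1atb n μ).subtype ∘ₗ (boundedH1 n μ).subtype) fun v =>
    Lp.mem_Lp_iff_eLpNorm_lt_top.2 (memLp_of_mem_boundedH1 hp hp' v).2, fun _ => rfl⟩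

theorem EndpointBounds.exists_lp_operator [IsLocallyFiniteMeasure μ] [NeZero μ]
    (D : GrowthData n μ β G) {T : H1atb n μ →ₗ[ℝ] Lp ℝ 1 μ} {C : ℝ}
    (hT : EndpointBounds n β μ T C) {p : ℝ≥0∞} [Fact (1 ≤ p)] (hp : 1 < p) (hp' : p < ∞)
    {e : boundedH1 n μ →ₗ[ℝ] Lp ℝ p μ}
    (he : ∀ v, (e v : EuclideanSpace ℝ (Fin d) →ₘ[μ] ℝ) = (v : H1atb n μ)) :
    ∃ (T' : boundedH1 n μ →ₗ[ℝ] Lp ℝ p μ) (C' : ℝ), 0 ≤ C' ∧ (∀ v, ‖T' v‖ ≤ C' * ‖e v‖) ∧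
      ∀ v, (T' v : EuclideanSpace ℝ (Fin d) →ₘ[μ] ℝ) = T v := by
  obtain ⟨C', hC', hle⟩ := hT.exists_eLpNorm_le D hp hp'
  have hTv : ∀ v : boundedH1 n μ, eLpNorm (T v) p μ ≤ ENNReal.ofReal C' * eLpNorm (e v) p μ := by
    intro v
    obtain ⟨Λ, hΛ⟩ := v.2
    rw [he]
    exact hle v Λ hΛ
  refine ⟨lpLift p (lpIncl 1 ∘ₗ T ∘ₗ (boundedH1 n μ).subtype) fun v =>
    Lp.mem_Lp_iff_eLpNorm_lt_top.2
      ((hTv v).trans_lt (ENNReal.mul_lt_top ENNReal.ofReal_lt_top (Lp.eLpNorm_lt_top _))),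
    C', hC', fun v => ?_, fun _ => rfl⟩
  rw [Lp.norm_def, Lp.norm_def]
  have h := ENNReal.toReal_mono (ENNReal.mul_ne_top ENNReal.ofReal_ne_top (Lp.eLpNorm_ne_top _))
    (hTv v)
  rwa [ENNReal.toReal_mul, ENNReal.toReal_ofReal hC'] at h

/-- The coefficient of the constant function is determined by the mean. -/
theorem exists_abs_le_norm_add_smul [IsLocallyFiniteMeasure μ] [NeZero μ] {p : ℝ≥0∞}
    [Fact (1 ≤ p)] {w : Lp ℝ p μ} (hw : IsUnitOrZero w) {e : boundedH1 n μ →ₗ[ℝ] Lp ℝ p μ}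
    (he : ∀ v, (e v : EuclideanSpace ℝ (Fin d) →ₘ[μ] ℝ) = (v : H1atb n μ))
    (hfin : μ Set.univ < ∞) :
    ∃ M : ℝ, 0 ≤ M ∧ ∀ (v : boundedH1 n μ) (c : ℝ), |c| ≤ M * ‖e v + c • w‖ := by
  have : IsFiniteMeasure μ := ⟨hfin⟩
  obtain ⟨M, hM, h⟩ := exists_abs_average_le (μ := μ) (p := p) hfin
  refine ⟨M, hM, fun v c => ?_⟩
  have h2 : ⨍ x, (e v + c • w : Lp ℝ p μ) x ∂μ = c := by
    have h3 : (e v + c • w : Lp ℝ p μ) =ᵐ[μ] fun x => e v x + c := by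
      filter_upwards [Lp.coeFn_add (e v) (c • w), Lp.coeFn_smul c w, hw.1 hfin] with x h4 h5 h6
      rw [h4, Pi.add_apply, h5, Pi.smul_apply, h6, smul_eq_mul, mul_one]
    obtain ⟨s, hs⟩ := (v : H1atb n μ).2
    rw [← he] at hs
    have h4 : ∫ x, e v x ∂μ = 0 := hs.integrable_and.2.2
    have h5 : Integrable (e v) μ := hs.integrable_and.1
    rw [average_congr h3, average_eq, integral_add h5 (integrable_const c), h4, zero_add,
      integral_const, smul_eq_mul, smul_eq_mul]
    refine inv_mul_cancel_left₀ ?_ c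
    exact (ENNReal.toReal_pos (Measure.measure_univ_pos.2 (NeZero.ne μ)).ne' hfin.ne).ne'
  have h3 := h (e v + c • w)
  rwa [h2] at h3

/-- Continuous extension of `T'` along `e`, with the value `h` prescribed at `w`. -/
theorem exists_extension_of_dense {V X Y : Type*} [AddCommMonoid V] [Module ℝ V]
    [NormedAddCommGroup X] [NormedSpace ℝ X] [NormedAddCommGroup Y] [NormedSpace ℝ Y]
    [CompleteSpace Y] {e : V →ₗ[ℝ] X} {T' : V →ₗ[ℝ] Y} {C M : ℝ} {w : X} {h : Y} (hC : 0 ≤ C)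
    (hT' : ∀ v, ‖T' v‖ ≤ C * ‖e v‖)
    (hM : ∀ (v : V) (c : ℝ), |c| * (‖w‖ + ‖h‖) ≤ M * ‖e v + c • w‖)
    (hdense : ∀ (x : X) (ε : ℝ), 0 < ε → ∃ (v : V) (c : ℝ), ‖x - (e v + c • w)‖ ≤ ε) :
    ∃ S : X →L[ℝ] Y, S w = h ∧ ∀ v, S (e v) = T' v := by
  let _ : AddCommGroup V := Module.addCommMonoidToAddCommGroup ℝ
  set E : V × ℝ →ₗ[ℝ] X := e.coprod (LinearMap.toSpanSingleton ℝ _ w) with hE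
  set F : V × ℝ →ₗ[ℝ] Y := T'.coprod (LinearMap.toSpanSingleton ℝ _ h) with hF
  have hEx : ∀ v c, E (v, c) = e v + c • w := fun v c => by
    rw [hE, LinearMap.coprod_apply, LinearMap.toSpanSingleton_apply]
  have hFx : ∀ v c, F (v, c) = T' v + c • h := fun v c => by
    rw [hF, LinearMap.coprod_apply, LinearMap.toSpanSingleton_apply]
  have hbound : ∀ z, ‖F z‖ ≤ (C * (1 + M) + M) * ‖E z‖ := by
    rintro ⟨v, c⟩
    rw [hEx, hFx]
    have h2 : ‖T' v + c • h‖ ≤ C * ‖e v‖ + |c| * ‖h‖ := by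
      refine (norm_add_le _ _).trans (add_le_add (hT' v) ?_)
      rw [norm_smul, Real.norm_eq_abs]
    have h3 : ‖e v‖ ≤ ‖e v + c • w‖ + |c| * ‖w‖ := by
      have h4 := norm_sub_le (e v + c • w) (c • w)
      rwa [add_sub_cancel_right, norm_smul, Real.norm_eq_abs] at h4
    have h4 := hM v c
    have h5 : 0 ≤ |c| * ‖w‖ := by positivity
    have h6 : 0 ≤ |c| * ‖h‖ := by positivity
    have h7 : C * ‖e v‖ ≤ C * (‖e v + c • w‖ + M * ‖e v + c • w‖) :=
      mul_le_mul_of_nonneg_left (by linarith) hC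
    linarith
  have hdense' : DenseRange E := by
    intro x
    refine Metric.mem_closure_iff.2 fun ε hε => ?_
    obtain ⟨v, c, h⟩ := hdense x (ε / 2) (half_pos hε)
    refine ⟨E (v, c), ⟨_, rfl⟩, ?_⟩
    rw [dist_eq_norm, hEx]
    linarith
  have hS := LinearMap.extendOfNorm_eq (f := F) hdense' ⟨_, hbound⟩
  refine ⟨F.extendOfNorm E, ?_, fun v => ?_⟩
  · have h2 := hS (0, 1)
    rwa [hEx, hFx, map_zero, map_zero, zero_add, zero_add, one_smul, one_smul] at h2
  · have h2 := hS (v, 0)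
    rwa [hEx, hFx, zero_smul, zero_smul, add_zero, add_zero] at h2

/-- The operator on bounded sums of atomic blocks extends to `L^p`, and the value at the constant
function `1`, if that lies in `L^p`, can be prescribed. -/
theorem EndpointBounds.exists_extension [IsLocallyFiniteMeasure μ] [NeZero μ]
    (D : GrowthData n μ β G) {T : H1atb n μ →ₗ[ℝ] Lp ℝ 1 μ} {C : ℝ}
    (hT : EndpointBounds n β μ T C) {p : ℝ≥0∞} [Fact (1 ≤ p)] (hp : 1 < p) (hp' : p < ∞)
    {w h₁ : Lp ℝ p μ} (hw : IsUnitOrZero w) (hh₁ : ¬μ Set.univ < ∞ → h₁ = 0) :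
    ∃ S : Lp ℝ p μ →L[ℝ] Lp ℝ p μ, S w = h₁ ∧
      ∀ (u : Lp ℝ p μ) (v : boundedH1 n μ),
        (u : EuclideanSpace ℝ (Fin d) →ₘ[μ] ℝ) = (v : H1atb n μ) →
        (S u : EuclideanSpace ℝ (Fin d) →ₘ[μ] ℝ) = T v := by
  obtain ⟨e, he⟩ := exists_lp_inclusion (n := n) (μ := μ) hp hp'
  obtain ⟨T', C', hC', hT'le, hT'⟩ := hT.exists_lp_operator D hp hp' he
  obtain ⟨M, hM⟩ : ∃ M : ℝ, ∀ (v : boundedH1 n μ) (c : ℝ),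
      |c| * (‖w‖ + ‖h₁‖) ≤ M * ‖e v + c • w‖ := by
    by_cases hfin : μ Set.univ < ∞
    · obtain ⟨M, -, h⟩ := exists_abs_le_norm_add_smul hw he hfin
      refine ⟨M * (‖w‖ + ‖h₁‖), fun v c => ?_⟩
      rw [mul_right_comm]
      exact mul_le_mul_of_nonneg_right (h v c) (by positivity)
    · refine ⟨0, fun v c => ?_⟩
      rw [hw.2 hfin, hh₁ hfin, norm_zero, add_zero, mul_zero, zero_mul]
  obtain ⟨S, hSw, hS⟩ := exists_extension_of_dense (w := w) (h := h₁) hC' hT'le hM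
    fun u ε hε => D.exists_norm_sub_lt hp hp' hw e he u hε
  refine ⟨S, hSw, fun u v huv => ?_⟩
  have h3 : u = e v := Subtype.ext (huv.trans (he v).symm)
  rw [h3, hS, hT']

/-- The extension agrees with the operator on the whole of `L^p ∩ H^{1,∞}_{atb}`, as the functions
in this intersection are limits of bounded ones in both spaces. -/
theorem EndpointBounds.extension_eq [IsLocallyFiniteMeasure μ] [NeZero μ]
    (D : GrowthData n μ β G) {T : H1atb n μ →ₗ[ℝ] Lp ℝ 1 μ} {C : ℝ}
    (hT : EndpointBounds n β μ T C) {p : ℝ≥0∞} [Fact (1 ≤ p)] (hp : 1 < p) (hp' : p < ∞)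
    {S : Lp ℝ p μ →L[ℝ] Lp ℝ p μ} (hS : ∀ (u : Lp ℝ p μ) (v : boundedH1 n μ),
      (u : EuclideanSpace ℝ (Fin d) →ₘ[μ] ℝ) = (v : H1atb n μ) →
        (S u : EuclideanSpace ℝ (Fin d) →ₘ[μ] ℝ) = T v) (u : Lp ℝ p μ) (f : H1atb n μ)
    (huf : (u : EuclideanSpace ℝ (Fin d) →ₘ[μ] ℝ) = f) :
    (S u : EuclideanSpace ℝ (Fin d) →ₘ[μ] ℝ) = T f := by
  have hum : MemLp u p μ := Lp.memLp u
  obtain ⟨b, s, Λ, hb, hs, hbn, hbΛ⟩ := D.exists_bounded_add_small hp hp'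
    (Lp.stronglyMeasurable u).measurable hum
  have hmem : ∀ K, f - (hb K).toH1atb ∈ boundedH1 n μ := by
    intro K
    refine ⟨Λ K, ?_⟩
    filter_upwards [hbΛ K, (hb K).coeFn_toH1atb, AEEqFun.coeFn_sub
      (f : EuclideanSpace ℝ (Fin d) →ₘ[μ] ℝ) (hb K).toH1atb] with x h1 h2 h3
    rw [Submodule.coe_sub, h3, Pi.sub_apply, h2, ← huf]
    exact h1
  set v : ℕ → boundedH1 n μ := fun K => ⟨_, hmem K⟩ with hv
  set uv : ℕ → Lp ℝ p μ := fun K =>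
    ⟨(v K : H1atb n μ), Lp.mem_Lp_iff_eLpNorm_lt_top.2 (memLp_of_mem_boundedH1 hp hp' (v K)).2⟩
    with huv
  have huvlim : Tendsto uv atTop (𝓝 u) := by
    rw [Lp.tendsto_Lp_iff_tendsto_eLpNorm']
    refine hbn.congr fun K => ?_
    rw [← eLpNorm_neg (f := b K)]
    refine eLpNorm_congr_ae ?_
    filter_upwards [(hb K).coeFn_toH1atb, AEEqFun.coeFn_sub
      (f : EuclideanSpace ℝ (Fin d) →ₘ[μ] ℝ) (hb K).toH1atb] with x h2 h3
    have h4 : uv K x = u x - b K x := by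
      rw [← h2]
      change (((f - (hb K).toH1atb : H1atb n μ) : EuclideanSpace ℝ (Fin d) →ₘ[μ] ℝ)) x = _
      rw [Submodule.coe_sub, h3, Pi.sub_apply, ← huf]
    rw [Pi.sub_apply, h4, Pi.neg_apply]
    ring
  have hSlim := (S.continuous.tendsto u).comp huvlim
  have hTlim : Tendsto (fun K => T (v K)) atTop (𝓝 (T f)) := by
    rw [tendsto_iff_norm_sub_tendsto_zero]
    have h1 := hs.const_mul C
    rw [mul_zero] at h1
    refine squeeze_zero (fun _ => norm_nonneg _) (fun K => ?_) h1
    have h2 : T (v K) - T f = -T (hb K).toH1atb := by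
      rw [hv, map_sub, sub_sub_cancel_left]
    rw [h2, norm_neg]
    exact hT.norm_le _ _ ((hb K).congr (hb K).coeFn_toH1atb.symm)
  refine AEEqFun.ext (tendstoInMeasure_ae_unique (tendstoInMeasure_of_tendsto_Lp hSlim) ?_)
  refine (tendstoInMeasure_of_tendsto_Lp hTlim).congr (fun K => ?_) (ae_eq_refl _)
  rw [Function.comp_apply, hS (uv K) (v K) rfl]

/-! ### Agreement with the operator on bounded functions -/

theorem MemRBMO.rbmoBound_of_lt {h : EuclideanSpace ℝ (Fin d) → ℝ} (hh : MemRBMO n β μ h) {σ : ℝ}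
    (hσ : rbmoNorm n β μ h < σ) : RBMOBound n β μ h σ := by
  obtain ⟨σ', hσ', hlt⟩ := exists_lt_of_csInf_lt hh hσ
  exact RBMOBound.mono hσ' hlt.le

theorem ae_abs_le_norm (g : Lp ℝ ∞ μ) : ∀ᵐ x ∂μ, |g x| ≤ ‖g‖ := by
  filter_upwards [ae_le_eLpNormEssSup (f := g) (μ := μ)] with x hx
  rw [Lp.norm_def, eLpNorm_exponent_top, ← Real.norm_eq_abs, ← toReal_enorm]
  refine ENNReal.toReal_mono ?_ hx
  rw [← eLpNorm_exponent_top]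
  exact Lp.eLpNorm_ne_top g

theorem norm_le_of_ae_abs_le {g : Lp ℝ ∞ μ} {l : ℝ} (hl : 0 ≤ l) (hg : ∀ᵐ x ∂μ, |g x| ≤ l) :
    ‖g‖ ≤ l := by
  rw [Lp.norm_def, eLpNorm_exponent_top]
  exact ENNReal.toReal_le_of_le_ofReal hl (eLpNormEssSup_le_of_ae_bound hg)

theorem exists_lp_top {f : EuclideanSpace ℝ (Fin d) →ₘ[μ] ℝ} {l : ℝ} (hl : 0 ≤ l)
    (hf : ∀ᵐ x ∂μ, |f x| ≤ l) :
    ∃ g : Lp ℝ ∞ μ, (g : EuclideanSpace ℝ (Fin d) →ₘ[μ] ℝ) = f ∧ ‖g‖ ≤ l := by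
  have h1 : eLpNorm f ∞ μ ≤ ENNReal.ofReal l := by
    rw [eLpNorm_exponent_top]
    exact eLpNormEssSup_le_of_ae_bound hf
  exact ⟨⟨f, Lp.mem_Lp_iff_eLpNorm_lt_top.2 (h1.trans_lt ENNReal.ofReal_lt_top)⟩, rfl,
    norm_le_of_ae_abs_le hl hf⟩

/-- The boundedness of an operator from `L^∞` into `RBMO`, for the representatives of its values. -/
structure RBMOOperator (n : ℕ) (β : ℝ) (μ : Measure (EuclideanSpace ℝ (Fin d)))
    (T₂ : Lp ℝ ∞ μ →ₗ[ℝ] (EuclideanSpace ℝ (Fin d) →ₘ[μ] ℝ) ⧸ constants μ) (C : ℝ) : Prop where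
  pos : 0 < C
  rbmoBound : ∀ (g : Lp ℝ ∞ μ) (h : EuclideanSpace ℝ (Fin d) →ₘ[μ] ℝ) (l : ℝ), 0 < l →
    (constants μ).mkQ h = T₂ g → ‖g‖ ≤ l → RBMOBound n β μ h (C * l)

theorem exists_rbmoOperator
    {T₂ : Lp ℝ ∞ μ →ₗ[ℝ] (EuclideanSpace ℝ (Fin d) →ₘ[μ] ℝ) ⧸ constants μ}
    (hT₂ : ∃ C : ℝ, ∀ (g : Lp ℝ ∞ μ) (h : EuclideanSpace ℝ (Fin d) →ₘ[μ] ℝ),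
      (constants μ).mkQ h = T₂ g → MemRBMO n β μ h ∧ rbmoNorm n β μ h ≤ C * ‖g‖) :
    ∃ C, RBMOOperator n β μ T₂ C := by
  obtain ⟨C, hC⟩ := hT₂
  refine ⟨|C| + 1, by positivity, fun g h l hl hh hg => ?_⟩
  refine (hC g h hh).1.rbmoBound_of_lt ((hC g h hh).2.trans_lt ?_)
  have h1 : C * ‖g‖ ≤ |C| * l :=
    mul_le_mul (le_abs_self C) hg (norm_nonneg _) (abs_nonneg C)
  linarith

theorem exists_endpointBounds {T₁ : H1atb n μ →ₗ[ℝ] Lp ℝ 1 μ}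
    {T₂ : Lp ℝ ∞ μ →ₗ[ℝ] (EuclideanSpace ℝ (Fin d) →ₘ[μ] ℝ) ⧸ constants μ} {C₂ : ℝ}
    (hT : ∀ (f : H1atb n μ) (g : Lp ℝ ∞ μ),
      (f : EuclideanSpace ℝ (Fin d) →ₘ[μ] ℝ) = (g : EuclideanSpace ℝ (Fin d) →ₘ[μ] ℝ) →
        (constants μ).mkQ (T₁ f : EuclideanSpace ℝ (Fin d) →ₘ[μ] ℝ) = T₂ g)
    (hT₁ : ∃ C : ℝ, ∀ f : H1atb n μ,
      ‖T₁ f‖ ≤ C * atbNorm n μ (f : EuclideanSpace ℝ (Fin d) →ₘ[μ] ℝ))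
    (hT₂ : RBMOOperator n β μ T₂ C₂) : ∃ C, EndpointBounds n β μ T₁ C := by
  obtain ⟨C₁, hC₁⟩ := hT₁
  have hC₂ := hT₂.pos
  refine ⟨|C₁| + C₂, by positivity, fun f s hs => ?_, fun f l hl hf => ?_⟩
  · have h0 : ∀ t ∈ {s : ℝ | HasAtomicBlockSum n μ (f : EuclideanSpace ℝ (Fin d) →ₘ[μ] ℝ) s},
        0 ≤ t := fun t ht => HasAtomicBlockSum.nonneg ht
    have h1 : atbNorm n μ (f : EuclideanSpace ℝ (Fin d) →ₘ[μ] ℝ) ≤ s := csInf_le ⟨0, h0⟩ hs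
    have h2 : 0 ≤ atbNorm n μ (f : EuclideanSpace ℝ (Fin d) →ₘ[μ] ℝ) := Real.sInf_nonneg h0
    calc ‖T₁ f‖ ≤ C₁ * atbNorm n μ (f : EuclideanSpace ℝ (Fin d) →ₘ[μ] ℝ) := hC₁ f
      _ ≤ |C₁| * s := mul_le_mul (le_abs_self _) h1 h2 (abs_nonneg _)
      _ ≤ (|C₁| + C₂) * s :=
          mul_le_mul_of_nonneg_right (le_add_of_nonneg_right hC₂.le) hs.nonneg
  · obtain ⟨g, hgf, hg⟩ := exists_lp_top hl.le hf
    refine (hT₂.rbmoBound g _ l hl (hT f g hgf.symm) hg).mono ?_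
    exact mul_le_mul_of_nonneg_right (le_add_of_nonneg_left (abs_nonneg _)) hl.le

/-- For a finite measure, functions in `RBMO` lie in every `L^p`. -/
theorem RBMOBound.memLp [IsLocallyFiniteMeasure μ] [NeZero μ] (D : GrowthData n μ β G)
    (hfin : μ Set.univ < ∞) {h : EuclideanSpace ℝ (Fin d) → ℝ} {σ : ℝ}
    (hh : RBMOBound n β μ h σ) (hhm : AEStronglyMeasurable h μ) {p : ℝ≥0∞} (hp : 1 < p)
    (hp' : p < ∞) : MemLp h p μ := by
  have hq := one_lt_toReal hp hp'
  have hi : Integrable h μ := by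
    have h1 := (hh.oscillation Cube.whole hfin).1
    rwa [Cube.toSet, integrableOn_univ] at h1
  have hpos : 0 < μ.real Set.univ :=
    ENNReal.toReal_pos (Measure.measure_univ_pos.2 (NeZero.ne μ)).ne' hfin.ne
  set A := ∫ x, |h x| ∂μ with hA
  have hA0 : 0 ≤ A := integral_nonneg fun _ => abs_nonneg _
  have hσ := hh.nonneg
  obtain ⟨C, -, hC⟩ := D.exists_lintegral_rpow_le hq.le
  have h1 := hC h (σ + A / μ.real Set.univ + 1) A ⟨hh.mono (by
    have := div_nonneg hA0 hpos.le
    linarith), by positivity, hi, le_rfl, ?_⟩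
  · refine ⟨hhm, ?_⟩
    rw [eLpNorm_eq_lintegral_ofReal hp hp']
    exact ENNReal.rpow_lt_top_of_nonneg (by positivity)
      (ne_top_of_le_ne_top ENNReal.ofReal_ne_top h1)
  · have h2 : μ Set.univ = ENNReal.ofReal (μ.real Set.univ) := (ENNReal.ofReal_toReal hfin.ne).symm
    rw [h2, ← ENNReal.ofReal_mul (by positivity)]
    refine ENNReal.ofReal_le_ofReal ?_
    calc A = A / μ.real Set.univ * μ.real Set.univ := (div_mul_cancel₀ _ hpos.ne').symm
      _ ≤ _ := mul_le_mul_of_nonneg_right (by linarith) hpos.le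

/-- A local limit of functions whose `RBMO` bounds tend to zero is constant. -/
theorem exists_ae_eq_const [IsLocallyFiniteMeasure μ] [NeZero μ]
    {h : ℕ → EuclideanSpace ℝ (Fin d) → ℝ} {σ : ℕ → ℝ} {H : EuclideanSpace ℝ (Fin d) → ℝ}
    (hh : ∀ k, RBMOBound n β μ (h k) (σ k)) (hσ : Tendsto σ atTop (𝓝 0))
    (hH : AEStronglyMeasurable H μ)
    (hlim : ∀ x j, Tendsto (fun k => ∫⁻ y in dset x j, ‖H y - h k y‖ₑ ∂μ) atTop (𝓝 0)) :
    ∃ c : ℝ, H =ᵐ[μ] fun _ => c := by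
  obtain ⟨x, hx⟩ := μ.nonempty_support (NeZero.ne μ)
  have hQ : ∀ j : ℤ, ∃ m : ℝ, ∀ᵐ y ∂(μ.restrict (dset x j)), H y = m := by
    intro j
    set ν := μ.restrict (dset x j) with hν
    have hνfin : IsFiniteMeasure ν := ⟨by
      rw [hν, Measure.restrict_apply_univ]
      exact measure_dset_lt_top x j⟩
    have hν0 : ν ≠ 0 := by
      intro h0
      have h1 := mass_pos hx j
      rw [← ENNReal.ofReal_pos, ofReal_mass, ← Measure.restrict_apply_univ, ← hν, h0] at h1
      simp at h1
    set c : ℕ → ℝ := fun k => mean μ ((dyad x j).tilde β μ) (h k) with hc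
    set δ : ℕ → ℝ≥0∞ := fun k => ∫⁻ y, ‖H y - h k y‖ₑ ∂ν +
      ENNReal.ofReal (σ k * mass μ x (j + 1)) with hδ
    have hδlim : Tendsto δ atTop (𝓝 0) := by
      have h1 := ENNReal.tendsto_ofReal (hσ.mul_const (mass μ x (j + 1)))
      rw [zero_mul, ENNReal.ofReal_zero] at h1
      have h2 := (hlim x j).add h1
      rwa [add_zero] at h2
    have hhi : ∀ k, Integrable (h k) ν := fun k => (hh k).integrableOn_dset x j
    have hle : ∀ k, ∫⁻ y, ‖H y - c k‖ₑ ∂ν ≤ δ k := by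
      intro k
      have h1 : ∫⁻ y, ‖h k y - c k‖ₑ ∂ν ≤ ENNReal.ofReal (σ k * mass μ x (j + 1)) := by
        have h2 := ((hh k).oscillation (dyad x j) (admissible_dyad hx j)).2
        rw [dilate_two_dyad] at h2
        have h3 : Integrable (fun y => h k y - c k) ν := (hhi k).sub (integrable_const _)
        rw [← ofReal_integral_norm_eq_lintegral_enorm h3]
        exact ENNReal.ofReal_le_ofReal h2
      calc ∫⁻ y, ‖H y - c k‖ₑ ∂ν ≤ ∫⁻ y, (‖H y - h k y‖ₑ + ‖h k y - c k‖ₑ) ∂ν := by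
            refine lintegral_mono fun y => ?_
            have h2 := enorm_add_le (H y - h k y) (h k y - c k)
            rwa [sub_add_sub_cancel] at h2
        _ = ∫⁻ y, ‖H y - h k y‖ₑ ∂ν + ∫⁻ y, ‖h k y - c k‖ₑ ∂ν :=
            lintegral_add_left' (hH.restrict.sub (hhi k).1).enorm _
        _ ≤ δ k := add_le_add le_rfl h1
    obtain ⟨k₀, hk₀⟩ := (hδlim.eventually (gt_mem_nhds ENNReal.zero_lt_top)).exists
    have hHi : Integrable H ν := by
      have h1 : Integrable (fun y => H y - c k₀) ν :=
        ⟨hH.restrict.sub aestronglyMeasurable_const, (hle k₀).trans_lt hk₀⟩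
      refine (h1.add (integrable_const (c k₀))).congr (Eventually.of_forall fun y => ?_)
      simp
    set m := ⨍ y, H y ∂ν with hm
    have hνr : ν.real Set.univ ≠ 0 :=
      (ENNReal.toReal_pos (Measure.measure_univ_ne_zero.2 hν0) (measure_ne_top _ _)).ne'
    have hmk : ∀ k, ∫⁻ _, ‖m - c k‖ₑ ∂ν ≤ δ k := by
      intro k
      refine le_trans ?_ (hle k)
      have h1 : ∫ y, (H y - c k) ∂ν = ν.real Set.univ * (m - c k) := by
        rw [integral_sub hHi (integrable_const _), integral_const, hm, average_eq, smul_eq_mul,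
          smul_eq_mul, mul_sub, mul_inv_cancel_left₀ hνr]
      have h2 := enorm_integral_le_lintegral_enorm (μ := ν) fun y => H y - c k
      refine le_trans (le_of_eq ?_) h2
      rw [h1, lintegral_const, enorm_mul, Real.enorm_eq_ofReal measureReal_nonneg, measureReal_def,
        ENNReal.ofReal_toReal (measure_ne_top _ _), mul_comm]
    have hzero : ∫⁻ y, ‖H y - m‖ₑ ∂ν = 0 := by
      have h1 : ∀ k, ∫⁻ y, ‖H y - m‖ₑ ∂ν ≤ δ k + δ k := by
        intro k
        calc ∫⁻ y, ‖H y - m‖ₑ ∂ν ≤ ∫⁻ y, (‖H y - c k‖ₑ + ‖m - c k‖ₑ) ∂ν := by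
              refine lintegral_mono fun y => ?_
              have h2 := enorm_sub_le (a := H y - c k) (b := m - c k)
              rwa [sub_sub_sub_cancel_right] at h2
          _ = ∫⁻ y, ‖H y - c k‖ₑ ∂ν + ∫⁻ _, ‖m - c k‖ₑ ∂ν :=
              lintegral_add_right _ measurable_const
          _ ≤ δ k + δ k := add_le_add (hle k) (hmk k)
      have h2 := hδlim.add hδlim
      rw [add_zero] at h2
      exact le_antisymm (ge_of_tendsto' h2 h1) zero_le
    refine ⟨m, ?_⟩
    have hHm : AEStronglyMeasurable (fun y => H y - m) ν :=
      hH.restrict.sub aestronglyMeasurable_const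
    rw [lintegral_eq_zero_iff' hHm.enorm] at hzero
    filter_upwards [hzero] with y hy
    rw [Pi.zero_apply, enorm_eq_zero, sub_eq_zero] at hy
    exact hy
  choose m hm using fun j : ℕ => hQ j
  have hm0 : ∀ j, m j = m 0 := by
    intro j
    have h1 : ∀ᵐ y ∂(μ.restrict (dset x ((0 : ℕ) : ℤ))), H y = m j :=
      ae_mono (Measure.restrict_mono (dset_mono (by omega)) le_rfl) (hm j)
    have hne : (ae (μ.restrict (dset x ((0 : ℕ) : ℤ)))).NeBot := by
      rw [ae_neBot]
      intro h0
      have h1 := mass_pos hx ((0 : ℕ) : ℤ)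
      rw [← ENNReal.ofReal_pos, ofReal_mass, ← Measure.restrict_apply_univ, h0] at h1
      simp at h1
    obtain ⟨y, h2, h3⟩ := (h1.and (hm 0)).exists
    rw [← h2, h3]
  refine ⟨m 0, ?_⟩
  have h1 : ∀ᵐ y ∂μ, ∀ j : ℕ, y ∈ dset x (j : ℤ) → H y = m j :=
    ae_all_iff.2 fun j => (ae_restrict_iff' (measurableSet_dset _ _)).1 (hm j)
  filter_upwards [h1] with y hy
  have h2 : y ∈ ⋃ j : ℕ, dset x (j : ℤ) := by
    rw [iUnion_dset]
    exact Set.mem_univ y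
  obtain ⟨j, hj⟩ := Set.mem_iUnion.1 h2
  rw [hy j hj, hm0]

theorem setLIntegral_enorm_le [IsLocallyFiniteMeasure μ] {p : ℝ≥0∞} (hp : 1 ≤ p)
    (x : EuclideanSpace ℝ (Fin d)) (j : ℤ) {f : EuclideanSpace ℝ (Fin d) → ℝ}
    (hf : AEStronglyMeasurable f μ) :
    ∫⁻ y in dset x j, ‖f y‖ₑ ∂μ ≤
      eLpNorm f p μ * μ (dset x j) ^ (1 / (1 : ℝ≥0∞).toReal - 1 / p.toReal) := by
  have h := eLpNorm_le_eLpNorm_mul_rpow_measure_univ (μ := μ.restrict (dset x j)) hp hf.restrict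
  rw [eLpNorm_one_eq_lintegral_enorm, Measure.restrict_apply_univ] at h
  exact h.trans (mul_le_mul_left (eLpNorm_restrict_le _ _ _ _) _)

theorem mkQ_eq_of_ae_eq_add_const {f g : EuclideanSpace ℝ (Fin d) →ₘ[μ] ℝ} {c : ℝ}
    (h : (f - g : EuclideanSpace ℝ (Fin d) →ₘ[μ] ℝ) =ᵐ[μ] fun _ => c) :
    (constants μ).mkQ f = (constants μ).mkQ g := by
  rw [← sub_eq_zero, ← map_sub, Submodule.mkQ_apply, Submodule.Quotient.mk_eq_zero]
  refine Submodule.mem_span_singleton.2 ⟨c, AEEqFun.ext ?_⟩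
  filter_upwards [h, AEEqFun.coeFn_smul c (AEEqFun.const (μ := μ) (EuclideanSpace ℝ (Fin d)) (1 : ℝ)),
    AEEqFun.coeFn_const (μ := μ) (EuclideanSpace ℝ (Fin d)) (1 : ℝ)] with x h1 h2 h3
  rw [h1, h2, Pi.smul_apply, h3, Function.const_apply, smul_eq_mul, mul_one]

/-- Agreement of the extension with the operator on `L^∞`, for infinite measures. A bounded
function in `L^p` is approximated both in `L^p` and uniformly by bounded sums of atomic blocks. -/
theorem mkQ_extension_eq_of_infinite [IsLocallyFiniteMeasure μ] [NeZero μ]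
    (D : GrowthData n μ β G) {T₁ : H1atb n μ →ₗ[ℝ] Lp ℝ 1 μ}
    {T₂ : Lp ℝ ∞ μ →ₗ[ℝ] (EuclideanSpace ℝ (Fin d) →ₘ[μ] ℝ) ⧸ constants μ} {C : ℝ}
    (hT : ∀ (f : H1atb n μ) (g : Lp ℝ ∞ μ),
      (f : EuclideanSpace ℝ (Fin d) →ₘ[μ] ℝ) = (g : EuclideanSpace ℝ (Fin d) →ₘ[μ] ℝ) →
        (constants μ).mkQ (T₁ f : EuclideanSpace ℝ (Fin d) →ₘ[μ] ℝ) = T₂ g)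
    (hT₂ : RBMOOperator n β μ T₂ C) {p : ℝ≥0∞} [Fact (1 ≤ p)] (hp : 1 < p) (hp' : p < ∞)
    {S : Lp ℝ p μ →L[ℝ] Lp ℝ p μ} (hS : ∀ (u : Lp ℝ p μ) (v : boundedH1 n μ),
      (u : EuclideanSpace ℝ (Fin d) →ₘ[μ] ℝ) = (v : H1atb n μ) →
        (S u : EuclideanSpace ℝ (Fin d) →ₘ[μ] ℝ) = T₁ v) (hfin : ¬μ Set.univ < ∞)
    (u : Lp ℝ p μ) (g : Lp ℝ ∞ μ)
    (hug : (u : EuclideanSpace ℝ (Fin d) →ₘ[μ] ℝ) = (g : EuclideanSpace ℝ (Fin d) →ₘ[μ] ℝ)) :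
    (constants μ).mkQ (S u : EuclideanSpace ℝ (Fin d) →ₘ[μ] ℝ) = T₂ g := by
  have hubd : ∀ᵐ x ∂μ, |u x| ≤ ‖g‖ := by
    rw [hug]
    exact ae_abs_le_norm g
  have hε : ∀ k : ℕ, 0 < 1 / ((k : ℝ) + 1) := fun k => by positivity
  choose c s hc hcabs hcn using fun k : ℕ => D.exists_approximation hp hp'
    (Lp.stronglyMeasurable u).measurable (Lp.memLp u) hubd (fun h => absurd h hfin) (hε k)
  have hmem : ∀ k, (hc k).toH1atb ∈ boundedH1 n μ := by
    intro k
    refine ⟨‖g‖ + 1 / ((k : ℝ) + 1), ?_⟩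
    filter_upwards [(hc k).coeFn_toH1atb, hubd, hcabs k] with x h1 h2 h3
    rw [h1]
    have h4 := abs_sub (u x) (u x - c k x)
    rw [sub_sub_cancel] at h4
    exact h4.trans (add_le_add h2 h3)
  obtain ⟨v, hv⟩ : ∃ v : ℕ → boundedH1 n μ, ∀ k, (v k : H1atb n μ) = (hc k).toH1atb :=
    ⟨fun k => ⟨_, hmem k⟩, fun _ => rfl⟩
  have hvc : ∀ k, ((v k : H1atb n μ) : EuclideanSpace ℝ (Fin d) →ₘ[μ] ℝ) =ᵐ[μ] c k := fun k => by
    rw [hv]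
    exact (hc k).coeFn_toH1atb
  obtain ⟨e, he⟩ := exists_lp_inclusion (n := n) (μ := μ) hp hp'
  have helim : Tendsto (fun k => e (v k)) atTop (𝓝 u) := by
    rw [tendsto_iff_norm_sub_tendsto_zero]
    refine squeeze_zero (fun _ => norm_nonneg _) (fun k => ?_)
      tendsto_one_div_add_atTop_nhds_zero_nat
    rw [norm_sub_rev, Lp.norm_def]
    refine ENNReal.toReal_le_of_le_ofReal (hε k).le (le_trans (le_of_eq ?_) (hcn k))
    refine eLpNorm_congr_ae ?_
    have h1 := hvc k
    rw [← he] at h1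
    filter_upwards [Lp.coeFn_sub u (e (v k)), h1] with x h2 h3
    rw [h2, Pi.sub_apply, h3]
  have hSlim := (S.continuous.tendsto u).comp helim
  obtain ⟨h, hh⟩ := (constants μ).mkQ_surjective (T₂ g)
  rw [← hh]
  -- differences of representatives have small `RBMO` bounds
  have hbd : ∀ k, RBMOBound n β μ
      (T₁ (v k) - h : EuclideanSpace ℝ (Fin d) →ₘ[μ] ℝ) (C * (1 / ((k : ℝ) + 1))) := by
    intro k
    obtain ⟨Λ, hΛ⟩ := (v k).2
    have hΛ' : ∀ᵐ x ∂μ, |((v k : H1atb n μ) : EuclideanSpace ℝ (Fin d) →ₘ[μ] ℝ) x| ≤ max Λ 0 := by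
      filter_upwards [hΛ] with x hx
      exact hx.trans (le_max_left _ _)
    obtain ⟨gv, hgv, -⟩ := exists_lp_top (le_max_right _ _) hΛ'
    refine hT₂.rbmoBound (gv - g) _ _ (hε k) ?_ ?_
    · rw [map_sub, map_sub, hT _ gv hgv.symm, hh]
    · refine norm_le_of_ae_abs_le (hε k).le ?_
      have h1 := hvc k
      rw [← hgv] at h1
      have h5 : u =ᵐ[μ] g := by rw [hug]
      filter_upwards [Lp.coeFn_sub gv g, h1, hcabs k, h5] with x h2 h3 h4 h6
      rw [h2, Pi.sub_apply, h3, ← h6, abs_sub_comm]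
      exact h4
  have hσ : Tendsto (fun k : ℕ => C * (1 / ((k : ℝ) + 1))) atTop (𝓝 0) := by
    have h1 := (tendsto_one_div_add_atTop_nhds_zero_nat (𝕜 := ℝ)).const_mul C
    rwa [mul_zero] at h1
  obtain ⟨c₀, hc₀⟩ := exists_ae_eq_const hbd hσ
    (H := (S u - h : EuclideanSpace ℝ (Fin d) →ₘ[μ] ℝ)) (AEEqFun.aestronglyMeasurable _)
    fun x j => by
      have h1 := (Lp.tendsto_Lp_iff_tendsto_eLpNorm' _ _).1 hSlim
      have h2 := ENNReal.Tendsto.mul_const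
        (b := μ (dset x j) ^ (1 / (1 : ℝ≥0∞).toReal - 1 / p.toReal)) h1
        (Or.inr (ENNReal.rpow_ne_top_of_nonneg (by
          rw [ENNReal.toReal_one, sub_nonneg]
          exact one_div_le_one_div_of_le one_pos (one_lt_toReal hp hp').le)
          (measure_dset_ne_top x j)))
      rw [zero_mul] at h2
      refine tendsto_of_tendsto_of_tendsto_of_le_of_le tendsto_const_nhds h2 (fun _ => zero_le)
        fun k => ?_
      refine le_trans (le_of_eq (lintegral_congr_ae (ae_restrict_of_ae ?_)))
        (setLIntegral_enorm_le hp.le x j ((Lp.aestronglyMeasurable _).sub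
          (Lp.aestronglyMeasurable _)))
      filter_upwards [AEEqFun.coeFn_sub (S u : EuclideanSpace ℝ (Fin d) →ₘ[μ] ℝ) h,
        AEEqFun.coeFn_sub (T₁ (v k) : EuclideanSpace ℝ (Fin d) →ₘ[μ] ℝ) h] with y h3 h4
      rw [h3, h4, Function.comp_apply, Pi.sub_apply, Pi.sub_apply, Pi.sub_apply,
        hS (e (v k)) (v k) (he _), sub_sub_sub_cancel_right, ← enorm_neg, neg_sub]
  exact mkQ_eq_of_ae_eq_add_const hc₀

/-- Agreement of the extension with the operator on `L^∞`, for finite measures. -/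
theorem mkQ_extension_eq_of_finite [IsLocallyFiniteMeasure μ] [NeZero μ]
    {T₁ : H1atb n μ →ₗ[ℝ] Lp ℝ 1 μ}
    {T₂ : Lp ℝ ∞ μ →ₗ[ℝ] (EuclideanSpace ℝ (Fin d) →ₘ[μ] ℝ) ⧸ constants μ}
    (hT : ∀ (f : H1atb n μ) (g : Lp ℝ ∞ μ),
      (f : EuclideanSpace ℝ (Fin d) →ₘ[μ] ℝ) = (g : EuclideanSpace ℝ (Fin d) →ₘ[μ] ℝ) →
        (constants μ).mkQ (T₁ f : EuclideanSpace ℝ (Fin d) →ₘ[μ] ℝ) = T₂ g)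
    {p : ℝ≥0∞} [Fact (1 ≤ p)] (hp : 1 < p) (hp' : p < ∞)
    {S : Lp ℝ p μ →L[ℝ] Lp ℝ p μ} (hS : ∀ (u : Lp ℝ p μ) (v : boundedH1 n μ),
      (u : EuclideanSpace ℝ (Fin d) →ₘ[μ] ℝ) = (v : H1atb n μ) →
        (S u : EuclideanSpace ℝ (Fin d) →ₘ[μ] ℝ) = T₁ v) (hfin : μ Set.univ < ∞)
    {w : Lp ℝ p μ} (hw : IsUnitOrZero w) {w' : Lp ℝ ∞ μ} (hw' : IsUnitOrZero w')
    (hSw : (constants μ).mkQ (S w : EuclideanSpace ℝ (Fin d) →ₘ[μ] ℝ) = T₂ w')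
    (u : Lp ℝ p μ) (g : Lp ℝ ∞ μ)
    (hug : (u : EuclideanSpace ℝ (Fin d) →ₘ[μ] ℝ) = (g : EuclideanSpace ℝ (Fin d) →ₘ[μ] ℝ)) :
    (constants μ).mkQ (S u : EuclideanSpace ℝ (Fin d) →ₘ[μ] ℝ) = T₂ g := by
  have : IsFiniteMeasure μ := ⟨hfin⟩
  have hubd : ∀ᵐ x ∂μ, |u x| ≤ ‖g‖ := by
    rw [hug]
    exact ae_abs_le_norm g
  have hui : Integrable u μ := (Lp.memLp u).integrable hp.le
  have hyΛ := abs_centre_le (norm_nonneg g) hubd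
  have hy := hasAtomicBlockSum_of_bounded (n := n) hfin (integrable_centre hui).1
    (by positivity) hyΛ (integral_centre hui hfin)
  have hmem : hy.toH1atb ∈ boundedH1 n μ := by
    refine ⟨2 * ‖g‖, ?_⟩
    filter_upwards [hy.coeFn_toH1atb, hyΛ] with x h1 h2
    rwa [h1]
  obtain ⟨v, hv⟩ : ∃ v : boundedH1 n μ, (v : H1atb n μ) = hy.toH1atb := ⟨⟨_, hmem⟩, rfl⟩
  have hvy : ((v : H1atb n μ) : EuclideanSpace ℝ (Fin d) →ₘ[μ] ℝ) =ᵐ[μ] centre μ u := by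
    rw [hv]
    exact hy.coeFn_toH1atb
  have hvabs : ∀ᵐ x ∂μ, |((v : H1atb n μ) : EuclideanSpace ℝ (Fin d) →ₘ[μ] ℝ) x| ≤ 2 * ‖g‖ := by
    filter_upwards [hvy, hyΛ] with x h1 h2
    rwa [h1]
  obtain ⟨gv, hgv, -⟩ := exists_lp_top (by positivity) hvabs
  obtain ⟨e, he⟩ := exists_lp_inclusion (n := n) (μ := μ) hp hp'
  set m := ⨍ x, u x ∂μ with hm
  have hu : u = e v + m • w := by
    refine Lp.ext ?_
    have h1 := hvy
    rw [← he] at h1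
    filter_upwards [Lp.coeFn_add (e v) (m • w), hw.coeFn_average_smul u, h1] with x h2 h3 h4
    rw [h2, Pi.add_apply, h3, h4, centre, sub_add_cancel]
  have hg : g = gv + m • w' := by
    refine Lp.ext ?_
    have h1 := hvy
    rw [← hgv] at h1
    have h5 : u =ᵐ[μ] g := by rw [hug]
    filter_upwards [Lp.coeFn_add gv (m • w'), hw'.coeFn_average_smul u, h1, h5] with x h2 h3 h4 h6
    rw [h2, Pi.add_apply, h3, h4, centre, sub_add_cancel, h6]
  have h1 : (S u : EuclideanSpace ℝ (Fin d) →ₘ[μ] ℝ) =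
      (T₁ v : EuclideanSpace ℝ (Fin d) →ₘ[μ] ℝ) + m • (S w : EuclideanSpace ℝ (Fin d) →ₘ[μ] ℝ) := by
    rw [hu, map_add, map_smul, ← hS (e v) v (he v)]
    rfl
  rw [h1, map_add, map_smul, hSw, hT _ gv hgv.symm, hg, map_add, map_smul]

end NonDoubling

end

open NonDoubling
theorem theorem6p2 (d n : ℕ) (hn : 1 ≤ n) (hnd : n ≤ d)
    (μ : Measure (EuclideanSpace ℝ (Fin d))) [IsLocallyFiniteMeasure μ] (hμ : HasGrowth n μ)
    (β : ℝ) (hβ : 2 ^ d < β)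
    -- the operator on `H^{1,∞}_{atb}(μ)`, with values in `L^1(μ)`
    (T₁ : H1atb n μ →ₗ[ℝ] Lp ℝ 1 μ)
    -- the operator on `L^∞(μ)`, with values in functions modulo constants
    (T₂ : Lp ℝ ∞ μ →ₗ[ℝ] (EuclideanSpace ℝ (Fin d) →ₘ[μ] ℝ) ⧸ constants μ)
    -- they are restrictions of one operator
    (hT : ∀ (f : H1atb n μ) (g : Lp ℝ ∞ μ),
      (f : EuclideanSpace ℝ (Fin d) →ₘ[μ] ℝ) = (g : EuclideanSpace ℝ (Fin d) →ₘ[μ] ℝ) →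
        (constants μ).mkQ (T₁ f : EuclideanSpace ℝ (Fin d) →ₘ[μ] ℝ) = T₂ g)
    (hT₁ : ∃ C : ℝ, ∀ f : H1atb n μ,
      ‖T₁ f‖ ≤ C * atbNorm n μ (f : EuclideanSpace ℝ (Fin d) →ₘ[μ] ℝ))
    (hT₂ : ∃ C : ℝ, ∀ (g : Lp ℝ ∞ μ) (h : EuclideanSpace ℝ (Fin d) →ₘ[μ] ℝ),
      (constants μ).mkQ h = T₂ g → MemRBMO n β μ h ∧ rbmoNorm n β μ h ≤ C * ‖g‖)
    (p : ℝ≥0∞) [Fact (1 ≤ p)] (hp : 1 < p) (hp' : p < ∞) :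
    ∃ S : Lp ℝ p μ →L[ℝ] Lp ℝ p μ,
      (∀ (u : Lp ℝ p μ) (f : H1atb n μ),
        (u : EuclideanSpace ℝ (Fin d) →ₘ[μ] ℝ) = (f : EuclideanSpace ℝ (Fin d) →ₘ[μ] ℝ) →
          (S u : EuclideanSpace ℝ (Fin d) →ₘ[μ] ℝ) = (T₁ f : EuclideanSpace ℝ (Fin d) →ₘ[μ] ℝ)) ∧
      (∀ (u : Lp ℝ p μ) (g : Lp ℝ ∞ μ),
        (u : EuclideanSpace ℝ (Fin d) →ₘ[μ] ℝ) = (g : EuclideanSpace ℝ (Fin d) →ₘ[μ] ℝ) →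
          (constants μ).mkQ (S u : EuclideanSpace ℝ (Fin d) →ₘ[μ] ℝ) = T₂ g) := by
  rcases eq_or_ne μ 0 with rfl | hμ0
  · -- all functions agree almost everywhere
    have hall : ∀ f g : EuclideanSpace ℝ (Fin d) →ₘ[(0 : Measure (EuclideanSpace ℝ (Fin d)))] ℝ,
        f = g := fun f g => AEEqFun.ext (by simp [Filter.EventuallyEq])
    refine ⟨0, fun u f _ => hall _ _, fun u g _ => ?_⟩
    obtain ⟨h, hh⟩ := (constants _).mkQ_surjective (T₂ g)
    rw [← hh]
    exact congrArg _ (hall _ _)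
  have : NeZero μ := ⟨hμ0⟩
  obtain ⟨G, D⟩ := hμ.exists_growthData hn hnd hβ
  obtain ⟨C₂, hC₂⟩ := exists_rbmoOperator hT₂
  obtain ⟨C, hC⟩ := exists_endpointBounds hT hT₁ hC₂
  obtain ⟨w, hw⟩ := exists_isUnitOrZero (μ := μ) p
  obtain ⟨w', hw'⟩ := exists_isUnitOrZero (μ := μ) ∞
  obtain ⟨h, hh⟩ := (constants μ).mkQ_surjective (T₂ w')
  -- the image of the constant function `1`, if it is in `L^p`
  obtain ⟨h₁, hh₁, hh₁'⟩ : ∃ h₁ : Lp ℝ p μ, (¬μ Set.univ < ∞ → h₁ = 0) ∧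
      (μ Set.univ < ∞ → (h₁ : EuclideanSpace ℝ (Fin d) →ₘ[μ] ℝ) = h) := by
    by_cases hfin : μ Set.univ < ∞
    · have hbd := hC₂.rbmoBound w' h (‖w'‖ + 1) (by positivity) hh (by linarith)
      exact ⟨⟨h, Lp.mem_Lp_iff_eLpNorm_lt_top.2
        (hbd.memLp D hfin (AEEqFun.aestronglyMeasurable h) hp hp').2⟩,
        fun h => absurd hfin h, fun _ => rfl⟩
    · exact ⟨0, fun _ => rfl, fun h => absurd h hfin⟩
  obtain ⟨S, hSw, hS⟩ := hC.exists_extension D hp hp' hw hh₁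
  refine ⟨S, hC.extension_eq D hp hp' hS, ?_⟩
  by_cases hfin : μ Set.univ < ∞
  · exact mkQ_extension_eq_of_finite hT hp hp' hS hfin hw hw' (by rw [hSw, hh₁' hfin, hh])
  · exact mkQ_extension_eq_of_infinite D hT hC₂ hp hp' hS hfin
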